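/- **Setting.** Let $\mathbb O$ be the Cayley numbers, with orthonormal basis $e_0=1,e_1,\dots,e_7$, where $e_i^2=-1$ for $i\ge 1$ and $e_ae_b=e_c=-e_be_a$ for every cyclic permutation $(a,b,c)$ of $(1,2,3),(1,4,5),(1,7,6),(2,4,6),(2,5,7),(3,4,7),(3,6,5)$. Let $\mathsf G_2=\mathrm{Aut}(\mathbb O)\subset\mathsf{SO}(7)$, and write $7\times7$ matrices with respect to $e_1,\dots,e_7$, the $i$-th row being the coordinates of the image of $e_i$. Let $\mathsf{SU}(2)\subset \mathsf G_2$ be the subgroup fixing $e_1$ and $e_3$, and let $\mathsf O(6)\cap\mathsf G_2$ be the subgroup of $\mathsf G_2$ mapping $e_1$ to $\pm e_1$. Identify $e^{i\theta}$ with $R(\theta)=\begin{pmatrix}\cos\theta&\sin\theta\\-\sin\theta&\cos\theta\end{pmatrix}\in\mathsf{SO}(2)$, and put $\mathsf G=\mathsf{SO}(2)\times\mathsf G_2$. Let $k$ be an odd integer, $m=\frac{k+1}2$, $n=\frac{-k+1}2$. Let $\Sigma_k$ be obtained from two copies of $\mathbb O\times\mathbb S^7$, with coordinates $(u,v)$ and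 $(u',v')$, by gluing along $u\neq0$ via $$(u',v')=\left(\frac{u}{|u|^2},\ \frac{u^m v\,u^n}{|u|^{m+n}}\right).$$ The group $\mathsf G_2$ acts on $\Sigma_k$ by $g(u,v)=(gu,gv)$, $g(u',v')=(gu',gv')$. The element $\gamma=\begin{pmatrix}a&b\\-b&a\end{pmatrix}\in\mathsf{SO}(2)$ acts by $$\gamma\star(u,v)=\left((au+b)(-bu+a)^{-1},\ \frac{(-bu+a)^m v(-bu+a)^n}{|-bu+a|^{m+n}}\right),$$ $$\gamma\star(u',v')=\left((-b+au')(a+bu')^{-1},\ \frac{(a+b\bar u')^m v'(a+b\bar u')^n}{|a+b\bar u'|^{m+n}}\right),$$ extended continuously to the points where a denominator vanishes: if $a-bu=0$, then $\gamma\star(u,v)$ is the point $(u',v')=\bigl(0,\frac{(au+b)^mv(au+b)^n}{|au+b|^{m+n}}\bigr)$; if $a+bu'=0$, then $\gamma\star(u',v')$ is the point $(u,v)=\bigl(0,\frac{(a\bar u'-b)^mv'(a\bar u'-b)^n}{|a\bar u'-b|^{m+n}}\bigr)$. Let $$\mathbb S^{13}_k=\{x\in\Sigma_k:\ \Re v=\Re(uv)=0,\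 \Re v'=\Re(u'(v')^{-1})=0\},$$ each condition being imposed where the respective coordinates are defined. This set is $\mathsf G$-invariant. Let $P^{13}_k=\mathbb S^{13}_k/T$, where $T(u,v)=(u,-v)$ and $T(u',v')=(u',-v')$, with the induced $\mathsf G$-action. **Theorem.** (A) The action of $\mathsf G$ on $\mathbb S^{13}_k$ has cohomogeneity one: it is continuous, and $t\mapsto\mathsf G\cdot(te_3,e_1)$ (in the $(u,v)$-chart) is a homeomorphism from $[0,1]$ onto the orbit space. Its isotropy groups are as follows. 1. At $(u,v)=(e_3,e_1)$, the isotropy group is $K=\mathsf{SO}(2)\mathsf{SU}(2)=\{(e^{i\theta},\mathrm{diag}\{R(k\theta),1,A\})\}$. 2. At $(u,v)=(u_1,e_1)$ with $u_1\in\mathbb R$, and at $(u',v')=(0,e_1)$, it is $L=\mathsf O(6)\cap\mathsf G_2=\{(\det B,\mathrm{diag}\{\det B,B\}) : B\in\mathsf O(6)\}$. 3. At $(u,v)=(u_1+u_2e_3,e_1)$ with $(u_1,u_2)\in\mathbb R\times(0,\infty)$, $(u_1,u_2)\ne(0,1)$, it is $H=\mathbb Z_2\cdot\mathsf{SU}(2)=\{(\varepsilon,\mathrm{diag}\{\varepsilon,\varepsilon,1,A\}):\varepsilon=\pm1\}$.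 Here $\theta\in\mathbb R$, $A$ is a $4\times4$ matrix, $\pm1\in\mathsf{SO}(2)$ denotes $\pm I_2$, and only pairs whose second entry lies in $\mathsf G_2$ are meant. (B) The names of these groups have the following meaning. The group $\mathsf{SU}(2)\subset\mathsf G_2$ is isomorphic, as a topological group, to the special unitary group of degree $2$. There is a continuous homomorphism $\sigma:\mathsf{SO}(2)\to\mathsf G_2$ with $K=\{(\gamma,\sigma(\gamma)s):\gamma\in\mathsf{SO}(2),\ s\in\mathsf{SU}(2)\}$. The projection to $\mathsf G_2$ maps $L$ bijectively onto $\mathsf O(6)\cap\mathsf G_2$. There is $\tau\in\mathsf G_2$ with $\tau^2=1$ and $H=\{(1,s),(-1,\tau s):s\in\mathsf{SU}(2)\}$. (C) The action of $\mathsf G$ on $P^{13}_k$ has cohomogeneity one in the same sense, with the images of the points $(te_3,e_1)$, $t\in[0,1]$. At the images of the points in 1, 2, 3 its isotropy groups are, respectively, $$\bar K=\{(e^{i\theta},\mathrm{diag}\{\varepsilon R(k\theta),1,A\})\},\quad \bar L=\{(\varepsilon,\mathrm{diag}\{\det B,B\}) : B\in\mathsf O(6)\},\quad \bar H=\{(\varepsilon_1,\mathrm{diag}\{\varepsilon_2,\varepsilon_2,1,A\})\}$$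 with $\varepsilon,\varepsilon_1,\varepsilon_2=\pm1$ and the same conventions. With $z=(-1,1)\in\mathsf G$ one has $\bar K=K\cup zK$, $\bar L=L\cup zL$ and $\bar H=H\cup zH$. -/

import Mathlib

noncomputable section

namespace Shimada

/-- The Cayley numbers as a Euclidean space with orthonormal basis `e 0 = 1, e 1, …, e 7`. -/
abbrev Oct : Type := EuclideanSpace ℝ (Fin 8)

namespace Oct

/-- The basis vectors of the Cayley numbers. -/
def e (i : Fin 8) : Oct := EuclideanSpace.single i 1

/-- The unit of the Cayley numbers is `e 0`. -/
instance : One Oct := ⟨e 0⟩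

/-- The multiplication of the Cayley numbers: `e i * e i = -1` for `i ≠ 0`, and
`e a * e b = e c = - e b * e a` whenever `(a, b, c)` is a cyclic permutation of one of
`(1,2,3)`, `(1,4,5)`, `(1,7,6)`, `(2,4,6)`, `(2,5,7)`, `(3,4,7)`, `(3,6,5)`. -/
def mul (x y : Oct) : Oct := !₂[
  x 0 * y 0 - x 1 * y 1 - x 2 * y 2 - x 3 * y 3 - x 4 * y 4 - x 5 * y 5 - x 6 * y 6 - x 7 * y 7,
  x 0 * y 1 + x 1 * y 0 + (x 2 * y 3 - x 3 * y 2) + (x 4 * y 5 - x 5 * y 4)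
    + (x 7 * y 6 - x 6 * y 7),
  x 0 * y 2 + x 2 * y 0 + (x 3 * y 1 - x 1 * y 3) + (x 4 * y 6 - x 6 * y 4)
    + (x 5 * y 7 - x 7 * y 5),
  x 0 * y 3 + x 3 * y 0 + (x 1 * y 2 - x 2 * y 1) + (x 4 * y 7 - x 7 * y 4)
    + (x 6 * y 5 - x 5 * y 6),
  x 0 * y 4 + x 4 * y 0 + (x 5 * y 1 - x 1 * y 5) + (x 6 * y 2 - x 2 * y 6)
    + (x 7 * y 3 - x 3 * y 7),
  x 0 * y 5 + x 5 * y 0 + (x 1 * y 4 - x 4 * y 1) + (x 7 * y 2 - x 2 * y 7)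
    + (x 3 * y 6 - x 6 * y 3),
  x 0 * y 6 + x 6 * y 0 + (x 1 * y 7 - x 7 * y 1) + (x 2 * y 4 - x 4 * y 2)
    + (x 5 * y 3 - x 3 * y 5),
  x 0 * y 7 + x 7 * y 0 + (x 6 * y 1 - x 1 * y 6) + (x 2 * y 5 - x 5 * y 2)
    + (x 3 * y 4 - x 4 * y 3)]

instance : Mul Oct := ⟨mul⟩

/-- The conjugation, which changes the sign of the imaginary part. -/
def conj (x : Oct) : Oct := !₂[x 0, -x 1, -x 2, -x 3, -x 4, -x 5, -x 6, -x 7]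

/-- The inverse `x⁻¹ = conj x / |x|²`. -/
instance : Inv Oct := ⟨fun x => (‖x‖ ^ 2)⁻¹ • conj x⟩

/-- Powers with a natural exponent. -/
def npow (x : Oct) : ℕ → Oct
  | 0 => 1
  | n + 1 => npow x n * x

/-- Powers with an integer exponent. -/
instance : Pow Oct ℤ := ⟨fun x m => match m with
  | Int.ofNat n => npow x n
  | Int.negSucc n => npow x⁻¹ (n + 1)⟩

theorem mul_def (x y : Oct) : x * y = mul x y := rfl

theorem one_def : (1 : Oct) = !₂[1, 0, 0, 0, 0, 0, 0, 0] := by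
  change e 0 = _
  ext i; fin_cases i <;> simp [e]

theorem ext8 {x y : Oct} (h0 : x 0 = y 0) (h1 : x 1 = y 1) (h2 : x 2 = y 2) (h3 : x 3 = y 3)
    (h4 : x 4 = y 4) (h5 : x 5 = y 5) (h6 : x 6 = y 6) (h7 : x 7 = y 7) : x = y := by
  ext i; fin_cases i <;> assumption

theorem norm_sq_eq (x : Oct) : ‖x‖ ^ 2 = x 0 ^ 2 + x 1 ^ 2 + x 2 ^ 2 + x 3 ^ 2 + x 4 ^ 2
    + x 5 ^ 2 + x 6 ^ 2 + x 7 ^ 2 := by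
  simp [EuclideanSpace.norm_sq_eq, Fin.sum_univ_eight]

theorem mul_add' (x y z : Oct) : x * (y + z) = x * y + x * z := by
  apply ext8 <;> simp [mul_def, mul] <;> ring
theorem add_mul' (x y z : Oct) : (x + y) * z = x * z + y * z := by
  apply ext8 <;> simp [mul_def, mul] <;> ring
theorem smul_mul' (r : ℝ) (x y : Oct) : (r • x) * y = r • (x * y) := by
  apply ext8 <;> simp [mul_def, mul] <;> ring
theorem mul_smul' (r : ℝ) (x y : Oct) : x * (r • y) = r • (x * y) := by
  apply ext8 <;> simp [mul_def, mul] <;> ring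
theorem one_mul' (x : Oct) : 1 * x = x := by
  apply ext8 <;> simp [mul_def, mul, one_def]
theorem mul_one' (x : Oct) : x * 1 = x := by
  apply ext8 <;> simp [mul_def, mul, one_def]
theorem left_alt (x y : Oct) : x * (x * y) = (x * x) * y := by
  apply ext8 <;> simp [mul_def, mul] <;> ring
theorem right_alt (x y : Oct) : (y * x) * x = y * (x * x) := by
  apply ext8 <;> simp [mul_def, mul] <;> ring
theorem flexible (x y : Oct) : (x * y) * x = x * (y * x) := by
  apply ext8 <;> simp [mul_def, mul] <;> ring
theorem norm_mul' (x y : Oct) : ‖x * y‖ = ‖x‖ * ‖y‖ := by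
  have : ‖x * y‖ ^ 2 = (‖x‖ * ‖y‖) ^ 2 := by
    rw [mul_pow, norm_sq_eq, norm_sq_eq, norm_sq_eq]
    simp [mul_def, mul]; ring
  exact (sq_eq_sq₀ (norm_nonneg _) (by positivity)).1 this
theorem imag_sq (x : Oct) (hx : x 0 = 0) : x * x = -(‖x‖ ^ 2) • (1 : Oct) := by
  rw [norm_sq_eq]
  apply ext8 <;> simp [mul_def, mul, one_def, hx] <;> ring

/-- The real subalgebra generated by an imaginary unit `J`, parametrized by `ℂ`. -/
def cx (J : Oct) (z : ℂ) : Oct := z.re • (1 : Oct) + z.im • J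

/-- The imaginary units. -/
def IsImUnit (J : Oct) : Prop := J 0 = 0 ∧ ‖J‖ = 1

theorem IsImUnit.sq {J : Oct} (hJ : IsImUnit J) : J * J = (-1 : ℝ) • (1 : Oct) := by
  rw [imag_sq J hJ.1, hJ.2]; norm_num

theorem cx_mul_cx_mul {J : Oct} (hJ : IsImUnit J) (z w : ℂ) (y : Oct) :
    cx J z * (cx J w * y) = cx J (z * w) * y := by
  simp only [cx, add_mul', mul_add', smul_mul', mul_smul', one_mul', left_alt, hJ.sq,
    Complex.mul_re, Complex.mul_im]
  module

theorem mul_cx_mul_cx {J : Oct} (hJ : IsImUnit J) (z w : ℂ) (y : Oct) :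
    (y * cx J z) * cx J w = y * cx J (z * w) := by
  simp only [cx, add_mul', mul_add', smul_mul', mul_smul', mul_one', right_alt, hJ.sq,
    Complex.mul_re, Complex.mul_im]
  module

theorem cx_mul_mul_cx {J : Oct} (z w : ℂ) (y : Oct) :
    (cx J z * y) * cx J w = cx J z * (y * cx J w) := by
  simp only [cx, add_mul', mul_add', smul_mul', mul_smul', one_mul', mul_one', flexible]

theorem cx_one (J : Oct) : cx J 1 = 1 := by simp [cx]

theorem cx_zero (J : Oct) : cx J 0 = 0 := by simp [cx]

theorem cx_add (J : Oct) (z w : ℂ) : cx J (z + w) = cx J z + cx J w := by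
  simp only [cx, Complex.add_re, Complex.add_im]; module

theorem cx_smul (J : Oct) (r : ℝ) (z : ℂ) : cx J (r * z) = r • cx J z := by
  simp only [cx, Complex.re_ofReal_mul, Complex.im_ofReal_mul]; module

theorem cx_ofReal (J : Oct) (r : ℝ) : cx J r = r • (1 : Oct) := by
  simp [cx]

theorem cx_mul_cx {J : Oct} (hJ : IsImUnit J) (z w : ℂ) : cx J z * cx J w = cx J (z * w) := by
  have := cx_mul_cx_mul hJ z w 1
  rwa [mul_one', mul_one'] at this

theorem norm_cx {J : Oct} (hJ : IsImUnit J) (z : ℂ) : ‖cx J z‖ = ‖z‖ := by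
  have h1 : ‖J‖ ^ 2 = 1 := by rw [hJ.2]; norm_num
  have : ‖cx J z‖ ^ 2 = ‖z‖ ^ 2 := by
    rw [norm_sq_eq] at h1 ⊢
    rw [Complex.sq_norm, Complex.normSq_apply]
    have h0 := hJ.1
    simp only [cx, one_def, PiLp.add_apply, PiLp.smul_apply, smul_eq_mul, h0] at *
    simp
    linear_combination z.im ^ 2 * h1
  exact (sq_eq_sq₀ (norm_nonneg _) (norm_nonneg _)).1 this

theorem cx_eq_zero {J : Oct} (hJ : IsImUnit J) {z : ℂ} : cx J z = 0 ↔ z = 0 := by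
  rw [← norm_eq_zero, norm_cx hJ, norm_eq_zero]

theorem conj_cx {J : Oct} (hJ : IsImUnit J) (z : ℂ) :
    conj (cx J z) = cx J (starRingEnd ℂ z) := by
  have h0 := hJ.1
  apply ext8 <;> simp [conj, cx, one_def, h0]

theorem inv_def (x : Oct) : x⁻¹ = (‖x‖ ^ 2)⁻¹ • conj x := rfl

theorem inv_cx {J : Oct} (hJ : IsImUnit J) (z : ℂ) : (cx J z)⁻¹ = cx J z⁻¹ := by
  rw [inv_def, norm_cx hJ, conj_cx hJ, Complex.inv_def, ← cx_smul, mul_comm, Complex.normSq_eq_norm_sq]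

theorem npow_cx {J : Oct} (hJ : IsImUnit J) (z : ℂ) (n : ℕ) : npow (cx J z) n = cx J (z ^ n) := by
  induction n with
  | zero => simp [npow, cx_one]
  | succ n ih => rw [npow, ih, cx_mul_cx hJ, pow_succ]

theorem zpow_cx {J : Oct} (hJ : IsImUnit J) (z : ℂ) (m : ℤ) : (cx J z) ^ m = cx J (z ^ m) := by
  cases m with
  | ofNat n => exact (npow_cx hJ z n).trans (by simp)
  | negSucc n =>
    refine Eq.trans (b := npow (cx J z)⁻¹ (n + 1)) rfl ?_
    rw [inv_cx hJ, npow_cx hJ, zpow_negSucc, inv_pow]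

theorem exists_cx (x : Oct) : ∃ J z, IsImUnit J ∧ x = cx J z := by
  set y : Oct := x - x 0 • (1 : Oct) with hy
  have y0 : y 0 = 0 := by simp [hy, one_def]
  by_cases h : y = 0
  · refine ⟨e 1, (x 0 : ℝ), ⟨by simp [e], by simp [e]⟩, ?_⟩
    rw [cx_ofReal]; exact sub_eq_zero.1 h
  · have hn : ‖y‖ ≠ 0 := norm_ne_zero_iff.2 h
    refine ⟨‖y‖⁻¹ • y, ⟨x 0, ‖y‖⟩, ⟨by simp [y0], ?_⟩, ?_⟩
    · rw [norm_smul, norm_inv, norm_norm, inv_mul_cancel₀ hn]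
    · simp only [cx]; rw [smul_smul, mul_inv_cancel₀ hn, hy]; module

end Oct
open Oct

/-- The unit sphere of the Cayley numbers. -/
abbrev S7 : Type := Metric.sphere (0 : Oct) 1

theorem zpow_mul_mul_norm (m n : ℤ) (x v : Oct) :
    ‖(x ^ m * v) * x ^ n‖ = ‖x‖ ^ m * ‖v‖ * ‖x‖ ^ n := by
  obtain ⟨J, z, hJ, rfl⟩ := exists_cx x
  simp [norm_mul', zpow_cx hJ, norm_cx hJ]

/-- The unit vector `x ^ m v x ^ n / |x| ^ (m + n)` for `x ≠ 0`; the value for `x = 0` is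
irrelevant. -/
def twist (m n : ℤ) (x : Oct) (v : S7) : S7 :=
  open Classical in
  if hx : x ≠ 0 then
    ⟨(‖x‖ ^ (m + n))⁻¹ • ((x ^ m * (v : Oct)) * x ^ n), by
      have h := norm_pos_iff.2 hx
      have hv : ‖(v : Oct)‖ = 1 := norm_eq_of_mem_sphere v
      rw [mem_sphere_zero_iff_norm, norm_smul, zpow_mul_mul_norm, hv, norm_inv, norm_zpow,
        norm_norm, zpow_add₀ h.ne']
      field_simp⟩
  else v

/-- The gluing relation of the two copies of `𝕆 × S⁷`: a point `(u, v)` with `u ≠ 0` is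
identified with `(u / |u|², u ^ m v u ^ n / |u| ^ (m + n))`. -/
inductive Glue (m n : ℤ) : (Oct × S7) ⊕ (Oct × S7) → (Oct × S7) ⊕ (Oct × S7) → Prop
  | glue (u : Oct) (v : S7) (hu : u ≠ 0) :
      Glue m n (Sum.inl (u, v)) (Sum.inr ((‖u‖ ^ 2)⁻¹ • u, twist m n u v))

/-- The total space of the bundle of 7-spheres over the 8-sphere. -/
def E (m n : ℤ) : Type := Quot (Glue m n)

/-- The total space has the quotient topology. -/
instance (m n : ℤ) : TopologicalSpace (E m n) := inferInstanceAs (TopologicalSpace (Quot _))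

/-- The chart with coordinates `(u, v)`. -/
def chart (m n : ℤ) (u : Oct) (v : S7) : E m n := Quot.mk _ (Sum.inl (u, v))

/-- The chart with coordinates `(u', v')`. -/
def chart' (m n : ℤ) (u : Oct) (v : S7) : E m n := Quot.mk _ (Sum.inr (u, v))

theorem E.ind {m n : ℤ} {P : E m n → Prop} (h : ∀ u v, P (chart m n u v))
    (h' : ∀ u v, P (chart' m n u v)) (x : E m n) : P x := by
  induction x using Quot.ind with
  | mk x => rcases x with ⟨u, v⟩ | ⟨u, v⟩
            · exact h u v
            · exact h' u v

theorem chart_eq (m n : ℤ) (u : Oct) (v : S7) (hu : u ≠ 0) :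
    chart m n u v = chart' m n ((‖u‖ ^ 2)⁻¹ • u) (twist m n u v) :=
  Quot.sound (Glue.glue u v hu)

theorem coe_twist_cx (m n : ℤ) {J : Oct} (hJ : IsImUnit J) {z : ℂ} (hz : z ≠ 0) (v : S7) :
    (twist m n (cx J z) v : Oct)
      = (‖z‖ ^ (m + n))⁻¹ • ((cx J (z ^ m) * (v : Oct)) * cx J (z ^ n)) := by
  rw [twist, dif_pos (by rwa [Ne, cx_eq_zero hJ])]
  simp [norm_cx hJ, zpow_cx hJ]

theorem twist_twist (m n : ℤ) {J : Oct} (hJ : IsImUnit J) {z w : ℂ} (hz : z ≠ 0) (hw : w ≠ 0)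
    (v : S7) : twist m n (cx J z) (twist m n (cx J w) v) = twist m n (cx J (z * w)) v := by
  ext1
  rw [coe_twist_cx m n hJ hz, coe_twist_cx m n hJ hw, coe_twist_cx m n hJ (mul_ne_zero hz hw)]
  rw [mul_smul', smul_mul', smul_smul, norm_mul, mul_zpow, mul_zpow, mul_zpow, mul_inv,
    ← cx_mul_mul_cx, cx_mul_cx_mul hJ, mul_cx_mul_cx hJ, mul_comm (w ^ n)]

theorem twist_one (m n : ℤ) (v : S7) : twist m n 1 v = v := by
  have hJ : IsImUnit (e 1) := ⟨by simp [e], by simp [e]⟩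
  ext1
  rw [← cx_one (e 1), coe_twist_cx m n hJ one_ne_zero]
  simp [cx_one, one_mul', mul_one']

/-- The point with homogeneous base coordinates `(p, q)` in the plane of `J`. -/
def hpt (m n : ℤ) (J : Oct) (p q : ℂ) (v : S7) : E m n :=
  open Classical in
  if q ≠ 0 then chart m n (cx J (p * q⁻¹)) (twist m n (cx J q) v)
  else chart' m n 0 (twist m n (cx J p) v)

theorem chart_cx (m n : ℤ) {J : Oct} (z : ℂ) (v : S7) :
    chart m n (cx J z) v = hpt m n J z 1 v := by
  simp [hpt, cx_one, twist_one]

theorem normSq_inv_smul_cx {J : Oct} (hJ : IsImUnit J) (z : ℂ) :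
    (‖cx J z‖ ^ 2)⁻¹ • cx J z = cx J ((starRingEnd ℂ z)⁻¹) := by
  rw [norm_cx hJ, ← cx_smul, Complex.inv_def, Complex.conj_conj, Complex.normSq_conj,
    Complex.normSq_eq_norm_sq, mul_comm]

theorem chart'_cx (m n : ℤ) {J : Oct} (hJ : IsImUnit J) (z : ℂ) (v : S7) :
    chart' m n (cx J z) v = hpt m n J 1 (starRingEnd ℂ z) v := by
  by_cases hz : z = 0
  · simp [hpt, hz, cx_one, twist_one, cx_zero]
  · have h : starRingEnd ℂ z ≠ 0 := by simpa using hz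
    rw [hpt, if_pos h, chart_eq _ _ _ _ (by rw [Ne, cx_eq_zero hJ]; simpa using hz),
      normSq_inv_smul_cx hJ, one_mul, twist_twist _ _ hJ (inv_ne_zero h) h, inv_mul_cancel₀ h,
      cx_one, twist_one, map_inv₀, Complex.conj_conj, inv_inv]

theorem hpt_twist (m n : ℤ) {J : Oct} (hJ : IsImUnit J) {p q c : ℂ} (hpq : p ≠ 0 ∨ q ≠ 0)
    (hc : c ≠ 0) (v : S7) :
    hpt m n J p q (twist m n (cx J c) v) = hpt m n J (p * c) (q * c) v := by
  by_cases hq : q = 0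
  · have hp : p ≠ 0 := by tauto
    simp [hpt, hq, twist_twist m n hJ hp hc]
  · simp only [hpt, ne_eq, hq, not_false_eq_true, if_true, mul_ne_zero hq hc,
      twist_twist m n hJ hq hc]
    congr 2
    field_simp

/-- The group `SO(2)`. -/
abbrev SO2 : Type := Matrix.specialOrthogonalGroup (Fin 2) ℝ

theorem SO2.entries (γ : SO2) : γ.1 1 0 = -γ.1 0 1 ∧ γ.1 1 1 = γ.1 0 0 ∧
    γ.1 0 0 ^ 2 + γ.1 0 1 ^ 2 = 1 := by
  obtain ⟨g, hg⟩ := γ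
  obtain ⟨h1, h2⟩ := Matrix.mem_specialOrthogonalGroup_iff.1 hg
  have h3 := (Matrix.mem_orthogonalGroup_iff _ _).1 h1
  have h00 := congrFun (congrFun h3 0) 0
  have h01 := congrFun (congrFun h3 0) 1
  have h11 := congrFun (congrFun h3 1) 1
  simp [Matrix.mul_apply, Fin.sum_univ_two] at h00 h01 h11
  rw [Matrix.det_fin_two] at h2
  simp only
  refine ⟨?_, ?_, by linarith⟩
  · linear_combination (-g 1 0) * h00 + g 0 0 * h01 - g 0 1 * h2
  · linear_combination (-g 1 1) * h00 + g 0 1 * h01 + g 0 0 * h2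

/-- The action of `γ = !![a, b; -b, a]` on the two charts. Where the image has second coordinate
`u' = 0`, that is for `a - b u = 0`, it is written in the chart `(u', v')`, and likewise for
`a + b u' = 0`. -/
def so2Fun (m n : ℤ) (γ : SO2) : (Oct × S7) ⊕ (Oct × S7) → E m n :=
  open Classical in fun x =>
  let a : ℝ := γ.1 0 0
  let b : ℝ := γ.1 0 1
  match x with
  | Sum.inl (u, v) =>
      if a • (1 : Oct) - b • u ≠ 0 then
        chart m n ((a • u + b • (1 : Oct)) * (a • (1 : Oct) - b • u)⁻¹)
          (twist m n (a • (1 : Oct) - b • u) v)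
      else chart' m n 0 (twist m n (a • u + b • (1 : Oct)) v)
  | Sum.inr (u, v) =>
      if a • (1 : Oct) + b • u ≠ 0 then
        chart' m n ((a • u - b • (1 : Oct)) * (a • (1 : Oct) + b • u)⁻¹)
          (twist m n (a • (1 : Oct) + b • conj u) v)
      else chart m n 0 (twist m n (a • conj u - b • (1 : Oct)) v)

theorem so2Fun_inl (m n : ℤ) (γ : SO2) {J : Oct} (hJ : IsImUnit J) (z : ℂ) (v : S7) :
    so2Fun m n γ (Sum.inl (cx J z, v))
      = hpt m n J (γ.1 0 0 * z + γ.1 0 1) (-γ.1 0 1 * z + γ.1 0 0) v := by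
  have h1 : γ.1 0 0 • cx J z + γ.1 0 1 • (1 : Oct) = cx J (γ.1 0 0 * z + γ.1 0 1) := by
    rw [cx_add, cx_smul, cx_ofReal]
  have h2 : γ.1 0 0 • (1 : Oct) - γ.1 0 1 • cx J z = cx J (-γ.1 0 1 * z + γ.1 0 0) := by
    rw [cx_add, ← Complex.ofReal_neg, cx_smul, cx_ofReal]; module
  simp only [so2Fun, h1, h2, hpt, Ne, cx_eq_zero hJ, inv_cx hJ, cx_mul_cx hJ]

theorem so2Fun_inr (m n : ℤ) (γ : SO2) {J : Oct} (hJ : IsImUnit J) (z : ℂ) (v : S7) :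
    so2Fun m n γ (Sum.inr (cx J z, v))
      = hpt m n J (γ.1 0 0 + γ.1 0 1 * starRingEnd ℂ z)
        (-γ.1 0 1 + γ.1 0 0 * starRingEnd ℂ z) v := by
  set w := starRingEnd ℂ z with hw
  have hz : z = starRingEnd ℂ w := by simp [hw]
  obtain ⟨-, -, hab⟩ := SO2.entries γ
  set a := γ.1 0 0 with ha
  set b := γ.1 0 1 with hb
  have h1 : a • cx J z - b • (1 : Oct) = cx J (starRingEnd ℂ (-b + a * w)) := by
    have : starRingEnd ℂ (-b + a * w) = ((-b : ℝ) : ℂ) + a * z := by simp [hz]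
    rw [this, cx_add, cx_smul, cx_ofReal]; module
  have h2 : a • (1 : Oct) + b • cx J z = cx J (starRingEnd ℂ (a + b * w)) := by
    have : starRingEnd ℂ (a + b * w) = (a : ℂ) + b * z := by simp [hz]
    rw [this, cx_add, cx_smul, cx_ofReal]
  have h3 : a • (1 : Oct) + b • conj (cx J z) = cx J (a + b * w) := by
    rw [conj_cx hJ, ← hw, cx_add, cx_smul, cx_ofReal]
  have h4 : a • conj (cx J z) - b • (1 : Oct) = cx J (-b + a * w) := by
    rw [conj_cx hJ, ← hw, cx_add, cx_smul, ← Complex.ofReal_neg, cx_ofReal]; module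
  simp only [so2Fun, ← ha, ← hb, h1, h2, h3, h4, Ne, cx_eq_zero hJ, inv_cx hJ, cx_mul_cx hJ,
    map_eq_zero]
  by_cases h : (a : ℂ) + b * w = 0
  · rw [if_neg (by simpa using h)]
    have hne : (-b + a * w : ℂ) ≠ 0 := by
      intro h'
      have : ((a ^ 2 + b ^ 2 : ℝ) : ℂ) = 0 := by
        push_cast; linear_combination a * h - b * h'
      rw [hab] at this; simp at this
    rw [hpt, if_pos hne, h, zero_mul, cx_zero]
  · rw [if_pos (by simpa using h), chart'_cx m n hJ, hpt_twist m n hJ (Or.inl one_ne_zero) h]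
    congr 1
    · simp
    · simp only [map_mul, map_inv₀, Complex.conj_conj]
      field_simp

/-- The Möbius action of `SO(2)` on the bundle. -/
def so2Act (m n : ℤ) (γ : SO2) : E m n → E m n :=
  Quot.lift (so2Fun m n γ) (by
    rintro _ _ ⟨u, v, hu⟩
    obtain ⟨J, z, hJ, rfl⟩ := exists_cx u
    have hz : z ≠ 0 := by rwa [Ne, cx_eq_zero hJ] at hu
    obtain ⟨-, -, hab⟩ := SO2.entries γ
    rw [normSq_inv_smul_cx hJ, so2Fun_inl m n γ hJ, so2Fun_inr m n γ hJ, hpt_twist m n hJ _ hz]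
    · congr 1
      · simp; field_simp
      · simp; field_simp
    · by_contra! h
      simp only [map_inv₀, Complex.conj_conj] at h
      obtain ⟨h, h'⟩ := h
      have : ((γ.1 0 0 ^ 2 + γ.1 0 1 ^ 2 : ℝ) : ℂ) = 0 := by
        push_cast; linear_combination γ.1 0 0 * h - γ.1 0 1 * h'
      rw [hab] at this; simp at this)

theorem so2Act_hpt (m n : ℤ) (γ : SO2) {J : Oct} (hJ : IsImUnit J) {p q : ℂ}
    (hpq : p ≠ 0 ∨ q ≠ 0) (v : S7) :
    so2Act m n γ (hpt m n J p q v)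
      = hpt m n J (γ.1 0 0 * p + γ.1 0 1 * q) (-γ.1 0 1 * p + γ.1 0 0 * q) v := by
  obtain ⟨-, -, hab⟩ := SO2.entries γ
  have key : ∀ p q : ℂ, p ≠ 0 ∨ q ≠ 0 → (γ.1 0 0 * p + γ.1 0 1 * q ≠ 0 ∨
      -γ.1 0 1 * p + γ.1 0 0 * q ≠ 0) := by
    intro p q hpq
    by_contra! h
    obtain ⟨h, h'⟩ := h
    have hab' : (γ.1 0 0 ^ 2 + γ.1 0 1 ^ 2 : ℂ) = 1 := by exact_mod_cast hab
    have hp : p = 0 := by linear_combination γ.1 0 0 * h - γ.1 0 1 * h' - p * hab'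
    have hq : q = 0 := by linear_combination γ.1 0 1 * h + γ.1 0 0 * h' - q * hab'
    tauto
  by_cases hq : q = 0
  · have hp : p ≠ 0 := by tauto
    have h1 : hpt m n J p q v = chart' m n (cx J 0) (twist m n (cx J p) v) := by
      simp [hpt, hq, cx_zero]
    rw [h1]
    refine (so2Fun_inr m n γ hJ _ _).trans ?_
    have := key 1 0 (by simp)
    rw [hpt_twist m n hJ (by simpa using this) hp]
    simp [hq]
  · have h1 : hpt m n J p q v = chart m n (cx J (p * q⁻¹)) (twist m n (cx J q) v) := by
      simp [hpt, hq]
    rw [h1]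
    refine (so2Fun_inl m n γ hJ _ _).trans ?_
    have := key (p * q⁻¹) 1 (by simp)
    rw [hpt_twist m n hJ (by simpa using this) hq]
    congr 1 <;> field_simp

theorem exists_hpt {m n : ℤ} (x : E m n) : ∃ J p q v, IsImUnit J ∧ (p ≠ 0 ∨ q ≠ 0) ∧
    x = hpt m n J p q v := by
  induction x using E.ind with
  | h u v =>
    obtain ⟨J, z, hJ, rfl⟩ := exists_cx u
    exact ⟨J, z, 1, v, hJ, Or.inr one_ne_zero, chart_cx m n z v⟩
  | h' u v =>
    obtain ⟨J, z, hJ, rfl⟩ := exists_cx u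
    exact ⟨J, 1, _, v, hJ, Or.inl one_ne_zero, chart'_cx m n hJ z v⟩

instance (m n : ℤ) : MulAction SO2 (E m n) where
  smul := so2Act m n
  one_smul x := by
    obtain ⟨J, p, q, v, hJ, hpq, rfl⟩ := exists_hpt x
    refine (so2Act_hpt m n 1 hJ hpq v).trans ?_
    simp
  mul_smul γ δ x := by
    obtain ⟨J, p, q, v, hJ, hpq, rfl⟩ := exists_hpt x
    refine (so2Act_hpt m n (γ * δ) hJ hpq v).trans ?_
    change _ = so2Act m n γ (so2Act m n δ _)
    obtain ⟨h1, h2, hab⟩ := SO2.entries δ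
    have hab' : (δ.1 0 0 ^ 2 + δ.1 0 1 ^ 2 : ℂ) = 1 := by exact_mod_cast hab
    rw [so2Act_hpt m n δ hJ hpq, so2Act_hpt m n γ hJ]
    · have e1 : (γ * δ).1 0 0 = γ.1 0 0 * δ.1 0 0 - γ.1 0 1 * δ.1 0 1 := by
        simp [Matrix.mul_apply, Fin.sum_univ_two, h1]; ring
      have e2 : (γ * δ).1 0 1 = γ.1 0 0 * δ.1 0 1 + γ.1 0 1 * δ.1 0 0 := by
        simp [Matrix.mul_apply, Fin.sum_univ_two, h2]
      rw [e1, e2]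
      congr 1
      · push_cast; ring
      · push_cast; ring
    · by_contra! h
      obtain ⟨h, h'⟩ := h
      have hp : p = 0 := by linear_combination δ.1 0 0 * h - δ.1 0 1 * h' - p * hab'
      have hq : q = 0 := by linear_combination δ.1 0 1 * h + δ.1 0 0 * h' - q * hab'
      tauto


/-- The automorphisms of the Cayley numbers, as a subgroup of the linear automorphisms. -/
def autOct : Subgroup (Oct ≃ₗ[ℝ] Oct) where
  carrier := {g | ∀ x y : Oct, g (x * y) = g x * g y}
  mul_mem' := by
    intro g h hg hh x y
    simp only [LinearEquiv.mul_apply]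
    rw [hh, hg]
  one_mem' := fun _ _ => rfl
  inv_mem' := by
    intro g hg x y
    apply g.injective
    rw [hg]
    change g (g.symm _) = g (g.symm _) * g (g.symm _)
    simp only [LinearEquiv.apply_symm_apply]

/-- The group `G₂`. -/
abbrev G2 : Type := autOct

/-- The topology of `G₂` as a group of linear maps. -/
instance : TopologicalSpace G2 :=
  TopologicalSpace.induced (fun (g : G2) (x : Oct) => g.1 x) inferInstance

theorem G2.map_mul (g : G2) (x y : Oct) : g.1 (x * y) = g.1 x * g.1 y := g.2 x y

theorem G2.map_one (g : G2) : g.1 1 = 1 := by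
  have h := g.map_mul 1 (g.1.symm 1)
  rw [one_mul', LinearEquiv.apply_symm_apply, mul_one'] at h
  exact h.symm

theorem quadratic (y : Oct) : y * y = (2 * y 0) • y - (‖y‖ ^ 2) • (1 : Oct) := by
  rw [norm_sq_eq]
  apply ext8 <;> simp [mul_def, mul, one_def] <;> ring

theorem G2.map_imag (g : G2) (x : Oct) (hx : x 0 = 0) : (g.1 x) 0 = 0 ∧ ‖g.1 x‖ = ‖x‖ := by
  have h1 : g.1 x * g.1 x = -(‖x‖ ^ 2) • (1 : Oct) := by
    rw [← g.map_mul, imag_sq x hx, map_smul, g.map_one]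
  have h2 := quadratic (g.1 x)
  have h3 : (2 * (g.1 x) 0) • g.1 x = (‖g.1 x‖ ^ 2 - ‖x‖ ^ 2) • (1 : Oct) := by
    rw [sub_smul, ← sub_eq_zero]
    rw [h1, ← sub_eq_zero] at h2
    rw [← neg_eq_zero, ← h2]
    module
  have h0 : (g.1 x) 0 = 0 := by
    by_contra hne
    have h4 : g.1 x = g.1 (((2 * (g.1 x) 0)⁻¹ * (‖g.1 x‖ ^ 2 - ‖x‖ ^ 2)) • (1 : Oct)) := by
      rw [map_smul, g.map_one, mul_smul, ← h3, smul_smul, inv_mul_cancel₀ (by simpa using hne),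
        one_smul]
    have h5 := g.1.injective h4
    have h6 := congrArg (fun y : Oct => y 0) h5
    rw [one_def] at h5
    simp [hx, one_def] at h6
    have h7 : x = 0 := by
      rw [h5]
      rcases h6 with h6 | h6 <;> simp [h6]
    rw [h7] at hne
    simp at hne
  refine ⟨h0, ?_⟩
  rw [h0] at h3
  simp only [mul_zero, zero_smul] at h3
  have h4 := congrArg (fun y : Oct => y 0) h3
  simp [one_def] at h4
  exact (sq_eq_sq₀ (norm_nonneg _) (norm_nonneg _)).1 (by linarith)

theorem G2.isImUnit (g : G2) {J : Oct} (hJ : IsImUnit J) : IsImUnit (g.1 J) :=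
  ⟨(g.map_imag J hJ.1).1, (g.map_imag J hJ.1).2.trans hJ.2⟩

theorem G2.map_cx (g : G2) (J : Oct) (z : ℂ) : g.1 (cx J z) = cx (g.1 J) z := by
  simp only [cx, map_add, map_smul, g.map_one]

theorem G2.norm_map (g : G2) (x : Oct) : ‖g.1 x‖ = ‖x‖ := by
  obtain ⟨J, z, hJ, rfl⟩ := exists_cx x
  rw [g.map_cx, norm_cx hJ, norm_cx (g.isImUnit hJ)]

/-- The action of `G₂` on the unit sphere. -/
def G2.sph (g : G2) (v : S7) : S7 :=
  ⟨g.1 v, by rw [mem_sphere_zero_iff_norm, g.norm_map]; exact norm_eq_of_mem_sphere v⟩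

theorem G2.sph_twist (g : G2) (m n : ℤ) {J : Oct} (hJ : IsImUnit J) {z : ℂ} (hz : z ≠ 0)
    (v : S7) : g.sph (twist m n (cx J z) v) = twist m n (cx (g.1 J) z) (g.sph v) := by
  ext1
  rw [coe_twist_cx m n (g.isImUnit hJ) hz]
  simp only [G2.sph]
  rw [coe_twist_cx m n hJ hz, map_smul, g.map_mul, g.map_mul, g.map_cx, g.map_cx]

/-- The action `g (u, v) = (g u, g v)`, `g (u', v') = (g u', g v')` of `G₂` on the bundle. -/
def g2Act (m n : ℤ) (g : G2) : E m n → E m n :=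
  Quot.lift (Sum.elim (fun p => chart m n (g.1 p.1) (g.sph p.2))
      (fun p => chart' m n (g.1 p.1) (g.sph p.2))) (by
    rintro _ _ ⟨u, v, hu⟩
    obtain ⟨J, z, hJ, rfl⟩ := exists_cx u
    have hz : z ≠ 0 := by rwa [Ne, cx_eq_zero hJ] at hu
    have hJ' := g.isImUnit hJ
    simp only [Sum.elim_inl, Sum.elim_inr]
    rw [g.sph_twist m n hJ hz, map_smul, g.map_cx, chart_eq, norm_cx hJ, norm_cx hJ']
    rwa [Ne, cx_eq_zero hJ'])

theorem g2Act_hpt (m n : ℤ) (g : G2) {J : Oct} (hJ : IsImUnit J) {p q : ℂ}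
    (hpq : p ≠ 0 ∨ q ≠ 0) (v : S7) :
    g2Act m n g (hpt m n J p q v) = hpt m n (g.1 J) p q (g.sph v) := by
  by_cases hq : q = 0
  · have hp : p ≠ 0 := by tauto
    simp only [hpt, hq, ne_eq, not_true_eq_false, if_false]
    refine Eq.trans (b := chart' m n (g.1 0) (g.sph (twist m n (cx J p) v))) rfl ?_
    rw [g.sph_twist m n hJ hp, map_zero]
  · simp only [hpt, hq, ne_eq, not_false_eq_true, if_true]
    refine Eq.trans (b := chart m n (g.1 (cx J (p * q⁻¹))) (g.sph (twist m n (cx J q) v))) rfl ?_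
    rw [g.sph_twist m n hJ hq, g.map_cx]

instance (m n : ℤ) : MulAction G2 (E m n) where
  smul := g2Act m n
  one_smul x := by
    change g2Act m n 1 x = x
    induction x using E.ind <;> rfl
  mul_smul g h x := by induction x using E.ind <;> rfl

/-- The group `G = SO(2) × G₂`. -/
abbrev G : Type := SO2 × G2

theorem so2_g2_comm {m n : ℤ} (γ : SO2) (g : G2) (x : E m n) : γ • g • x = g • γ • x := by
  obtain ⟨J, p, q, v, hJ, hpq, rfl⟩ := exists_hpt x
  obtain ⟨-, -, hab⟩ := SO2.entries γ
  change so2Act m n γ (g2Act m n g _) = g2Act m n g (so2Act m n γ _)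
  rw [g2Act_hpt m n g hJ hpq, so2Act_hpt m n γ (g.isImUnit hJ) hpq, so2Act_hpt m n γ hJ hpq,
    g2Act_hpt m n g hJ]
  by_contra! h
  obtain ⟨h, h'⟩ := h
  have hab' : (γ.1 0 0 ^ 2 + γ.1 0 1 ^ 2 : ℂ) = 1 := by exact_mod_cast hab
  have hp : p = 0 := by linear_combination γ.1 0 0 * h - γ.1 0 1 * h' - p * hab'
  have hq : q = 0 := by linear_combination γ.1 0 1 * h + γ.1 0 0 * h' - q * hab'
  tauto

/-- The action of `SO(2) × G₂` on the bundle. -/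
instance (m n : ℤ) : MulAction G (E m n) where
  smul g x := g.1 • g.2 • x
  one_smul x := by
    change (1 : SO2) • (1 : G2) • x = x
    rw [one_smul, one_smul]
  mul_smul g h x := by
    change (g.1 * h.1) • (g.2 * h.2) • x = g.1 • g.2 • h.1 • h.2 • x
    rw [mul_smul, mul_smul, so2_g2_comm h.1 g.2]

/-- The manifold `Σ_k = E_{m,n}` with `m = (k + 1) / 2` and `n = (-k + 1) / 2`, for `k` odd. -/
abbrev Sigma15 (k : ℤ) : Type := E ((k + 1) / 2) ((-k + 1) / 2)

/-- The points of `Σ_k` with `Re v = Re (u v) = 0` in the coordinates `(u, v)` and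
`Re v' = Re (u' v'⁻¹) = 0` in the coordinates `(u', v')`. -/
def S13Set (k : ℤ) : Set (Sigma15 k) :=
  {x | (∀ (u : Oct) (v : S7), x = chart _ _ u v → (v : Oct) 0 = 0 ∧ (u * (v : Oct)) 0 = 0) ∧
    ∀ (u' : Oct) (v' : S7), x = chart' _ _ u' v' →
      (v' : Oct) 0 = 0 ∧ (u' * (v' : Oct)⁻¹) 0 = 0}

theorem re_mul_comm (x y : Oct) : (x * y) 0 = (y * x) 0 := by
  simp [mul_def, mul]; ring

theorem re_conj (x y : Oct) : (x * conj y) 0 = (conj x * y) 0 := by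
  simp [mul_def, mul, conj]

theorem re_cx_twist {m n : ℤ} (h : m + n = 1) {J : Oct} (hJ : IsImUnit J) {z : ℂ} (hz : z ≠ 0)
    (w : ℂ) (v : S7) :
    (cx J w * (twist m n (cx J z) v : Oct)) 0 = ‖z‖⁻¹ * (cx J (w * z) * (v : Oct)) 0 := by
  rw [coe_twist_cx m n hJ hz, h, zpow_one, mul_smul', ← cx_mul_mul_cx, cx_mul_cx_mul hJ]
  simp only [PiLp.smul_apply, smul_eq_mul]
  rw [re_mul_comm, cx_mul_cx_mul hJ]
  rw [show z ^ n * (w * z ^ m) = w * z by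
    rw [mul_comm, mul_assoc, ← zpow_add₀ hz, h, zpow_one]]

/-- The defining conditions as a predicate on the total space. -/
def cond (m n : ℤ) (h : m + n = 1) : E m n → Prop :=
  Quot.lift (Sum.elim (fun p => (p.2 : Oct) 0 = 0 ∧ (p.1 * (p.2 : Oct)) 0 = 0)
      (fun p => (p.2 : Oct) 0 = 0 ∧ (p.1 * (p.2 : Oct)⁻¹) 0 = 0)) (by
    rintro _ _ ⟨u, v, hu⟩
    obtain ⟨J, z, hJ, rfl⟩ := exists_cx u
    have hz : z ≠ 0 := by rwa [Ne, cx_eq_zero hJ] at hu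
    have hz' : ‖z‖ ≠ 0 := norm_ne_zero_iff.2 hz
    simp only [Sum.elim_inl, Sum.elim_inr]
    rw [normSq_inv_smul_cx hJ, inv_def, mul_smul']
    have h1 := re_cx_twist h hJ hz 1 v
    rw [cx_one, one_mul', one_mul] at h1
    have h2 := re_cx_twist h hJ hz z⁻¹ v
    rw [inv_mul_cancel₀ hz, cx_one, one_mul'] at h2
    have h3 : ‖(twist m n (cx J z) v : Oct)‖ = 1 := norm_eq_of_mem_sphere _
    rw [PiLp.smul_apply, re_conj, conj_cx hJ, map_inv₀, Complex.conj_conj, h1, h2, h3]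
    simp [hz, and_comm])

theorem cond_hpt {m n : ℤ} (h : m + n = 1) {J : Oct} (hJ : IsImUnit J) {p q : ℂ}
    (hpq : p ≠ 0 ∨ q ≠ 0) (v : S7) :
    cond m n h (hpt m n J p q v) ↔ (cx J q * (v : Oct)) 0 = 0 ∧ (cx J p * (v : Oct)) 0 = 0 := by
  by_cases hq : q = 0
  · have hp : p ≠ 0 := by tauto
    simp only [hpt, hq, ne_eq, not_true_eq_false, if_false]
    have h1 := re_cx_twist h hJ hp 1 v
    rw [cx_one, one_mul', one_mul] at h1
    refine Iff.trans (b := (twist m n (cx J p) v : Oct) 0 = 0 ∧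
      ((0 : Oct) * (twist m n (cx J p) v : Oct)⁻¹) 0 = 0) Iff.rfl ?_
    rw [h1]
    simp [hp, cx_zero, mul_def, mul]
  · simp only [hpt, hq, ne_eq, not_false_eq_true, if_true]
    have h1 := re_cx_twist h hJ hq 1 v
    rw [cx_one, one_mul', one_mul] at h1
    have h2 := re_cx_twist h hJ hq (p * q⁻¹) v
    rw [inv_mul_cancel_right₀ hq] at h2
    refine Iff.trans (b := (twist m n (cx J q) v : Oct) 0 = 0 ∧
      (cx J (p * q⁻¹) * (twist m n (cx J q) v : Oct)) 0 = 0) Iff.rfl ?_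
    rw [h1, h2]
    simp [hq]

theorem sum_eq_one {k : ℤ} (hk : Odd k) : (k + 1) / 2 + (-k + 1) / 2 = 1 := by
  obtain ⟨j, rfl⟩ := hk
  omega

theorem mem_S13Set {k : ℤ} (hk : Odd k) (x : Sigma15 k) :
    x ∈ S13Set k ↔ cond _ _ (sum_eq_one hk) x := by
  constructor
  · intro hx
    induction x using E.ind with
    | h u v => exact hx.1 u v rfl
    | h' u v => exact hx.2 u v rfl
  · intro hx
    refine ⟨?_, ?_⟩
    · rintro u v rfl
      exact hx
    · rintro u v rfl
      exact hx

theorem G2.re_map (g : G2) (x : Oct) : (g.1 x) 0 = x 0 := by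
  have h : x = x 0 • (1 : Oct) + (x - x 0 • (1 : Oct)) := by module
  have h1 := (g.map_imag (x - x 0 • (1 : Oct)) (by simp [one_def])).1
  rw [map_sub, map_smul, g.map_one] at h1
  simp [one_def] at h1
  linarith

/-- The sphere `S¹³_k`, for `k` odd, with the action of `SO(2) × G₂` and the subspace topology. -/
def S13 (k : ℤ) (hk : Odd k) : SubMulAction G (Sigma15 k) where
  carrier := S13Set k
  smul_mem' := by
    intro g x hx
    rw [mem_S13Set hk] at hx ⊢
    obtain ⟨J, p, q, v, hJ, hpq, rfl⟩ := exists_hpt x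
    rw [cond_hpt _ hJ hpq] at hx
    change cond _ _ _ (g.1 • g.2 • _)
    rw [so2_g2_comm]
    change cond _ _ _ (g2Act _ _ g.2 (so2Act _ _ g.1 _))
    obtain ⟨-, -, hab⟩ := SO2.entries g.1
    have hne : (g.1.1 0 0 * p + g.1.1 0 1 * q : ℂ) ≠ 0 ∨
        (-g.1.1 0 1 * p + g.1.1 0 0 * q : ℂ) ≠ 0 := by
      by_contra! h
      obtain ⟨h, h'⟩ := h
      have hab' : (g.1.1 0 0 ^ 2 + g.1.1 0 1 ^ 2 : ℂ) = 1 := by exact_mod_cast hab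
      have hp : p = 0 := by linear_combination g.1.1 0 0 * h - g.1.1 0 1 * h' - p * hab'
      have hq : q = 0 := by linear_combination g.1.1 0 1 * h + g.1.1 0 0 * h' - q * hab'
      tauto
    rw [so2Act_hpt _ _ _ hJ hpq, g2Act_hpt _ _ _ hJ hne, cond_hpt _ (g.2.isImUnit hJ) hne]
    simp only [G2.sph]
    rw [← g.2.map_cx, ← g.2.map_cx, ← g.2.map_mul, ← g.2.map_mul, g.2.re_map, g.2.re_map,
      cx_add, cx_add, ← Complex.ofReal_neg, cx_smul, cx_smul, cx_smul, cx_smul, add_mul',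
      add_mul', smul_mul', smul_mul', smul_mul', smul_mul']
    simp [hx.1, hx.2]

theorem neg_twist (m n : ℤ) (x : Oct) (v : S7) : twist m n x (-v) = -twist m n x v := by
  by_cases hx : x = 0
  · simp [twist, hx]
  · ext1
    have h : ((-v : S7) : Oct) = (-1 : ℝ) • (v : Oct) := by simp
    rw [coe_neg_sphere, twist, dif_pos hx, twist, dif_pos hx]
    simp only [h]
    rw [mul_smul', smul_mul']
    module

/-- The involution `(u, v) ↦ (u, -v)`, `(u', v') ↦ (u', -v')`. -/
def invT (m n : ℤ) : E m n → E m n :=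
  Quot.map (Sum.map (fun p => (p.1, -p.2)) (fun p => (p.1, -p.2))) (by
    rintro _ _ ⟨u, v, hu⟩
    simp only [Sum.map_inl, Sum.map_inr]
    rw [← neg_twist]
    exact Glue.glue u (-v) hu)

theorem invT_hpt (m n : ℤ) (J : Oct) (p q : ℂ) (v : S7) :
    invT m n (hpt m n J p q v) = hpt m n J p q (-v) := by
  by_cases hq : q = 0
  · simp only [hpt, hq, ne_eq, not_true_eq_false, if_false, neg_twist]; rfl
  · simp only [hpt, hq, ne_eq, not_false_eq_true, if_true, neg_twist]; rfl

theorem invT_smul {m n : ℤ} (g : G) (x : E m n) : invT m n (g • x) = g • invT m n x := by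
  obtain ⟨J, p, q, v, hJ, hpq, rfl⟩ := exists_hpt x
  have hs : g.2.sph (-v) = -g.2.sph v := by ext1; simp [G2.sph]
  rw [invT_hpt]
  change invT m n (so2Act m n g.1 (g2Act m n g.2 _)) = so2Act m n g.1 (g2Act m n g.2 _)
  rw [g2Act_hpt m n _ hJ hpq, so2Act_hpt m n _ (g.2.isImUnit hJ) hpq, invT_hpt,
    g2Act_hpt m n _ hJ hpq, so2Act_hpt m n _ (g.2.isImUnit hJ) hpq, hs]

theorem invT_mem {k : ℤ} (hk : Odd k) {x : Sigma15 k} (hx : x ∈ S13 k hk) :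
    invT _ _ x ∈ S13 k hk := by
  change _ ∈ S13Set k at hx
  change _ ∈ S13Set k
  rw [mem_S13Set hk] at hx ⊢
  obtain ⟨J, p, q, v, hJ, hpq, rfl⟩ := exists_hpt x
  have h : ((-v : S7) : Oct) = (-1 : ℝ) • (v : Oct) := by simp
  rw [cond_hpt _ hJ hpq] at hx
  rw [invT_hpt, cond_hpt _ hJ hpq, h, mul_smul', mul_smul']
  simp [hx.1, hx.2]

/-- The quotient `P¹³_k` of `S¹³_k` by the involution. -/
def P13 (k : ℤ) (hk : Odd k) : Type :=
  Quot fun x y : S13 k hk => (y : Sigma15 k) = invT _ _ (x : Sigma15 k)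

/-- The quotient topology. -/
instance (k : ℤ) (hk : Odd k) : TopologicalSpace (P13 k hk) :=
  inferInstanceAs (TopologicalSpace (Quot _))

/-- The projection from `S¹³_k` to `P¹³_k`. -/
def P13.mk {k : ℤ} {hk : Odd k} (x : S13 k hk) : P13 k hk := Quot.mk _ x

/-- The induced action of `SO(2) × G₂` on `P¹³_k`. -/
instance (k : ℤ) (hk : Odd k) : MulAction G (P13 k hk) where
  smul g := Quot.map (fun x => g • x) (by
    intro x y hxy
    change g • (y : Sigma15 k) = invT _ _ (g • (x : Sigma15 k))
    rw [hxy, invT_smul])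
  one_smul x := by
    induction x using Quot.ind with
    | mk x => exact congrArg (Quot.mk _) (one_smul G x)
  mul_smul g h x := by
    induction x using Quot.ind with
    | mk x => exact congrArg (Quot.mk _) (mul_smul g h x)

/-- The point `e 1` of the unit sphere. -/
def s1 : S7 := ⟨e 1, by simp [e]⟩

/-- The point `(u, v) = (u₁ + u₂ e₃, e₁)` of `S¹³_k`. -/
def S13.pt {k : ℤ} (hk : Odd k) (u₁ u₂ : ℝ) : S13 k hk :=
  ⟨chart _ _ (u₁ • (1 : Oct) + u₂ • e 3) s1, by
    change _ ∈ S13Set k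
    rw [mem_S13Set hk]
    change (s1 : Oct) 0 = 0 ∧ ((u₁ • (1 : Oct) + u₂ • e 3) * (s1 : Oct)) 0 = 0
    simp [s1, mul_def, mul, e, one_def]⟩

/-- The point `(u', v') = (0, e₁)` of `S¹³_k`. -/
def S13.pt' {k : ℤ} (hk : Odd k) : S13 k hk :=
  ⟨chart' _ _ 0 s1, by
    change _ ∈ S13Set k
    rw [mem_S13Set hk]
    change (s1 : Oct) 0 = 0 ∧ ((0 : Oct) * (s1 : Oct)⁻¹) 0 = 0
    simp [s1, mul_def, mul, e]⟩

/-- The action of `G` on `X` is continuous with one-dimensional orbit space: the curve `c` meets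
every orbit exactly once and identifies the orbit space with the interval `[0, 1]`. -/
def IsCohomogeneityOne (X : Type) [TopologicalSpace X] [MulAction G X]
    (c : Set.Icc (0 : ℝ) 1 → X) : Prop :=
  ContinuousSMul G X ∧
    ∃ Ψ : Set.Icc (0 : ℝ) 1 ≃ₜ Quotient (MulAction.orbitRel G X),
      ∀ t, Ψ t = Quotient.mk (MulAction.orbitRel G X) (c t)

/-- The matrix of an element of `G₂ ⊂ SO(7)` with respect to `e 1, …, e 7`, in the convention where
the `i`-th row contains the coordinates of the image of the `i`-th basis vector. -/
def mat7 (g : G2) : Matrix (Fin 7) (Fin 7) ℝ :=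
  Matrix.of fun i j => (g.1 (e i.succ)) j.succ

/-- The block diagonal matrix `diag{R, 1, A}`. -/
def diag214 (R : Matrix (Fin 2) (Fin 2) ℝ) (A : Matrix (Fin 4) (Fin 4) ℝ) :
    Matrix (Fin 7) (Fin 7) ℝ :=
  Matrix.reindex (finSumFinEquiv (m := 3) (n := 4)) (finSumFinEquiv (m := 3) (n := 4))
    (Matrix.fromBlocks
      (Matrix.reindex (finSumFinEquiv (m := 2) (n := 1)) (finSumFinEquiv (m := 2) (n := 1))
        (Matrix.fromBlocks R 0 0 1)) 0 0 A)

/-- The block diagonal matrix `diag{c, B}`. -/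
def diag16 (c : ℝ) (B : Matrix (Fin 6) (Fin 6) ℝ) : Matrix (Fin 7) (Fin 7) ℝ :=
  Matrix.reindex (finSumFinEquiv (m := 1) (n := 6)) (finSumFinEquiv (m := 1) (n := 6))
    (Matrix.fromBlocks (Matrix.of fun _ _ => c) 0 0 B)

/-- The matrix `R(θ)`, which is the element `e^{iθ}` of `SO(2)`. -/
def rot (θ : ℝ) : Matrix (Fin 2) (Fin 2) ℝ :=
  !![Real.cos θ, Real.sin θ; -Real.sin θ, Real.cos θ]

/-- `K`: the pairs `(e^{iθ}, diag{R(kθ), 1, A})`. -/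
def groupK (k : ℤ) : Set G :=
  {g | ∃ (θ : ℝ) (A : Matrix (Fin 4) (Fin 4) ℝ),
    (g.1 : Matrix (Fin 2) (Fin 2) ℝ) = rot θ ∧ mat7 g.2 = diag214 (rot (k * θ)) A}

/-- `L`: the pairs `(det B, diag{det B, B})` with `B ∈ O(6)`. -/
def groupL : Set G :=
  {g | ∃ B ∈ Matrix.orthogonalGroup (Fin 6) ℝ,
    (g.1 : Matrix (Fin 2) (Fin 2) ℝ) = B.det • 1 ∧ mat7 g.2 = diag16 B.det B}

/-- `H`: the pairs `(ε, diag{ε, ε, 1, A})` with `ε = ±1`. -/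
def groupH : Set G :=
  {g | ∃ (ε : ℝ) (A : Matrix (Fin 4) (Fin 4) ℝ), (ε = 1 ∨ ε = -1) ∧
    (g.1 : Matrix (Fin 2) (Fin 2) ℝ) = ε • 1 ∧ mat7 g.2 = diag214 (ε • 1) A}

/-- The pairs `(e^{iθ}, diag{ε R(kθ), 1, A})` with `ε = ±1`. -/
def groupKbar (k : ℤ) : Set G :=
  {g | ∃ (θ ε : ℝ) (A : Matrix (Fin 4) (Fin 4) ℝ), (ε = 1 ∨ ε = -1) ∧
    (g.1 : Matrix (Fin 2) (Fin 2) ℝ) = rot θ ∧ mat7 g.2 = diag214 (ε • rot (k * θ)) A}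

/-- The pairs `(ε, diag{det B, B})` with `ε = ±1` and `B ∈ O(6)`. -/
def groupLbar : Set G :=
  {g | ∃ ε : ℝ, (ε = 1 ∨ ε = -1) ∧ ∃ B ∈ Matrix.orthogonalGroup (Fin 6) ℝ,
    (g.1 : Matrix (Fin 2) (Fin 2) ℝ) = ε • 1 ∧ mat7 g.2 = diag16 B.det B}

/-- The pairs `(ε₁, diag{ε₂, ε₂, 1, A})` with `ε₁, ε₂ = ±1`. -/
def groupHbar : Set G :=
  {g | ∃ (ε₁ ε₂ : ℝ) (A : Matrix (Fin 4) (Fin 4) ℝ), (ε₁ = 1 ∨ ε₁ = -1) ∧ (ε₂ = 1 ∨ ε₂ = -1) ∧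
    (g.1 : Matrix (Fin 2) (Fin 2) ℝ) = ε₁ • 1 ∧ mat7 g.2 = diag214 (ε₂ • 1) A}

/-- The subgroup `SU(2) = SU(3) ∩ SU(3)₃` of `G₂` of the elements that fix `e 1` and `e 3`. -/
def SU2 : Subgroup G2 := MulAction.stabilizer G2 (e 1) ⊓ MulAction.stabilizer G2 (e 3)

/-- The subgroup `O(6) ∩ G₂` of `G₂` of the elements that map `e 1` to `± e 1`. -/
def O6 : Set G2 := {h | h.1 (e 1) = e 1 ∨ h.1 (e 1) = -e 1}

end Shimada

end

/-! Every Cayley number lies in a plane spanned by `1` and an imaginary unit `J`, and this plane is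
a copy of `ℂ`. Over it the bundle has homogeneous coordinates: `hpt m n J p q v` is the point over
`p / q`, and `(p c, q c, v)` and `(p, q, twist c v)` describe the same point. In these coordinates
both actions are transparent: `SO(2)` acts linearly on `(p, q)` and leaves `J` and `v` alone, while
`G₂` moves `J` and `v` and leaves `(p, q)` alone.

Orbit space. A rotation brings `p / q` to a purely imaginary point of the closed unit disc, so the
base point becomes `t J` with `0 ≤ t ≤ 1`. The conditions `Re v = Re (u v) = 0` then say that `v` is
an imaginary unit, orthogonal to `J` when `t > 0`. Since `G₂` is transitive on orthonormal pairs of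
imaginary units (`exists_map_eq_e_one`, `exists_map_eq_e_three`), every orbit meets the curve `(t
e₃, e₁)`. The function `|Im u| / (1 + |u|²)` (`height`) is continuous on the total space, invariant,
and injective along the curve, so no orbit is met twice and the orbit space is Hausdorff;
compactness of `[0, 1]` does the rest (`isCohomogeneityOne_of_invariant`).

Isotropy groups. A pair `(γ, g)` fixes the point over `z` in the plane of `e₃` if the Möbius map of
`γ` fixes `z`, `g` fixes `e₃` (an empty condition for real `z`), and the fibre coordinate returns to
`e₁` (`S13.mem_stabilizer_pt`). With first row `(a, b)` of `γ` the Möbius condition reads `b (1 +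
z²) = 0`. If `b = 0`, then `γ = ε = ±1` and the fibre condition is `g e₁ = ε e₁`; this gives `L` for
real `z` and `H` otherwise. If `z = i`, every `γ` is allowed. Since `e₁` anticommutes with `e₃` and
`m - n = k`, the fibre condition becomes `g e₁ = γ ^ k e₁`, which gives `K` (`coe_twist_s1`). The
determinants in `L` come for free: an automorphism fixing `e₁` is complex linear on the orthogonal
complement of `e₁` in the imaginary part, so its determinant there is `1` (`det_block6`).

Quotient. Because `m + n = 1`, the element `(-1, 1)` acts as the involution `T` (`negOne_smul`). So
`P¹³_k` is the quotient by a subgroup of `G`, and its isotropy groups are `S ∪ z S`. -/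

noncomputable section

namespace Shimada
open Oct Topology

/-! ### Explicit automorphisms of the Cayley numbers -/

/-- A multiplicative unital linear self-map of the Cayley numbers as an element of `G₂`. -/
def G2.ofMap (f : Oct →ₗ[ℝ] Oct) (hmul : ∀ x y, f (x * y) = f x * f y) (hone : f 1 = 1) : G2 :=
  ⟨LinearEquiv.ofInjectiveEndo f (by
    rw [← LinearMap.ker_eq_bot, LinearMap.ker_eq_bot']
    intro x hx
    by_contra hne
    have hn : ‖x‖ ≠ 0 := norm_ne_zero_iff.2 hne
    obtain ⟨J, z, hJ, rfl⟩ := exists_cx x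
    have hz : z ≠ 0 := fun h => hne (by rw [h, cx_zero])
    -- A nonzero `x` is invertible inside its own plane, so a multiplicative unital map cannot send
    -- it to `0`. In finite dimension injectivity suffices.
    have h1 : f (cx J z * cx J z⁻¹) = 1 := by rw [cx_mul_cx hJ, mul_inv_cancel₀ hz, cx_one, hone]
    rw [hmul, hx] at h1
    have h2 := congrArg (fun y : Oct => y 0) h1
    simp [mul_def, mul, one_def] at h2), fun x y => hmul x y⟩

@[simp] theorem G2.ofMap_apply (f : Oct →ₗ[ℝ] Oct) (hmul hone) (x : Oct) :
    (G2.ofMap f hmul hone).1 x = f x := rfl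

/-- The automorphism rotating the planes of `e 1, e 2` and of `e 5, e 6`. -/
def G2.rotA (c s : ℝ) (h : c ^ 2 + s ^ 2 = 1) : G2 := G2.ofMap
  { toFun := fun x => !₂[x 0, c * x 1 - s * x 2, s * x 1 + c * x 2, x 3, x 4,
      c * x 5 - s * x 6, s * x 5 + c * x 6, x 7]
    map_add' := fun x y => by apply ext8 <;> simp <;> ring
    map_smul' := fun r x => by apply ext8 <;> simp <;> ring }
  (fun x y => by
    -- Multiplicativity holds only modulo `c ^ 2 + s ^ 2 = 1`. Eliminating `s ^ 2` turns each
    -- coordinate into a polynomial identity; the other automorphisms below are treated alike.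
    have hs : s ^ 2 = 1 - c ^ 2 := by linarith
    apply ext8 <;> simp [mul_def, mul] <;> ring_nf <;> (try simp only [hs]) <;> ring)
  (by apply ext8 <;> simp [one_def])

/-- The automorphism rotating the planes of `e 1, e 3` and of `e 5, e 7`. -/
def G2.rotB (c s : ℝ) (h : c ^ 2 + s ^ 2 = 1) : G2 := G2.ofMap
  { toFun := fun x => !₂[x 0, c * x 1 - s * x 3, x 2, s * x 1 + c * x 3, x 4,
      c * x 5 - s * x 7, x 6, s * x 5 + c * x 7]
    map_add' := fun x y => by apply ext8 <;> simp <;> ring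
    map_smul' := fun r x => by apply ext8 <;> simp <;> ring }
  (fun x y => by
    have hs : s ^ 2 = 1 - c ^ 2 := by linarith
    apply ext8 <;> simp [mul_def, mul] <;> ring_nf <;> (try simp only [hs]) <;> ring)
  (by apply ext8 <;> simp [one_def])

/-- The automorphism rotating the planes of `e 2, e 3` and of `e 6, e 7`. -/
def G2.rotC (c s : ℝ) (h : c ^ 2 + s ^ 2 = 1) : G2 := G2.ofMap
  { toFun := fun x => !₂[x 0, x 1, c * x 2 - s * x 3, s * x 2 + c * x 3, x 4, x 5,
      c * x 6 - s * x 7, s * x 6 + c * x 7]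
    map_add' := fun x y => by apply ext8 <;> simp <;> ring
    map_smul' := fun r x => by apply ext8 <;> simp <;> ring }
  (fun x y => by
    have hs : s ^ 2 = 1 - c ^ 2 := by linarith
    apply ext8 <;> simp [mul_def, mul] <;> ring_nf <;> (try simp only [hs]) <;> ring)
  (by apply ext8 <;> simp [one_def])

/-- The automorphism rotating the planes of `e 1, e 4` and of `e 6, e 3`. -/
def G2.rotD (c s : ℝ) (h : c ^ 2 + s ^ 2 = 1) : G2 := G2.ofMap
  { toFun := fun x => !₂[x 0, c * x 1 - s * x 4, x 2, c * x 3 + s * x 6, s * x 1 + c * x 4, x 5,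
      c * x 6 - s * x 3, x 7]
    map_add' := fun x y => by apply ext8 <;> simp <;> ring
    map_smul' := fun r x => by apply ext8 <;> simp <;> ring }
  (fun x y => by
    have hs : s ^ 2 = 1 - c ^ 2 := by linarith
    apply ext8 <;> simp [mul_def, mul] <;> ring_nf <;> (try simp only [hs]) <;> ring)
  (by apply ext8 <;> simp [one_def])

/-- The automorphism rotating the planes of `e 3, e 4` and of `e 5, e 2`. -/
def G2.rotE (c s : ℝ) (h : c ^ 2 + s ^ 2 = 1) : G2 := G2.ofMap
  { toFun := fun x => !₂[x 0, x 1, c * x 2 + s * x 5, c * x 3 - s * x 4, s * x 3 + c * x 4,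
      c * x 5 - s * x 2, x 6, x 7]
    map_add' := fun x y => by apply ext8 <;> simp <;> ring
    map_smul' := fun r x => by apply ext8 <;> simp <;> ring }
  (fun x y => by
    have hs : s ^ 2 = 1 - c ^ 2 := by linarith
    apply ext8 <;> simp [mul_def, mul] <;> ring_nf <;> (try simp only [hs]) <;> ring)
  (by apply ext8 <;> simp [one_def])

/-- The automorphism that fixes `e 1, e 2, e 3` and acts on the span of `e 4, …, e 7` as the
left multiplication by the unit quaternion `a + b i + c j + d k`. -/
def G2.quat (a b c d : ℝ) (h : a ^ 2 + b ^ 2 + c ^ 2 + d ^ 2 = 1) : G2 := G2.ofMap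
  { toFun := fun x => !₂[x 0, x 1, x 2, x 3,
      a * x 4 - b * x 5 - c * x 6 - d * x 7,
      b * x 4 + a * x 5 - d * x 6 + c * x 7,
      c * x 4 + d * x 5 + a * x 6 - b * x 7,
      d * x 4 - c * x 5 + b * x 6 + a * x 7]
    map_add' := fun x y => by apply ext8 <;> simp <;> ring
    map_smul' := fun r x => by apply ext8 <;> simp <;> ring }
  (fun x y => by
    have hs : d ^ 2 = 1 - a ^ 2 - b ^ 2 - c ^ 2 := by linarith
    apply ext8 <;> simp [mul_def, mul] <;> ring_nf <;> (try simp only [hs]) <;> ring)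
  (by apply ext8 <;> simp [one_def])

theorem G2.inner_map (g : G2) (x y : Oct) : inner ℝ (g.1 x) (g.1 y) = inner ℝ x y :=
  LinearIsometry.inner_map_map (⟨g.1.toLinearMap, g.norm_map⟩ : Oct →ₗᵢ[ℝ] Oct) x y

theorem inner_e_left (i : Fin 8) (x : Oct) : inner ℝ (e i) x = x i := by
  simp [e, EuclideanSpace.inner_single_left]

theorem inner_e_right (i : Fin 8) (x : Oct) : inner ℝ x (e i) = x i := by
  simp [e, EuclideanSpace.inner_single_right]

theorem inner_eq (x y : Oct) : inner ℝ x y = x 0 * y 0 + x 1 * y 1 + x 2 * y 2 + x 3 * y 3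
    + x 4 * y 4 + x 5 * y 5 + x 6 * y 6 + x 7 * y 7 := by
  simp [PiLp.inner_apply, Fin.sum_univ_eight]; ring

theorem eq_sum_e (x : Oct) : x = x 0 • (1 : Oct) + x 1 • e 1 + x 2 • e 2 + x 3 • e 3 + x 4 • e 4
    + x 5 • e 5 + x 6 • e 6 + x 7 • e 7 := by
  apply ext8 <;> simp [e, one_def]

theorem e_three_mul_e_one : e 3 * e 1 = e 2 := by apply ext8 <;> simp [mul_def, mul, e]
theorem e_one_mul_e_four : e 1 * e 4 = e 5 := by apply ext8 <;> simp [mul_def, mul, e]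
theorem e_two_mul_e_four : e 2 * e 4 = e 6 := by apply ext8 <;> simp [mul_def, mul, e]
theorem e_three_mul_e_four : e 3 * e 4 = e 7 := by apply ext8 <;> simp [mul_def, mul, e]

theorem G2.map_e_two (g : G2) : g.1 (e 2) = g.1 (e 3) * g.1 (e 1) := by
  rw [← g.map_mul, e_three_mul_e_one]

/-- The algebra is generated by `e 1`, `e 3` and `e 4`: the other basis vectors are `e 3 * e 1`, `e
1 * e 4`, `e 2 * e 4` and `e 3 * e 4`. -/
theorem G2.ext_e {g h : G2} (h1 : g.1 (e 1) = h.1 (e 1)) (h3 : g.1 (e 3) = h.1 (e 3))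
    (h4 : g.1 (e 4) = h.1 (e 4)) : g = h := by
  have h2 : g.1 (e 2) = h.1 (e 2) := by rw [G2.map_e_two, G2.map_e_two, h1, h3]
  have h5 : g.1 (e 5) = h.1 (e 5) := by rw [← e_one_mul_e_four, g.map_mul, h.map_mul, h1, h4]
  have h6 : g.1 (e 6) = h.1 (e 6) := by rw [← e_two_mul_e_four, g.map_mul, h.map_mul, h2, h4]
  have h7 : g.1 (e 7) = h.1 (e 7) := by rw [← e_three_mul_e_four, g.map_mul, h.map_mul, h3, h4]
  apply Subtype.ext
  apply LinearEquiv.ext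
  intro x
  rw [eq_sum_e x]
  simp only [map_add, map_smul, h1, h2, h3, h4, h5, h6, h7, G2.map_one]

/-! ### Transitivity of `G₂` on orthonormal pairs of imaginary units -/

/-- A plane vector can be rotated to the nonnegative first half-axis. -/
theorem exists_rotation (x y : ℝ) : ∃ c s r : ℝ, c ^ 2 + s ^ 2 = 1 ∧ 0 ≤ r ∧
    c * x - s * y = r ∧ s * x + c * y = 0 := by
  by_cases h : x ^ 2 + y ^ 2 = 0
  · have hx : x = 0 := by nlinarith [sq_nonneg x, sq_nonneg y]
    have hy : y = 0 := by nlinarith [sq_nonneg x, sq_nonneg y]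
    exact ⟨1, 0, 0, by norm_num, le_rfl, by simp [hx], by simp [hy]⟩
  · have hpos : 0 < x ^ 2 + y ^ 2 := lt_of_le_of_ne (by positivity) (Ne.symm h)
    have hr := Real.sqrt_pos.2 hpos
    have hr2 := Real.sq_sqrt hpos.le
    set r := Real.sqrt (x ^ 2 + y ^ 2)
    refine ⟨x / r, -y / r, r, ?_, hr.le, ?_, ?_⟩
    · field_simp; linarith
    · field_simp; linarith
    · field_simp; ring

/-- The four left-hand sides are the components of the quaternion product `(a + b i + c j + d k) (x
+ y i + z j + w k)`. The first factor is taken to be the conjugate of the second divided by its norm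
`r`, so that the product is `r`. -/
theorem exists_unit_quaternion (x y z w : ℝ) : ∃ a b c d r : ℝ,
    a ^ 2 + b ^ 2 + c ^ 2 + d ^ 2 = 1 ∧ 0 ≤ r ∧ a * x - b * y - c * z - d * w = r ∧
    b * x + a * y - d * z + c * w = 0 ∧ c * x + d * y + a * z - b * w = 0 ∧
    d * x - c * y + b * z + a * w = 0 := by
  by_cases h : x ^ 2 + y ^ 2 + z ^ 2 + w ^ 2 = 0
  · have hx : x = 0 := by nlinarith [sq_nonneg x, sq_nonneg y, sq_nonneg z, sq_nonneg w]
    have hy : y = 0 := by nlinarith [sq_nonneg x, sq_nonneg y, sq_nonneg z, sq_nonneg w]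
    have hz : z = 0 := by nlinarith [sq_nonneg x, sq_nonneg y, sq_nonneg z, sq_nonneg w]
    have hw : w = 0 := by nlinarith [sq_nonneg x, sq_nonneg y, sq_nonneg z, sq_nonneg w]
    exact ⟨1, 0, 0, 0, 0, by norm_num, le_rfl, by simp [hx], by simp [hy], by simp [hz],
      by simp [hw]⟩
  · have hpos : 0 < x ^ 2 + y ^ 2 + z ^ 2 + w ^ 2 :=
      lt_of_le_of_ne (by positivity) (Ne.symm h)
    have hr := Real.sqrt_pos.2 hpos
    have hr2 := Real.sq_sqrt hpos.le
    set r := Real.sqrt (x ^ 2 + y ^ 2 + z ^ 2 + w ^ 2)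
    refine ⟨x / r, -y / r, -z / r, -w / r, r, ?_, hr.le, ?_, ?_, ?_, ?_⟩
    · field_simp; linarith
    · field_simp; linarith
    · field_simp; ring
    · field_simp; ring
    · field_simp; ring

/-- `SU(2)` moves any vector into the span of `e 0, …, e 4`. -/
theorem exists_quat_map (x : Oct) : ∃ g : G2, g.1 (e 1) = e 1 ∧ ∃ r : ℝ, 0 ≤ r ∧
    g.1 x = !₂[x 0, x 1, x 2, x 3, r, 0, 0, 0] := by
  obtain ⟨a, b, c, d, r, h, hr, h4, h5, h6, h7⟩ := exists_unit_quaternion (x 4) (x 5) (x 6) (x 7)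
  refine ⟨G2.quat a b c d h, ?_, r, hr, ?_⟩
  · apply ext8 <;> simp [G2.quat, e]
  · apply ext8 <;> simp [G2.quat, h4, h5, h6, h7]

/-- `G₂` acts transitively on the imaginary units. -/
theorem exists_map_eq_e_one {v : Oct} (hv : IsImUnit v) : ∃ g : G2, g.1 v = e 1 := by
  -- The quaternion collects the components along `e 4, …, e 7` in `e 4`. Rotations in the planes of
  -- `e 1` with `e 2`, `e 3`, `e 4` then clear one coordinate each. The companion plane of each
  -- rotation carries only zeros at that stage, so nothing reappears.
  obtain ⟨g₁, -, r₁, -, h₁⟩ := exists_quat_map v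
  obtain ⟨c, s, r₂, h, -, h2, h2'⟩ := exists_rotation (v 1) (v 2)
  have e₂ : (G2.rotA c s h).1 (g₁.1 v) = !₂[0, r₂, 0, v 3, r₁, 0, 0, 0] := by
    rw [h₁]; apply ext8 <;> simp [G2.rotA, h2, h2', hv.1]
  obtain ⟨c', s', r₃, h', -, h3, h3'⟩ := exists_rotation r₂ (v 3)
  have e₃ : (G2.rotB c' s' h').1 ((G2.rotA c s h).1 (g₁.1 v)) = !₂[0, r₃, 0, 0, r₁, 0, 0, 0] := by
    rw [e₂]; apply ext8 <;> simp [G2.rotB, h3, h3']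
  obtain ⟨c'', s'', r₄, h'', hr, h4, h4'⟩ := exists_rotation r₃ r₁
  have e₄ : (G2.rotD c'' s'' h'').1 ((G2.rotB c' s' h').1 ((G2.rotA c s h).1 (g₁.1 v)))
      = r₄ • e 1 := by
    rw [e₃]; apply ext8 <;> simp [G2.rotD, h4, h4', e]
  -- Automorphisms preserve the norm, so the remaining nonnegative coefficient is `1`.
  have hn := congrArg norm e₄
  rw [G2.norm_map, G2.norm_map, G2.norm_map, G2.norm_map, hv.2, norm_smul] at hn
  have h5 : r₄ = 1 := by simpa [e, abs_of_nonneg hr] using hn.symm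
  rw [h5, one_smul] at e₄
  exact ⟨G2.rotD c'' s'' h'' * (G2.rotB c' s' h' * (G2.rotA c s h * g₁)), e₄⟩

/-- The stabilizer of `e 1` in `G₂` acts transitively on the imaginary units orthogonal to
`e 1`. -/
theorem exists_map_eq_e_three {J : Oct} (hJ : IsImUnit J) (hJ1 : J 1 = 0) :
    ∃ g : G2, g.1 (e 1) = e 1 ∧ g.1 J = e 3 := by
  obtain ⟨g₁, hg₁, r₁, -, h₁⟩ := exists_quat_map J
  -- Here coordinate 3 has to survive and coordinate 2 to vanish, which accounts for the order and
  -- the sign. Only automorphisms that fix `e 1` are used.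
  obtain ⟨c, s, r₂, h, -, h2, h2'⟩ := exists_rotation (J 3) (-J 2)
  have e₂ : (G2.rotC c s h).1 (g₁.1 J) = !₂[0, 0, 0, r₂, r₁, 0, 0, 0] := by
    rw [h₁]
    apply ext8 <;> simp [G2.rotC, hJ.1, hJ1] <;> linarith
  obtain ⟨c', s', r₃, h', hr, h3, h3'⟩ := exists_rotation r₂ r₁
  have e₃ : (G2.rotE c' s' h').1 ((G2.rotC c s h).1 (g₁.1 J)) = r₃ • e 3 := by
    rw [e₂]; apply ext8 <;> simp [G2.rotE, h3, h3', e]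
  have hn := congrArg norm e₃
  rw [G2.norm_map, G2.norm_map, G2.norm_map, hJ.2, norm_smul] at hn
  have h5 : r₃ = 1 := by simpa [e, abs_of_nonneg hr] using hn.symm
  rw [h5, one_smul] at e₃
  refine ⟨G2.rotE c' s' h' * (G2.rotC c s h * g₁), ?_, e₃⟩
  change (G2.rotE c' s' h').1 ((G2.rotC c s h).1 (g₁.1 (e 1))) = e 1
  rw [hg₁]
  apply ext8 <;> simp [G2.rotC, G2.rotE, e]

/-! ### Continuity of the operations, of `twist` and of evaluation on `G₂` -/

instance : ContinuousMul Oct where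
  continuous_mul := by
    refine (PiLp.continuous_toLp 2 _).comp (continuous_pi fun i => ?_)
    fin_cases i <;> simp <;> fun_prop

@[fun_prop]
theorem Oct.continuous_conj : Continuous conj := by
  refine (PiLp.continuous_toLp 2 _).comp (continuous_pi fun i => ?_)
  fin_cases i <;> simp <;> fun_prop

theorem Oct.continuousAt_inv {x : Oct} (hx : x ≠ 0) : ContinuousAt (fun y : Oct => y⁻¹) x := by
  have h : ‖x‖ ^ 2 ≠ 0 := pow_ne_zero 2 (norm_ne_zero_iff.2 hx)
  exact ((continuous_norm.pow 2).continuousAt.inv₀ h).smul continuous_conj.continuousAt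

theorem Oct.continuous_npow (n : ℕ) : Continuous fun x : Oct => npow x n := by
  induction n with
  | zero => exact continuous_const
  | succ n ih => exact ih.mul continuous_id

theorem Oct.continuousAt_zpow (m : ℤ) {x : Oct} (hx : x ≠ 0) :
    ContinuousAt (fun y : Oct => y ^ m) x := by
  cases m with
  | ofNat n => exact (continuous_npow n).continuousAt
  | negSucc n => exact (continuous_npow (n + 1)).continuousAt.comp (continuousAt_inv hx)

theorem continuousAt_twist (m n : ℤ) {x : Oct} (hx : x ≠ 0) (v : S7) :
    ContinuousAt (fun p : Oct × S7 => twist m n p.1 p.2) (x, v) := by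
  rw [Topology.IsInducing.subtypeVal.continuousAt_iff]
  have h1 : ContinuousAt (fun p : Oct × S7 => (‖p.1‖ ^ (m + n))⁻¹ •
      ((p.1 ^ m * (p.2 : Oct)) * p.1 ^ n)) (x, v) := by
    have hn : ‖x‖ ≠ 0 := norm_ne_zero_iff.2 hx
    have hp : ∀ j : ℤ, ContinuousAt (fun p : Oct × S7 => p.1 ^ j) (x, v) := fun j =>
      ContinuousAt.comp (f := Prod.fst) (continuousAt_zpow j hx) continuousAt_fst
    have hv : ContinuousAt (fun p : Oct × S7 => (p.2 : Oct)) (x, v) :=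
      (continuous_subtype_val.comp continuous_snd).continuousAt
    have hd : ContinuousAt (fun p : Oct × S7 => ‖p.1‖) (x, v) :=
      (continuous_norm.comp continuous_fst).continuousAt
    have hm : ContinuousAt (fun p : Oct × S7 => (p.1 ^ m * (p.2 : Oct)) * p.1 ^ n) (x, v) :=
      ((hp m).mul hv).mul (hp n)
    exact ((hd.zpow₀ _ (Or.inl hn)).inv₀ (zpow_ne_zero _ hn)).smul hm
  refine h1.congr ?_
  have h2 : ∀ᶠ p : Oct × S7 in 𝓝 (x, v), p.1 ≠ 0 :=
    continuous_fst.continuousAt.eventually_ne hx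
  filter_upwards [h2] with p hp
  simp [twist, hp]

theorem ContinuousAt.twist {X : Type*} [TopologicalSpace X] (m n : ℤ) {f : X → Oct} {g : X → S7}
    {x : X} (hf : ContinuousAt f x) (hg : ContinuousAt g x) (hx : f x ≠ 0) :
    ContinuousAt (fun y => Shimada.twist m n (f y) (g y)) x :=
  ContinuousAt.comp (f := fun y => (f y, g y)) (continuousAt_twist m n hx (g x)) (hf.prodMk hg)

theorem G2.continuous_apply (x : Oct) : Continuous fun g : G2 => g.1 x :=
  (_root_.continuous_apply x).comp continuous_induced_dom

/-- The topology of `G₂` is that of pointwise convergence. Joint continuity follows since, by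
linearity, the value at `x` is a combination of the images of the eight basis vectors, with the
coordinates of `x` as coefficients. -/
theorem G2.continuous_eval : Continuous fun p : G2 × Oct => p.1.1 p.2 := by
  have h : (fun p : G2 × Oct => p.1.1 p.2) = fun p => p.2 0 • (1 : Oct) + p.2 1 • p.1.1 (e 1)
      + p.2 2 • p.1.1 (e 2) + p.2 3 • p.1.1 (e 3) + p.2 4 • p.1.1 (e 4) + p.2 5 • p.1.1 (e 5)
      + p.2 6 • p.1.1 (e 6) + p.2 7 • p.1.1 (e 7) := by
    funext p
    conv_lhs => rw [eq_sum_e p.2]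
    simp only [map_add, map_smul, G2.map_one]
  have hc : ∀ i : Fin 8, Continuous fun p : G2 × Oct => p.2 i := fun i => by fun_prop
  have hg : ∀ x : Oct, Continuous fun p : G2 × Oct => p.1.1 x := fun x =>
    (G2.continuous_apply x).comp continuous_fst
  rw [h]
  have h8 := fun i j => (hc i).smul (hg (e j))
  exact ((((((((hc 0).smul continuous_const).add (h8 1 1)).add (h8 2 2)).add (h8 3 3)).add
    (h8 4 4)).add (h8 5 5)).add (h8 6 6)).add (h8 7 7)

theorem G2.continuous_of_apply {X : Type*} [TopologicalSpace X] {f : X → G2}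
    (h : ∀ x : Oct, Continuous fun y => (f y).1 x) : Continuous f :=
  continuous_induced_rng.2 (continuous_pi h)

/-! ### Transition maps and the quotient topology of the total space -/

/-- The coordinates `(u', v')` in terms of `(u, v)`, defined for `u ≠ 0`. -/
def glueMap (m n : ℤ) (p : Oct × S7) : Oct × S7 := ((‖p.1‖ ^ 2)⁻¹ • p.1, twist m n p.1 p.2)

/-- The coordinates `(u, v)` in terms of `(u', v')`, defined for `u' ≠ 0`. -/
def glueInv (m n : ℤ) (p : Oct × S7) : Oct × S7 :=
  ((‖p.1‖ ^ 2)⁻¹ • p.1, twist m n (conj p.1) p.2)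

theorem continuousAt_inversion {x : Oct} (hx : x ≠ 0) :
    ContinuousAt (fun y : Oct => (‖y‖ ^ 2)⁻¹ • y) x :=
  ((continuous_norm.pow 2).continuousAt.inv₀ (pow_ne_zero 2 (norm_ne_zero_iff.2 hx))).smul
    continuousAt_id

theorem conj_ne_zero {x : Oct} (hx : x ≠ 0) : conj x ≠ 0 := by
  obtain ⟨J, z, hJ, rfl⟩ := exists_cx x
  rw [conj_cx hJ, Ne, cx_eq_zero hJ]
  simpa [cx_eq_zero hJ] using hx

theorem continuousAt_glueMap (m n : ℤ) {p : Oct × S7} (hp : p.1 ≠ 0) :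
    ContinuousAt (glueMap m n) p :=
  (ContinuousAt.comp (f := Prod.fst) (continuousAt_inversion hp) continuousAt_fst).prodMk
    (continuousAt_twist m n hp p.2)

theorem continuousAt_glueInv (m n : ℤ) {p : Oct × S7} (hp : p.1 ≠ 0) :
    ContinuousAt (glueInv m n) p :=
  (ContinuousAt.comp (f := Prod.fst) (continuousAt_inversion hp) continuousAt_fst).prodMk
    (ContinuousAt.twist m n (continuous_conj.comp continuous_fst).continuousAt continuousAt_snd
      (conj_ne_zero hp))

theorem glueMap_fst_ne_zero (m n : ℤ) {p : Oct × S7} (hp : p.1 ≠ 0) : (glueMap m n p).1 ≠ 0 := by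
  simp [glueMap, hp]

/-- If `u` corresponds to `z`, then `u' = u / |u|²` corresponds to the inverse of the conjugate of
`z`. Hence `conj u'` corresponds to `z⁻¹`, and the twists by `z` and `z⁻¹` cancel. -/
theorem glueInv_glueMap (m n : ℤ) {p : Oct × S7} (hp : p.1 ≠ 0) :
    glueInv m n (glueMap m n p) = p := by
  obtain ⟨u, v⟩ := p
  obtain ⟨J, z, hJ, rfl⟩ := exists_cx u
  have hz : z ≠ 0 := by simpa [cx_eq_zero hJ] using hp
  simp only [glueMap, glueInv, normSq_inv_smul_cx hJ, conj_cx hJ, map_inv₀, Complex.conj_conj,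
    inv_inv]
  rw [twist_twist m n hJ (inv_ne_zero hz) hz, inv_mul_cancel₀ hz, cx_one, twist_one]

theorem glueMap_glueInv (m n : ℤ) {p : Oct × S7} (hp : p.1 ≠ 0) :
    glueMap m n (glueInv m n p) = p := by
  obtain ⟨u, v⟩ := p
  obtain ⟨J, z, hJ, rfl⟩ := exists_cx u
  have hz : z ≠ 0 := by simpa [cx_eq_zero hJ] using hp
  have hz' : starRingEnd ℂ z ≠ 0 := by simpa using hz
  simp only [glueMap, glueInv, normSq_inv_smul_cx hJ, conj_cx hJ, map_inv₀, Complex.conj_conj,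
    inv_inv]
  rw [twist_twist m n hJ (inv_ne_zero hz') hz', inv_mul_cancel₀ hz', cx_one, twist_one]

/-- The coordinates `(u, v)` of a point, where they are defined. -/
def coords (m n : ℤ) : E m n → Option (Oct × S7) :=
  open Classical in
  Quot.lift (Sum.elim some (fun p => if p.1 = 0 then none else some (glueInv m n p))) (by
    rintro _ _ ⟨u, v, hu⟩
    have h1 := glueMap_fst_ne_zero m n (p := (u, v)) hu
    have h2 := glueInv_glueMap m n (p := (u, v)) hu
    change some (u, v) = if (glueMap m n (u, v)).1 = 0 then none
      else some (glueInv m n (glueMap m n (u, v)))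
    rw [if_neg h1, h2])

/-- The coordinates `(u', v')` of a point, where they are defined. -/
def coords' (m n : ℤ) : E m n → Option (Oct × S7) :=
  open Classical in
  Quot.lift (Sum.elim (fun p => if p.1 = 0 then none else some (glueMap m n p)) some) (by
    rintro _ _ ⟨u, v, hu⟩
    simp [hu, glueMap])

theorem coords_chart (m n : ℤ) (u : Oct) (v : S7) : coords m n (chart m n u v) = some (u, v) :=
  rfl

open Classical in
theorem coords_chart' (m n : ℤ) (u : Oct) (v : S7) :
    coords m n (chart' m n u v) = if u = 0 then none else some (glueInv m n (u, v)) := rfl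

theorem coords'_chart' (m n : ℤ) (u : Oct) (v : S7) :
    coords' m n (chart' m n u v) = some (u, v) := rfl

open Classical in
theorem coords'_chart (m n : ℤ) (u : Oct) (v : S7) :
    coords' m n (chart m n u v) = if u = 0 then none else some (glueMap m n (u, v)) := rfl

/-- The gluing relation is not an equivalence relation, so equality in the quotient is tested by
functions that descend to it: `coords` recovers `(u, v)`. The next lemmas use `coords` and `coords'`
in the same way. -/
theorem chart_inj {m n : ℤ} {u u' : Oct} {v v' : S7} :
    chart m n u v = chart m n u' v' ↔ u = u' ∧ v = v' := by
  refine ⟨fun h => ?_, fun ⟨h, h'⟩ => by rw [h, h']⟩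
  have := congrArg (coords m n) h
  simpa [coords_chart] using this

theorem chart'_inj {m n : ℤ} {u u' : Oct} {v v' : S7} :
    chart' m n u v = chart' m n u' v' ↔ u = u' ∧ v = v' := by
  refine ⟨fun h => ?_, fun ⟨h, h'⟩ => by rw [h, h']⟩
  have := congrArg (coords' m n) h
  simpa [coords'_chart'] using this

theorem chart'_zero_ne_chart {m n : ℤ} {u : Oct} {v v' : S7} :
    chart' m n 0 v ≠ chart m n u v' := by
  intro h
  have := congrArg (coords m n) h
  simp [coords_chart, coords_chart'] at this

theorem chart_zero_ne_chart' {m n : ℤ} {u : Oct} {v v' : S7} :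
    chart m n 0 v ≠ chart' m n u v' := by
  intro h
  have := congrArg (coords' m n) h
  simp [coords'_chart, coords'_chart'] at this

theorem chart_eq_chart' {m n : ℤ} {p q : Oct × S7} :
    chart m n p.1 p.2 = chart' m n q.1 q.2 ↔ p.1 ≠ 0 ∧ glueMap m n p = q := by
  refine ⟨fun h => ?_, fun ⟨h, h'⟩ => by rw [← h', chart_eq _ _ _ _ h]; rfl⟩
  have h1 := congrArg (coords' m n) h
  rw [coords'_chart, coords'_chart'] at h1
  split_ifs at h1 with h2
  exact ⟨h2, Option.some.inj h1⟩

theorem chart'_eq_chart {m n : ℤ} {p q : Oct × S7} :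
    chart' m n p.1 p.2 = chart m n q.1 q.2 ↔ p.1 ≠ 0 ∧ glueInv m n p = q := by
  constructor
  · intro h
    have h1 := congrArg (coords m n) h
    rw [coords_chart, coords_chart'] at h1
    split_ifs at h1 with h2
    exact ⟨h2, Option.some.inj h1⟩
  · rintro ⟨h, rfl⟩
    refine (chart_eq_chart'.2 ⟨?_, glueMap_glueInv m n h⟩).symm
    simp [glueInv, h]

theorem isOpen_preimage_of_continuousAt {f : Oct × S7 → Oct × S7}
    (hf : ∀ p : Oct × S7, p.1 ≠ 0 → ContinuousAt f p) {U : Set (Oct × S7)} (hU : IsOpen U) :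
    IsOpen {p : Oct × S7 | p.1 ≠ 0 ∧ f p ∈ U} := by
  rw [isOpen_iff_mem_nhds]
  rintro p ⟨hp, hpU⟩
  have h2 : ∀ᶠ p in 𝓝 p, p.1 ≠ (0 : Oct) := continuous_fst.continuousAt.eventually_ne hp
  filter_upwards [h2, (hf p hp).preimage_mem_nhds (hU.mem_nhds hpU)] with q h h' using ⟨h, h'⟩

/-- The saturation of an open set meets each copy in an open set together with the preimage of an
open set under a transition map, and that preimage is open in the region `u ≠ 0`. Openness matters
because products of open quotient maps are again quotient maps. -/
theorem isOpenMap_mk (m n : ℤ) : IsOpenMap (Quot.mk (Glue m n)) := by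
  intro U hU
  have hl := hU.preimage continuous_inl
  have hr := hU.preimage continuous_inr
  change IsOpen (Quot.mk (Glue m n) ⁻¹' (Quot.mk (Glue m n) '' U))
  rw [isOpen_sum_iff]
  constructor
  · convert hl.union (isOpen_preimage_of_continuousAt (fun p hp => continuousAt_glueMap m n hp) hr)
      using 1
    ext p
    constructor
    · rintro ⟨q | q, hq, h⟩
      · left
        have := chart_inj.1 (show chart m n q.1 q.2 = chart m n p.1 p.2 from h)
        have h' : q = p := Prod.ext this.1 this.2
        rwa [h'] at hq
      · right
        obtain ⟨h1, h2⟩ := chart_eq_chart'.1 (show chart m n p.1 p.2 = chart' m n q.1 q.2 from h.symm)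
        refine ⟨h1, ?_⟩
        rwa [h2]
    · rintro (h | ⟨h1, h2⟩)
      · exact ⟨_, h, rfl⟩
      · exact ⟨_, h2, (chart_eq_chart'.2 ⟨h1, rfl⟩).symm⟩
  · convert hr.union (isOpen_preimage_of_continuousAt (fun p hp => continuousAt_glueInv m n hp) hl)
      using 1
    ext p
    constructor
    · rintro ⟨q | q, hq, h⟩
      · right
        obtain ⟨h1, h2⟩ := chart'_eq_chart.1 (show chart' m n p.1 p.2 = chart m n q.1 q.2 from h.symm)
        refine ⟨h1, ?_⟩
        rwa [h2]
      · left
        have := chart'_inj.1 (show chart' m n q.1 q.2 = chart' m n p.1 p.2 from h)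
        have h' : q = p := Prod.ext this.1 this.2
        rwa [h'] at hq
    · rintro (h | ⟨h1, h2⟩)
      · exact ⟨_, h, rfl⟩
      · exact ⟨_, h2, (chart'_eq_chart.2 ⟨h1, rfl⟩).symm⟩

theorem isOpenQuotientMap_mk (m n : ℤ) : IsOpenQuotientMap (Quot.mk (Glue m n)) where
  surjective := Quot.mk_surjective
  continuous := continuous_quot_mk
  isOpenMap := isOpenMap_mk m n

theorem continuous_chart (m n : ℤ) : Continuous fun p : Oct × S7 => chart m n p.1 p.2 :=
  continuous_quot_mk.comp continuous_inl

theorem continuous_chart' (m n : ℤ) : Continuous fun p : Oct × S7 => chart' m n p.1 p.2 :=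
  continuous_quot_mk.comp continuous_inr

/-! ### Continuity of the action -/

theorem hpt_eq_chart' (m n : ℤ) {J : Oct} (hJ : IsImUnit J) {p : ℂ} (q : ℂ) (hp : p ≠ 0) (v : S7) :
    hpt m n J p q v = chart' m n (conj (cx J (q * p⁻¹))) (twist m n (cx J p) v) := by
  rw [conj_cx hJ, chart'_cx m n hJ, Complex.conj_conj, hpt_twist m n hJ (Or.inl one_ne_zero) hp,
    one_mul, inv_mul_cancel_right₀ hp]

/-- A family of points given by continuous homogeneous coordinates is continuous. -/
theorem continuous_of_eq_hpt (m n : ℤ) {X : Type*} [TopologicalSpace X] {F : X → E m n}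
    {P Q : X → Oct} {V : X → S7} (hP : Continuous P) (hQ : Continuous Q) (hV : Continuous V)
    (h : ∀ x, ∃ J p q, IsImUnit J ∧ (p ≠ 0 ∨ q ≠ 0) ∧ P x = cx J p ∧ Q x = cx J q ∧
      F x = hpt m n J p q (V x)) : Continuous F := by
  -- The unit `J` need not depend continuously on `x`, since real numbers lie in every plane. The
  -- two chart formulas are therefore written in `P x` and `Q x` alone, without `J`.
  have h1 : ∀ x, Q x ≠ 0 → F x = chart m n (P x * (Q x)⁻¹) (twist m n (Q x) (V x)) := by
    intro x hx
    obtain ⟨J, p, q, hJ, -, hp, hq, hF⟩ := h x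
    have hq0 : q ≠ 0 := fun h0 => hx (by rw [hq, h0, cx_zero])
    rw [hF, hp, hq, hpt, if_pos hq0, inv_cx hJ, cx_mul_cx hJ]
  have h2 : ∀ x, P x ≠ 0 → F x = chart' m n (conj (Q x * (P x)⁻¹)) (twist m n (P x) (V x)) := by
    intro x hx
    obtain ⟨J, p, q, hJ, -, hp, hq, hF⟩ := h x
    have hp0 : p ≠ 0 := fun h0 => hx (by rw [hp, h0, cx_zero])
    rw [hF, hp, hq, hpt_eq_chart' m n hJ q hp0, inv_cx hJ, cx_mul_cx hJ]
  rw [continuous_iff_continuousAt]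
  intro x
  by_cases hx : Q x = 0
  · have hx' : P x ≠ 0 := by
      obtain ⟨J, p, q, hJ, hpq, hp, hq, -⟩ := h x
      rw [hq, cx_eq_zero hJ] at hx
      rw [hp, Ne, cx_eq_zero hJ]
      tauto
    have hinv : ContinuousAt (fun y => (P y)⁻¹) x :=
      ContinuousAt.comp (f := P) (continuousAt_inv hx') hP.continuousAt
    have hc : ContinuousAt (fun y => conj (Q y * (P y)⁻¹)) x :=
      ContinuousAt.comp (f := fun y => Q y * (P y)⁻¹) continuous_conj.continuousAt
        (hQ.continuousAt.mul hinv)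
    have ht := ContinuousAt.twist m n hP.continuousAt hV.continuousAt hx'
    refine (ContinuousAt.comp (f := fun y => (conj (Q y * (P y)⁻¹), twist m n (P y) (V y)))
      (continuous_chart' m n).continuousAt (hc.prodMk ht)).congr ?_
    filter_upwards [hP.continuousAt.eventually_ne hx'] with y hy using (h2 y hy).symm
  · have hinv : ContinuousAt (fun y => (Q y)⁻¹) x :=
      ContinuousAt.comp (f := Q) (continuousAt_inv hx) hQ.continuousAt
    have ht := ContinuousAt.twist m n hQ.continuousAt hV.continuousAt hx
    refine (ContinuousAt.comp (f := fun y => (P y * (Q y)⁻¹, twist m n (Q y) (V y)))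
      (continuous_chart m n).continuousAt ((hP.continuousAt.mul hinv).prodMk ht)).congr ?_
    filter_upwards [hQ.continuousAt.eventually_ne hx] with y hy using (h1 y hy).symm

theorem SO2.ne_zero_or (γ : SO2) {p q : ℂ} (hpq : p ≠ 0 ∨ q ≠ 0) :
    (γ.1 0 0 * p + γ.1 0 1 * q : ℂ) ≠ 0 ∨ (-γ.1 0 1 * p + γ.1 0 0 * q : ℂ) ≠ 0 := by
  obtain ⟨-, -, hab⟩ := SO2.entries γ
  by_contra! h
  obtain ⟨h, h'⟩ := h
  have hab' : (γ.1 0 0 ^ 2 + γ.1 0 1 ^ 2 : ℂ) = 1 := by exact_mod_cast hab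
  have hp : p = 0 := by linear_combination γ.1 0 0 * h - γ.1 0 1 * h' - p * hab'
  have hq : q = 0 := by linear_combination γ.1 0 1 * h + γ.1 0 0 * h' - q * hab'
  tauto

theorem SO2.continuous_entry (i j : Fin 2) : Continuous fun γ : SO2 => γ.1 i j :=
  (continuous_apply_apply i j).comp continuous_subtype_val

/-- A map from a product with the total space is continuous if it is so in both charts. -/
theorem continuous_prod_total {m n : ℤ} {X Y : Type*} [TopologicalSpace X] [TopologicalSpace Y]
    {F : X × E m n → Y}
    (h : Continuous fun p : X × (Oct × S7) => F (p.1, chart m n p.2.1 p.2.2))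
    (h' : Continuous fun p : X × (Oct × S7) => F (p.1, chart' m n p.2.1 p.2.2)) :
    Continuous F := by
  -- The product of the identity with the open quotient map is a quotient map, and its source is the
  -- disjoint union of the two chart domains times `X`.
  refine ((IsOpenQuotientMap.id (X := X)).prodMap
    (isOpenQuotientMap_mk m n)).isQuotientMap.continuous_iff.2 ?_
  rw [← (Homeomorph.prodSumDistrib (X := X) (Y := Oct × S7) (Z := Oct × S7)).symm.comp_continuous_iff']
  rw [continuous_sum_dom]
  exact ⟨h, h'⟩

theorem continuous_so2Act (m n : ℤ) : Continuous fun p : SO2 × E m n => so2Act m n p.1 p.2 := by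
  have ha : Continuous fun p : SO2 × (Oct × S7) => p.1.1 0 0 :=
    (SO2.continuous_entry 0 0).comp continuous_fst
  have hb : Continuous fun p : SO2 × (Oct × S7) => p.1.1 0 1 :=
    (SO2.continuous_entry 0 1).comp continuous_fst
  have hu : Continuous fun p : SO2 × (Oct × S7) => p.2.1 := continuous_fst.comp continuous_snd
  have hv : Continuous fun p : SO2 × (Oct × S7) => p.2.2 := continuous_snd.comp continuous_snd
  have hu' : Continuous fun p : SO2 × (Oct × S7) => conj p.2.1 := continuous_conj.comp hu
  apply continuous_prod_total
  · refine continuous_of_eq_hpt m n (P := fun p => p.1.1 0 0 • p.2.1 + p.1.1 0 1 • (1 : Oct))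
      (Q := fun p => -p.1.1 0 1 • p.2.1 + p.1.1 0 0 • (1 : Oct)) (V := fun p => p.2.2)
      ((ha.smul hu).add (hb.smul continuous_const)) ((hb.neg.smul hu).add (ha.smul continuous_const)) hv ?_
    rintro ⟨γ, u, v⟩
    obtain ⟨J, z, hJ, rfl⟩ := exists_cx u
    have h := SO2.ne_zero_or γ (p := z) (q := 1) (Or.inr one_ne_zero)
    simp only [mul_one] at h
    refine ⟨J, _, _, hJ, h, ?_, ?_, so2Fun_inl m n γ hJ z v⟩
    · simp only [cx_add, cx_smul, cx_ofReal]
    · simp only [cx_add, ← Complex.ofReal_neg, cx_smul, cx_ofReal]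
  · refine continuous_of_eq_hpt m n (P := fun p => p.1.1 0 0 • (1 : Oct) + p.1.1 0 1 • conj p.2.1)
      (Q := fun p => -p.1.1 0 1 • (1 : Oct) + p.1.1 0 0 • conj p.2.1) (V := fun p => p.2.2)
      ((ha.smul continuous_const).add (hb.smul hu')) ((hb.neg.smul continuous_const).add (ha.smul hu')) hv ?_
    rintro ⟨γ, u, v⟩
    obtain ⟨J, z, hJ, rfl⟩ := exists_cx u
    have h := SO2.ne_zero_or γ (p := 1) (q := starRingEnd ℂ z) (Or.inl one_ne_zero)
    simp only [mul_one] at h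
    refine ⟨J, _, _, hJ, h, ?_, ?_, so2Fun_inr m n γ hJ z v⟩
    · simp only [cx_add, cx_smul, cx_ofReal, conj_cx hJ]
    · simp only [cx_add, ← Complex.ofReal_neg, cx_smul, cx_ofReal, conj_cx hJ]

theorem G2.continuous_sph : Continuous fun p : G2 × S7 => p.1.sph p.2 :=
  (G2.continuous_eval.comp (continuous_fst.prodMk
    (continuous_subtype_val.comp continuous_snd))).subtype_mk _

theorem continuous_g2Act (m n : ℤ) : Continuous fun p : G2 × E m n => g2Act m n p.1 p.2 := by
  have h : Continuous fun p : G2 × (Oct × S7) => (p.1.1 p.2.1, p.1.sph p.2.2) :=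
    (G2.continuous_eval.comp (continuous_fst.prodMk (continuous_fst.comp continuous_snd))).prodMk
      (G2.continuous_sph.comp (continuous_fst.prodMk (continuous_snd.comp continuous_snd)))
  apply continuous_prod_total
  · exact (continuous_chart m n).comp h
  · exact (continuous_chart' m n).comp h

instance (m n : ℤ) : ContinuousSMul G (E m n) where
  continuous_smul := by
    have h : Continuous fun p : G × E m n => g2Act m n p.1.2 p.2 :=
      (continuous_g2Act m n).comp ((continuous_snd.comp continuous_fst).prodMk continuous_snd)
    exact (continuous_so2Act m n).comp ((continuous_fst.comp continuous_fst).prodMk h)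

instance (k : ℤ) (hk : Odd k) : ContinuousSMul G (S13 k hk) where
  continuous_smul := Continuous.subtype_mk
    (continuous_smul.comp (continuous_fst.prodMk (continuous_subtype_val.comp continuous_snd))) _

/-! ### The invariant function and the criterion for cohomogeneity one -/

/-- The curve induces a continuous bijection from `[0, 1]` to the orbit space. The invariant `f`
descends to an injective continuous real function there, so the orbit space is Hausdorff, and a
continuous bijection from a compact space to a Hausdorff space is a homeomorphism. -/
theorem isCohomogeneityOne_of_invariant {X : Type} [TopologicalSpace X] [MulAction G X]
    [ContinuousSMul G X] {c : Set.Icc (0 : ℝ) 1 → X} (hc : Continuous c)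
    (hsurj : ∀ x, ∃ (g : G) (t : Set.Icc (0 : ℝ) 1), g • x = c t) {f : X → ℝ} (hf : Continuous f)
    (hinv : ∀ (g : G) x, f (g • x) = f x) (hinj : Function.Injective (f ∘ c)) :
    IsCohomogeneityOne X c := by
  refine ⟨inferInstance, ?_⟩
  let F : Quotient (MulAction.orbitRel G X) → ℝ := Quotient.lift f (by
    rintro _ y ⟨g, rfl⟩
    exact hinv g y)
  have hF : Continuous F := hf.quotient_lift _
  let C : Set.Icc (0 : ℝ) 1 → Quotient (MulAction.orbitRel G X) :=
    fun t => Quotient.mk _ (c t)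
  have hC : Continuous C := continuous_quotient_mk'.comp hc
  have hCinj : Function.Injective C := fun s t h => hinj (congrArg F h)
  have hCsurj : Function.Surjective C := by
    intro y
    induction y using Quotient.ind with
    | _ x =>
      obtain ⟨g, t, h⟩ := hsurj x
      exact ⟨t, Quotient.sound ⟨g, h⟩⟩
  have hFinj : Function.Injective F := by
    intro x y h
    obtain ⟨s, rfl⟩ := hCsurj x
    obtain ⟨t, rfl⟩ := hCsurj y
    exact congrArg C (hinj h)
  have : T2Space (Quotient (MulAction.orbitRel G X)) := T2Space.of_injective_continuous hFinj hF
  exact ⟨hC.homeoOfEquivCompactToT2 (f := Equiv.ofBijective C ⟨hCinj, hCsurj⟩), fun t => rfl⟩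

/-- The imaginary part. -/
def Oct.im (x : Oct) : Oct := x - x 0 • (1 : Oct)

theorem Oct.continuous_im : Continuous im := by
  have h : Continuous fun x : Oct => x 0 := by fun_prop
  exact continuous_id.sub (h.smul continuous_const)

theorem Oct.im_cx {J : Oct} (hJ : IsImUnit J) (z : ℂ) : im (cx J z) = z.im • J := by
  simp [im, cx, hJ.1, one_def]

theorem Oct.norm_im_cx {J : Oct} (hJ : IsImUnit J) (z : ℂ) : ‖im (cx J z)‖ = |z.im| := by
  rw [im_cx hJ, norm_smul, hJ.2, mul_one, Real.norm_eq_abs]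

/-- The function `|Im u| / (1 + |u|²)`, which is given by the same formula in both charts. -/
def height (m n : ℤ) : E m n → ℝ :=
  Quot.lift (Sum.elim (fun p => ‖im p.1‖ / (1 + ‖p.1‖ ^ 2)) (fun p => ‖im p.1‖ / (1 + ‖p.1‖ ^ 2)))
    (by
      rintro _ _ ⟨u, v, hu⟩
      obtain ⟨J, z, hJ, rfl⟩ := exists_cx u
      have hz : z ≠ 0 := by rwa [Ne, cx_eq_zero hJ] at hu
      simp only [Sum.elim_inl, Sum.elim_inr]
      rw [normSq_inv_smul_cx hJ, norm_im_cx hJ, norm_im_cx hJ, norm_cx hJ, norm_cx hJ]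
      have h1 : ((starRingEnd ℂ z)⁻¹).im = z.im / ‖z‖ ^ 2 := by
        simp [Complex.inv_im, Complex.normSq_eq_norm_sq]
      have h2 : 0 < ‖z‖ := norm_pos_iff.2 hz
      rw [h1, abs_div, abs_of_pos (pow_pos h2 2), norm_inv, RCLike.norm_conj]
      field_simp
      ring)

theorem continuous_height (m n : ℤ) : Continuous (height m n) := by
  have h : Continuous fun p : Oct × S7 => ‖im p.1‖ / (1 + ‖p.1‖ ^ 2) := by
    have h1 : Continuous fun p : Oct × S7 => im p.1 := continuous_im.comp continuous_fst
    refine h1.norm.div (by fun_prop) fun p => by positivity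
  exact continuous_quot_lift _ (h.sumElim h)

/-- The numerator is the absolute value of the determinant of the real and imaginary parts of `(p,
q)`, the denominator the squared Hermitian norm. Both are unchanged by real rotations of `(p, q)`,
which makes the invariance under `SO(2)` visible. -/
theorem height_hpt (m n : ℤ) {J : Oct} (hJ : IsImUnit J) (p q : ℂ) (v : S7) : height m n (hpt m n J p q v)
      = |p.im * q.re - p.re * q.im| / (‖p‖ ^ 2 + ‖q‖ ^ 2) := by
  by_cases hq : q = 0
  · simp only [hpt, hq, ne_eq, not_true_eq_false, if_false]
    refine Eq.trans (b := ‖im (0 : Oct)‖ / (1 + ‖(0 : Oct)‖ ^ 2)) rfl ?_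
    simp [im]
  · rw [hpt, if_pos hq]
    refine Eq.trans (b := ‖im (cx J (p * q⁻¹))‖ / (1 + ‖cx J (p * q⁻¹)‖ ^ 2)) rfl ?_
    rw [norm_im_cx hJ, norm_cx hJ, norm_mul, norm_inv]
    have hn : 0 < ‖q‖ := norm_pos_iff.2 hq
    have h1 : (p * q⁻¹).im = (p.im * q.re - p.re * q.im) / ‖q‖ ^ 2 := by
      rw [Complex.mul_im, Complex.inv_re, Complex.inv_im, Complex.normSq_eq_norm_sq]; ring
    rw [h1, abs_div, abs_of_pos (pow_pos hn 2)]
    field_simp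
    ring

theorem smul_hpt (m n : ℤ) (g : G) {J : Oct} (hJ : IsImUnit J) {p q : ℂ} (hpq : p ≠ 0 ∨ q ≠ 0)
    (v : S7) : g • hpt m n J p q v = hpt m n (g.2.1 J) (g.1.1 0 0 * p + g.1.1 0 1 * q)
      (-g.1.1 0 1 * p + g.1.1 0 0 * q) (g.2.sph v) := by
  change so2Act m n g.1 (g2Act m n g.2 _) = _
  rw [g2Act_hpt m n _ hJ hpq, so2Act_hpt m n _ (g.2.isImUnit hJ) hpq]

theorem height_smul (m n : ℤ) (g : G) (x : E m n) : height m n (g • x) = height m n x := by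
  obtain ⟨J, p, q, v, hJ, hpq, rfl⟩ := exists_hpt x
  obtain ⟨-, -, hab⟩ := SO2.entries g.1
  rw [smul_hpt m n g hJ hpq, height_hpt m n (g.2.isImUnit hJ), height_hpt m n hJ]
  simp only [← Complex.normSq_eq_norm_sq, Complex.normSq_apply, Complex.add_re, Complex.add_im,
    Complex.mul_re, Complex.mul_im, Complex.neg_re, Complex.neg_im, Complex.ofReal_re,
    Complex.ofReal_im]
  congr 1
  · congr 1
    linear_combination (p.im * q.re - p.re * q.im) * hab
  · linear_combination (p.re ^ 2 + p.im ^ 2 + q.re ^ 2 + q.im ^ 2) * hab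

/-! ### Normal forms of points under `SO(2) × G₂` -/

/-- The element of `SO(2)` with first row `(cos θ, sin θ)`. -/
def SO2.ofAngle (θ : ℝ) : SO2 := ⟨rot θ, by
  rw [Matrix.mem_specialOrthogonalGroup_iff, Matrix.mem_orthogonalGroup_iff]
  have h := Real.cos_sq_add_sin_sq θ
  constructor
  · ext i j
    fin_cases i <;> fin_cases j <;>
      simp [rot, Matrix.mul_apply, Fin.sum_univ_two] <;> linarith
  · rw [Matrix.det_fin_two]
    simp [rot]; linarith⟩

/-- `SO(2)` moves every point of the projective line to a purely imaginary point of the closed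
unit disc. -/
theorem SO2.exists_normal_form (p q : ℂ) : ∃ γ : SO2,
    ((γ.1 0 0 * p + γ.1 0 1 * q : ℂ) * starRingEnd ℂ (-γ.1 0 1 * p + γ.1 0 0 * q : ℂ)).re = 0 ∧
      ‖(γ.1 0 0 * p + γ.1 0 1 * q : ℂ)‖ ≤ ‖(-γ.1 0 1 * p + γ.1 0 0 * q : ℂ)‖ := by
  set D : ℝ := ‖q‖ ^ 2 - ‖p‖ ^ 2 with hD
  set R : ℝ := (p * starRingEnd ℂ q).re with hR
  -- Rotating `(p, q)` by an angle rotates the vector `(|q|² - |p|², 2 Re (p q̄))` by twice that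
  -- angle. Half the argument of `w` thus brings it to `(‖w‖, 0)`: the real part vanishes and `|p| ≤
  -- |q|`.
  set w : ℂ := ⟨D, 2 * R⟩ with hw
  have hre : ‖w‖ * Real.cos w.arg = D := Complex.norm_mul_cos_arg w
  have him : ‖w‖ * Real.sin w.arg = 2 * R := Complex.norm_mul_sin_arg w
  refine ⟨SO2.ofAngle (-(w.arg / 2)), ?_⟩
  have hc : Real.cos w.arg = Real.cos (w.arg / 2) ^ 2 - Real.sin (w.arg / 2) ^ 2 := by
    conv_lhs => rw [show w.arg = 2 * (w.arg / 2) by ring]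
    rw [Real.cos_two_mul']
  have hs : Real.sin w.arg = 2 * Real.sin (w.arg / 2) * Real.cos (w.arg / 2) := by
    conv_lhs => rw [show w.arg = 2 * (w.arg / 2) by ring]
    rw [Real.sin_two_mul]
  have h1 := Real.cos_sq_add_sin_sq (w.arg / 2)
  have h2 := Real.cos_sq_add_sin_sq w.arg
  have e0 : (SO2.ofAngle (-(w.arg / 2))).1 0 0 = Real.cos (w.arg / 2) := by
    simp [SO2.ofAngle, rot]
  have e1 : (SO2.ofAngle (-(w.arg / 2))).1 0 1 = -Real.sin (w.arg / 2) := by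
    simp [SO2.ofAngle, rot]
  rw [e0, e1]
  rw [← Complex.normSq_eq_norm_sq, ← Complex.normSq_eq_norm_sq, Complex.normSq_apply,
    Complex.normSq_apply] at hD
  simp only [Complex.mul_re, Complex.conj_re, Complex.conj_im] at hR
  set c := Real.cos (w.arg / 2)
  set s := Real.sin (w.arg / 2)
  constructor
  · simp only [Complex.mul_re, Complex.mul_im, Complex.add_re, Complex.add_im, Complex.neg_re,
      Complex.neg_im, Complex.conj_re, Complex.conj_im, Complex.ofReal_re, Complex.ofReal_im]
    have : (c ^ 2 - s ^ 2) * R - c * s * D = 0 := by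
      rw [← hc]
      have : R = ‖w‖ * Real.sin w.arg / 2 := by linarith
      rw [this, ← hre, hs]; ring
    rw [hR, hD] at this
    linear_combination this
  · refine (sq_le_sq₀ (norm_nonneg _) (norm_nonneg _)).1 ?_
    rw [← Complex.normSq_eq_norm_sq, ← Complex.normSq_eq_norm_sq, Complex.normSq_apply,
      Complex.normSq_apply]
    simp only [Complex.mul_re, Complex.mul_im, Complex.add_re, Complex.add_im, Complex.neg_re,
      Complex.neg_im, Complex.ofReal_re, Complex.ofReal_im]
    have : 0 ≤ (c ^ 2 - s ^ 2) * D + 4 * (c * s) * R := by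
      have h3 : (c ^ 2 - s ^ 2) * D + 4 * (c * s) * R = ‖w‖ := by
        rw [← hc, ← hre]
        have : R = ‖w‖ * Real.sin w.arg / 2 := by linarith
        rw [this]
        linear_combination (-‖w‖ * Real.sin w.arg) * hs + ‖w‖ * h2
      rw [h3]; exact norm_nonneg _
    rw [hR, hD] at this
    linarith

theorem IsImUnit.neg {J : Oct} (hJ : IsImUnit J) : IsImUnit (-J) :=
  ⟨by simp [hJ.1], by rw [norm_neg, hJ.2]⟩

theorem isImUnit_e_three : IsImUnit (e 3) := ⟨by simp [e], by simp [e]⟩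

/-- Every point is in the orbit of a point `(t J, v)` with `0 ≤ t ≤ 1`. -/
theorem exists_smul_eq_chart {m n : ℤ} (x : E m n) : ∃ (γ : SO2) (J : Oct) (t : ℝ) (v : S7),
    IsImUnit J ∧ 0 ≤ t ∧ t ≤ 1 ∧ γ • x = chart m n (t • J) v := by
  obtain ⟨J, p, q, v, hJ, hpq, rfl⟩ := exists_hpt x
  obtain ⟨γ, h1, h2⟩ := SO2.exists_normal_form p q
  have hne := γ.ne_zero_or hpq
  have hsm := so2Act_hpt m n γ hJ hpq v
  set p' : ℂ := γ.1 0 0 * p + γ.1 0 1 * q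
  set q' : ℂ := -γ.1 0 1 * p + γ.1 0 0 * q
  have hq : q' ≠ 0 := by
    intro h
    rw [h, norm_zero] at h2
    have : p' = 0 := norm_le_zero_iff.1 h2
    tauto
  have hqn : 0 < ‖q'‖ := norm_pos_iff.2 hq
  have hre : (p' * q'⁻¹).re = 0 := by
    rw [Complex.inv_def, ← mul_assoc, Complex.re_mul_ofReal, h1, zero_mul]
  have hle : ‖p' * q'⁻¹‖ ≤ 1 := by
    rw [norm_mul, norm_inv, ← div_eq_mul_inv]
    exact (div_le_one hqn).2 h2
  have him : |(p' * q'⁻¹).im| ≤ 1 := (Complex.abs_im_le_norm _).trans hle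
  have hx : γ • hpt m n J p q v = chart m n ((p' * q'⁻¹).im • J) (twist m n (cx J q') v) := by
    refine hsm.trans ?_
    rw [hpt, if_pos hq]
    congr 1
    simp [cx, hre]
  -- A negative imaginary part is made positive by passing from `J` to `-J`.
  rcases le_total 0 (p' * q'⁻¹).im with h | h
  · exact ⟨γ, J, _, _, hJ, h, (abs_le.1 him).2, hx⟩
  · refine ⟨γ, -J, -(p' * q'⁻¹).im, twist m n (cx J q') v, IsImUnit.neg hJ, by linarith, by
      linarith [(abs_le.1 him).1], ?_⟩
    rw [hx, smul_neg, neg_smul, neg_neg]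

theorem re_mul_of_re_eq_zero {x y : Oct} (hx : x 0 = 0) : (x * y) 0 = -inner ℝ x y := by
  rw [inner_eq]; simp [mul_def, mul, hx]; ring

theorem S13.exists_smul_eq_pt {k : ℤ} (hk : Odd k) (x : S13 k hk) :
    ∃ (g : G) (t : Set.Icc (0 : ℝ) 1), g • x = S13.pt hk 0 t := by
  obtain ⟨γ, J, t, v, hJ, ht0, ht1, hγ⟩ := exists_smul_eq_chart (x : Sigma15 k)
  have hmem : γ • (x : Sigma15 k) ∈ S13Set k := by
    have h := (S13 k hk).smul_mem (γ, (1 : G2)) x.2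
    change γ • (1 : G2) • (x : Sigma15 k) ∈ S13Set k at h
    rwa [one_smul] at h
  rw [hγ, mem_S13Set hk] at hmem
  obtain ⟨hv0, htv⟩ : (v : Oct) 0 = 0 ∧ (t • J * (v : Oct)) 0 = 0 := hmem
  have hv : IsImUnit (v : Oct) := ⟨hv0, norm_eq_of_mem_sphere v⟩
  obtain ⟨g₁, hg₁⟩ := exists_map_eq_e_one hv
  have key : ∀ g : G2, g.1 (t • J) = t • e 3 → g.1 v = e 1 →
      ∃ (g : G) (t : Set.Icc (0 : ℝ) 1), g • x = S13.pt hk 0 t := by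
    intro g h1 h2
    refine ⟨(γ, g), ⟨t, ht0, ht1⟩, Subtype.ext ?_⟩
    change γ • g • (x : Sigma15 k) = chart _ _ ((0 : ℝ) • (1 : Oct) + t • e 3) s1
    rw [so2_g2_comm, hγ, zero_smul, zero_add, ← h1]
    exact congrArg (chart _ _ _) (Subtype.ext h2)
  -- For `t = 0` the condition on `u v` says nothing about `J`, but `J` does not enter the point
  -- either. For `t > 0` it says that `J` is orthogonal to `v`.
  rcases ht0.eq_or_lt with rfl | ht
  · exact key g₁ (by simp) hg₁
  · have h1 : (g₁.1 J) 1 = 0 := by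
      rw [← inner_e_right, ← hg₁, G2.inner_map]
      rw [Oct.smul_mul', PiLp.smul_apply, re_mul_of_re_eq_zero hJ.1, smul_eq_mul] at htv
      simpa [ht.ne'] using htv
    obtain ⟨g₂, h2, h3⟩ := exists_map_eq_e_three (g₁.isImUnit hJ) h1
    refine key (g₂ * g₁) ?_ ?_
    · change g₂.1 (g₁.1 (t • J)) = _
      rw [map_smul, map_smul, h3]
    · change g₂.1 (g₁.1 v) = _
      rw [hg₁, h2]

theorem S13.coe_pt {k : ℤ} (hk : Odd k) (u₁ u₂ : ℝ) :
    (S13.pt hk u₁ u₂ : Sigma15 k) = hpt _ _ (e 3) ⟨u₁, u₂⟩ 1 s1 :=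
  chart_cx _ _ ⟨u₁, u₂⟩ s1

theorem S13.coe_pt' {k : ℤ} (hk : Odd k) :
    (S13.pt' hk : Sigma15 k) = hpt _ _ (e 3) 1 0 s1 := by
  rw [← map_zero (starRingEnd ℂ), ← chart'_cx _ _ isImUnit_e_three, cx_zero]
  rfl

theorem S13.height_pt {k : ℤ} (hk : Odd k) (t : ℝ) :
    height _ _ (S13.pt hk 0 t : Sigma15 k) = |t| / (1 + t ^ 2) := by
  rw [S13.coe_pt, height_hpt _ _ isImUnit_e_three,
    ← Complex.normSq_eq_norm_sq, Complex.normSq_apply]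
  simp [add_comm, sq]

theorem injOn_div_one_add_sq :
    Set.InjOn (fun t : ℝ => |t| / (1 + t ^ 2)) (Set.Icc 0 1) := by
  intro s hs t ht h
  simp only at h
  rw [abs_of_nonneg hs.1, abs_of_nonneg ht.1, div_eq_div_iff (by positivity) (by positivity)] at h
  -- The second factor reflects the symmetry of the function under `t ↦ 1 / t`. On `[0, 1]` it
  -- vanishes only at `s = t = 1`.
  have h1 : (s - t) * (1 - s * t) = 0 := by linear_combination h
  rcases mul_eq_zero.1 h1 with h2 | h2
  · linarith
  · have hs1 : s = 1 := by nlinarith [hs.1, hs.2, ht.1, ht.2]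
    have ht1 : t = 1 := by nlinarith [hs.1, hs.2, ht.1, ht.2]
    rw [hs1, ht1]

theorem S13.continuous_pt {k : ℤ} (hk : Odd k) :
    Continuous fun t : Set.Icc (0 : ℝ) 1 => S13.pt hk 0 t := by
  refine Continuous.subtype_mk ?_ _
  exact (continuous_chart _ _).comp (by fun_prop :
    Continuous fun t : Set.Icc (0 : ℝ) 1 => ((0 : ℝ) • (1 : Oct) + (t : ℝ) • e 3, s1))

theorem S13.isCohomogeneityOne {k : ℤ} (hk : Odd k) :
    IsCohomogeneityOne (S13 k hk) fun t => S13.pt hk 0 t := by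
  refine isCohomogeneityOne_of_invariant (S13.continuous_pt hk) (S13.exists_smul_eq_pt hk)
    (f := fun x => height _ _ (x : Sigma15 k))
    ((continuous_height _ _).comp continuous_subtype_val) (fun g x => height_smul _ _ g _) ?_
  intro s t h
  simp only [Function.comp_apply, S13.height_pt] at h
  exact Subtype.ext (injOn_div_one_add_sq s.2 t.2 h)

/-! ### The involution and the quotient `P¹³_k` -/

/-- The element `-1` of `SO(2)`. -/
def SO2.negOne : SO2 := ⟨-1, by
  rw [Matrix.mem_specialOrthogonalGroup_iff, Matrix.mem_orthogonalGroup_iff]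
  constructor
  · simp
  · simp [Matrix.det_fin_two]⟩

/-- The element `(-1, 1)` of `SO(2) × G₂`. -/
def negOne : G := (SO2.negOne, 1)

theorem negOne_mul_self : negOne * negOne = 1 := by
  refine Prod.ext (Subtype.ext ?_) (one_mul 1)
  change (-1 : Matrix (Fin 2) (Fin 2) ℝ) * -1 = 1
  simp

/-- Powers of `-1` are real and commute with `v`, leaving the factor `(-1) ^ (m + n) = -1`. -/
theorem twist_neg_one {m n : ℤ} (h : m + n = 1) {J : Oct} (hJ : IsImUnit J) (v : S7) :
    twist m n (cx J (-1)) v = -v := by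
  ext1
  rw [coe_twist_cx m n hJ (by simp), h]
  have h1 : ((-1 : ℂ) ^ m) * (-1) ^ n = -1 := by rw [← zpow_add₀ (by simp), h, zpow_one]
  have h3 : cx J (-1) = (-1 : ℝ) • (1 : Oct) := by simp [cx]
  rcases Int.even_or_odd m with hm | hm
  · rw [hm.neg_one_zpow, one_mul] at h1
    rw [hm.neg_one_zpow, h1, h3, Oct.mul_smul', mul_one', cx_one, one_mul']
    simp
  · rw [hm.neg_one_zpow] at h1
    have h2 : (-1 : ℂ) ^ n = 1 := by simpa using h1
    rw [hm.neg_one_zpow, h2, h3, Oct.smul_mul', cx_one, mul_one', one_mul']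
    simp

/-- The rotation `-1` multiplies both homogeneous coordinates by `-1`. By homogeneity this amounts
to a twist by `-1` in the fibre. -/
theorem negOne_smul {m n : ℤ} (h : m + n = 1) (x : E m n) : negOne • x = invT m n x := by
  obtain ⟨J, p, q, v, hJ, hpq, rfl⟩ := exists_hpt x
  rw [smul_hpt m n _ hJ hpq, invT_hpt, ← twist_neg_one h hJ, hpt_twist m n hJ hpq (by simp)]
  have e0 : negOne.1.1 0 0 = -1 := by simp [negOne, SO2.negOne]
  have e1 : negOne.1.1 0 1 = 0 := by simp [negOne, SO2.negOne]
  rw [e0, e1]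
  have e2 : negOne.2.sph v = v := rfl
  have e3 : negOne.2.1 J = J := rfl
  rw [e2, e3]
  congr 1 <;> simp

theorem P13.mk_eq_mk {k : ℤ} {hk : Odd k} {x y : S13 k hk} :
    P13.mk x = P13.mk y ↔ y = x ∨ y = negOne • x := by
  have hT : ∀ a b : S13 k hk, (b : Sigma15 k) = invT _ _ (a : Sigma15 k) ↔ b = negOne • a := by
    intro a b
    rw [← negOne_smul (sum_eq_one hk)]
    exact ⟨fun h => Subtype.ext h, fun h => congrArg Subtype.val h⟩
  constructor
  · intro h
    -- The predicate "equal to `x` or to its partner" descends to the quotient because `negOne`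
    -- squares to `1`; it shows that no further points are identified.
    let φ : P13 k hk → Prop := Quot.lift (fun y => y = x ∨ y = negOne • x) (by
      intro a b hab
      rw [hT] at hab
      have : a = negOne • b := by rw [hab, smul_smul, negOne_mul_self, one_smul]
      apply propext
      constructor
      · rintro (h | h)
        · right; rw [hab, h]
        · left; rw [hab, h, smul_smul, negOne_mul_self, one_smul]
      · rintro (h | h)
        · right; rw [this, h]
        · left; rw [this, h, smul_smul, negOne_mul_self, one_smul])
    have h1 : φ (P13.mk x) := Or.inl rfl
    rw [h] at h1
    exact h1
  · rintro (h | h)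
    · rw [h]
    · exact Quot.sound ((hT x y).2 h)

theorem P13.isOpenQuotientMap_mk (k : ℤ) (hk : Odd k) :
    IsOpenQuotientMap (P13.mk : S13 k hk → P13 k hk) where
  surjective := Quot.mk_surjective
  continuous := continuous_quot_mk
  isOpenMap := by
    intro U hU
    change IsOpen (P13.mk ⁻¹' (P13.mk '' U))
    have : P13.mk ⁻¹' (P13.mk '' U) = U ∪ (fun x : S13 k hk => negOne • x) ⁻¹' U := by
      ext y
      constructor
      · rintro ⟨x, hx, h⟩
        rcases P13.mk_eq_mk.1 h with rfl | rfl
        · exact Or.inl hx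
        · right
          change negOne • negOne • x ∈ U
          rwa [smul_smul, negOne_mul_self, one_smul]
      · rintro (h | h)
        · exact ⟨y, h, rfl⟩
        · refine ⟨_, h, P13.mk_eq_mk.2 (Or.inr ?_)⟩
          rw [smul_smul, negOne_mul_self, one_smul]
    rw [this]
    exact hU.union (hU.preimage (continuous_const_smul negOne))

instance (k : ℤ) (hk : Odd k) : ContinuousSMul G (P13 k hk) where
  continuous_smul := by
    refine ((IsOpenQuotientMap.id (X := G)).prodMap
      (P13.isOpenQuotientMap_mk k hk)).isQuotientMap.continuous_iff.2 ?_
    exact (P13.isOpenQuotientMap_mk k hk).continuous.comp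
      (continuous_smul : Continuous fun p : G × S13 k hk => p.1 • p.2)

theorem P13.smul_mk {k : ℤ} {hk : Odd k} (g : G) (x : S13 k hk) :
    g • P13.mk x = P13.mk (g • x) := rfl

/-- Fixing a class means fixing its representative or interchanging it with its partner. In the
latter case the product with `negOne` fixes the representative. -/
theorem P13.mem_stabilizer {k : ℤ} {hk : Odd k} (g : G) (x : S13 k hk) :
    g ∈ MulAction.stabilizer G (P13.mk x) ↔
      g ∈ MulAction.stabilizer G x ∨ negOne * g ∈ MulAction.stabilizer G x := by
  simp only [MulAction.mem_stabilizer_iff, P13.smul_mk, P13.mk_eq_mk, mul_smul]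
  exact or_congr eq_comm eq_comm

theorem P13.isCohomogeneityOne {k : ℤ} (hk : Odd k) :
    IsCohomogeneityOne (P13 k hk) fun t => P13.mk (S13.pt hk 0 t) := by
  let f : P13 k hk → ℝ := Quot.lift (fun x => height _ _ (x : Sigma15 k)) (by
    intro a b h
    rw [h, ← negOne_smul (sum_eq_one hk)]
    exact (height_smul _ _ _ _).symm)
  have hf : Continuous f :=
    continuous_quot_lift _ ((continuous_height _ _).comp continuous_subtype_val)
  refine isCohomogeneityOne_of_invariant
    ((P13.isOpenQuotientMap_mk k hk).continuous.comp (S13.continuous_pt hk)) ?_ hf ?_ ?_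
  · intro x
    obtain ⟨x, rfl⟩ := (P13.isOpenQuotientMap_mk k hk).surjective x
    obtain ⟨g, t, h⟩ := S13.exists_smul_eq_pt hk x
    exact ⟨g, t, by rw [P13.smul_mk, h]⟩
  · intro g x
    obtain ⟨x, rfl⟩ := (P13.isOpenQuotientMap_mk k hk).surjective x
    exact height_smul _ _ g _
  · intro s t h
    have h' : height _ _ (S13.pt hk 0 s : Sigma15 k) = height _ _ (S13.pt hk 0 t : Sigma15 k) := h
    rw [S13.height_pt, S13.height_pt] at h'
    exact Subtype.ext (injOn_div_one_add_sq s.2 t.2 h')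

/-! ### Block matrices and the images of `e 1` and `e 3` -/

theorem diag214_eq (R : Matrix (Fin 2) (Fin 2) ℝ) (A : Matrix (Fin 4) (Fin 4) ℝ) :
    diag214 R A = !![R 0 0, R 0 1, 0, 0, 0, 0, 0; R 1 0, R 1 1, 0, 0, 0, 0, 0;
      0, 0, 1, 0, 0, 0, 0; 0, 0, 0, A 0 0, A 0 1, A 0 2, A 0 3;
      0, 0, 0, A 1 0, A 1 1, A 1 2, A 1 3; 0, 0, 0, A 2 0, A 2 1, A 2 2, A 2 3;
      0, 0, 0, A 3 0, A 3 1, A 3 2, A 3 3] := by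
  ext i j; fin_cases i <;> fin_cases j <;> rfl

theorem G2.map_e_apply_zero (g : G2) (i : Fin 7) : (g.1 (e i.succ)) 0 = 0 := by
  rw [G2.re_map]; simp [e]

/-- If `g x` is a combination of images of other basis vectors, the corresponding coordinates of
the images of the remaining basis vectors vanish. -/
theorem G2.apply_coord_eq_zero (g : G2) {i j : Fin 8} {y : Oct} (hy : g.1 y = e j) (hi : y i = 0) :
    (g.1 (e i)) j = 0 := by
  rw [← inner_e_right, ← hy, G2.inner_map, inner_e_left, hi]

/-- The images of `e 1` and `e 3` determine that of `e 2 = e 3 * e 1`, hence the first three rows.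
The zeros below the upper left block come from orthogonality, and `A` is whatever remains, so no
condition on it is needed. -/
theorem exists_mat7_eq_diag214_iff (g : G2) {R : Matrix (Fin 2) (Fin 2) ℝ} (h10 : R 1 0 = -R 0 1)
    (h11 : R 1 1 = R 0 0) (h : R 0 0 ^ 2 + R 0 1 ^ 2 = 1) :
    (∃ A, mat7 g = diag214 R A) ↔
      g.1 (e 1) = R 0 0 • e 1 + R 0 1 • e 2 ∧ g.1 (e 3) = e 3 := by
  constructor
  · rintro ⟨A, hA⟩
    rw [diag214_eq] at hA
    have h0 : ∀ j : Fin 7, (g.1 (e 1)) j.succ = _ := fun j => congrFun (congrFun hA 0) j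
    have h2 : ∀ j : Fin 7, (g.1 (e 3)) j.succ = _ := fun j => congrFun (congrFun hA 2) j
    have z0 : (g.1 (e 1)) 0 = 0 := g.map_e_apply_zero 0
    have z2 : (g.1 (e 3)) 0 = 0 := g.map_e_apply_zero 2
    constructor
    · refine ext8 (z0.trans ?_) ((h0 0).trans ?_) ((h0 1).trans ?_) ((h0 2).trans ?_)
        ((h0 3).trans ?_) ((h0 4).trans ?_) ((h0 5).trans ?_) ((h0 6).trans ?_) <;> simp [e]
    · refine ext8 (z2.trans ?_) ((h2 0).trans ?_) ((h2 1).trans ?_) ((h2 2).trans ?_)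
        ((h2 3).trans ?_) ((h2 4).trans ?_) ((h2 5).trans ?_) ((h2 6).trans ?_) <;> simp [e]
  · rintro ⟨h1, h3⟩
    have h2 : g.1 (e 2) = -R 0 1 • e 1 + R 0 0 • e 2 := by
      rw [g.map_e_two, h1, h3]
      apply ext8 <;> simp [e, mul_def, mul]
    -- Inverting the rotation `R` gives preimages of `e 1` and `e 2` inside their span. These are
    -- orthogonal to `e 4, …, e 7`, and `g` preserves the inner product.
    have y1 : g.1 (R 0 0 • e 1 - R 0 1 • e 2) = e 1 := by
      rw [map_sub, map_smul, map_smul, h1, h2]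
      apply ext8 <;> simp [e] <;> first | linear_combination h | ring
    have y2 : g.1 (R 0 1 • e 1 + R 0 0 • e 2) = e 2 := by
      rw [map_add, map_smul, map_smul, h1, h2]
      apply ext8 <;> simp [e] <;> first | linear_combination h | ring
    refine ⟨Matrix.of fun i j => mat7 g (Fin.natAdd 3 i) (Fin.natAdd 3 j), ?_⟩
    rw [diag214_eq]
    have k1 : ∀ i : Fin 8, 4 ≤ i → (g.1 (e i)) 1 = 0 := fun i hi =>
      g.apply_coord_eq_zero y1 (by
        fin_cases i <;> simp [e] <;> exact absurd hi (by decide))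
    have k2 : ∀ i : Fin 8, 4 ≤ i → (g.1 (e i)) 2 = 0 := fun i hi =>
      g.apply_coord_eq_zero y2 (by
        fin_cases i <;> simp [e] <;> exact absurd hi (by decide))
    have k3 : ∀ i : Fin 8, 4 ≤ i → (g.1 (e i)) 3 = 0 := fun i hi =>
      g.apply_coord_eq_zero h3 (by
        fin_cases i <;> simp [e] <;> exact absurd hi (by decide))
    have hr0 : ∀ j : Fin 7, mat7 g 0 j = (R 0 0 • e 1 + R 0 1 • e 2) j.succ := fun j => by
      rw [← h1]; rfl
    have hr1 : ∀ j : Fin 7, mat7 g 1 j = (-R 0 1 • e 1 + R 0 0 • e 2) j.succ := fun j => by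
      rw [← h2]; rfl
    have hr2 : ∀ j : Fin 7, mat7 g 2 j = e 3 j.succ := fun j => by
      rw [← h3]; rfl
    have hc : ∀ i : Fin 4, mat7 g (Fin.natAdd 3 i) 0 = 0 ∧ mat7 g (Fin.natAdd 3 i) 1 = 0 ∧
        mat7 g (Fin.natAdd 3 i) 2 = 0 := fun i => by
      have hi : (4 : Fin 8) ≤ (Fin.natAdd 3 i).succ := by revert i; decide
      exact ⟨k1 _ hi, k2 _ hi, k3 _ hi⟩
    ext i j
    fin_cases i
    · refine (hr0 j).trans ?_; fin_cases j <;> simp [e]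
    · refine (hr1 j).trans ?_; fin_cases j <;> simp [e, h10, h11]
    · refine (hr2 j).trans ?_; fin_cases j <;> simp [e]
    · obtain ⟨c0, c1, c2⟩ := hc 0
      fin_cases j <;> first | exact c0 | exact c1 | exact c2 | rfl
    · obtain ⟨c0, c1, c2⟩ := hc 1
      fin_cases j <;> first | exact c0 | exact c1 | exact c2 | rfl
    · obtain ⟨c0, c1, c2⟩ := hc 2
      fin_cases j <;> first | exact c0 | exact c1 | exact c2 | rfl
    · obtain ⟨c0, c1, c2⟩ := hc 3
      fin_cases j <;> first | exact c0 | exact c1 | exact c2 | rfl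

/-! ### The determinant on the orthogonal complement of `e 1` -/

/-- The real form of a complex matrix has nonnegative determinant. -/
theorem det_fromBlocks_neg_nonneg {ι : Type*} [Fintype ι] [DecidableEq ι] (X Y : Matrix ι ι ℝ) :
    0 ≤ (Matrix.fromBlocks X Y (-Y) X).det := by
  set Xc : Matrix ι ι ℂ := X.map Complex.ofRealHom with hX
  set Yc : Matrix ι ι ℂ := Y.map Complex.ofRealHom with hY
  set Z := Xc + Complex.I • Yc with hZ
  have hmap : Complex.ofRealHom.mapMatrix (Matrix.fromBlocks X Y (-Y) X)
      = Matrix.fromBlocks Xc Yc (-Yc) Xc := by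
    ext (i | i) (j | j) <;> simp [Xc, Yc]
  -- Over `ℂ`, conjugation by a unipotent matrix makes the block matrix triangular with diagonal
  -- blocks `X - iY` and `Z = X + iY`. These are complex conjugates, so the determinant is `|det
  -- Z|²`.
  have hprod : Matrix.fromBlocks 1 (Complex.I • (1 : Matrix ι ι ℂ)) 0 1
      * Matrix.fromBlocks Xc Yc (-Yc) Xc
      * Matrix.fromBlocks 1 (-Complex.I • (1 : Matrix ι ι ℂ)) 0 1
      = Matrix.fromBlocks (Xc - Complex.I • Yc) 0 (-Yc) Z := by
    rw [Matrix.fromBlocks_multiply, Matrix.fromBlocks_multiply]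
    congr 1
    · simp [sub_eq_add_neg]
    · simp [smul_smul]
      module
    · simp
    · simp [hZ, add_comm]
  have hconj : (Xc - Complex.I • Yc) = (starRingEnd ℂ).mapMatrix Z := by
    ext i j
    simp [hZ, Xc, Yc, sub_eq_add_neg]
  have hdet := congrArg Matrix.det hprod
  rw [Matrix.det_mul, Matrix.det_mul, Matrix.det_fromBlocks_zero₂₁, Matrix.det_fromBlocks_zero₂₁,
    Matrix.det_fromBlocks_zero₁₂, hconj, ← RingHom.map_det, ← hmap, ← RingHom.map_det,
    mul_comm (starRingEnd ℂ _), Complex.mul_conj] at hdet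
  simp only [Matrix.det_one, mul_one, one_mul] at hdet
  have : (Matrix.fromBlocks X Y (-Y) X).det = Complex.normSq Z.det := by
    have h2 : ((Matrix.fromBlocks X Y (-Y) X).det : ℂ) = (Complex.normSq Z.det : ℂ) := hdet
    exact_mod_cast h2
  rw [this]
  exact Complex.normSq_nonneg _

/-- The lower right `6 × 6` block of the matrix of an element of `G₂`. -/
def block6 (g : G2) : Matrix (Fin 6) (Fin 6) ℝ :=
  Matrix.of fun i j => (g.1 (e i.succ.succ)) j.succ.succ

theorem G2.block_column (g : G2) {ε : ℝ} (hε : ε = 1 ∨ ε = -1) (h : g.1 (e 1) = ε • e 1)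
    (i : Fin 6) : (g.1 (e i.succ.succ)) 1 = 0 := by
  refine g.apply_coord_eq_zero (y := ε • e 1) ?_ ?_
  · rw [map_smul, h, smul_smul]
    rcases hε with rfl | rfl <;> simp
  · fin_cases i <;> simp [e]

theorem block6_mem_orthogonalGroup (g : G2) {ε : ℝ} (hε : ε = 1 ∨ ε = -1)
    (h : g.1 (e 1) = ε • e 1) : block6 g ∈ Matrix.orthogonalGroup (Fin 6) ℝ := by
  rw [Matrix.mem_orthogonalGroup_iff]
  ext i j
  have h1 : (block6 g * star (block6 g)) i j
      = inner ℝ (g.1 (e i.succ.succ)) (g.1 (e j.succ.succ)) := by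
    rw [inner_eq, g.block_column hε h, G2.re_map, show e i.succ.succ 0 = 0 by simp [e]]
    simp [Matrix.mul_apply, block6, Fin.sum_univ_six, Matrix.star_eq_conjTranspose]
  refine h1.trans ?_
  rw [G2.inner_map, inner_e_right, Matrix.one_apply]
  simp [e, eq_comm]

/-- An automorphism fixing `e 1` commutes with left multiplication by `e 1`. In coordinates, the row
of `e j` is thereby expressed by the row of `e i`. -/
theorem G2.map_e_one_mul (g : G2) (h : g.1 (e 1) = e 1) (i j : Fin 8) (hj : e 1 * e i = e j)
    (l : Fin 8) : (g.1 (e j)) l = (e 1 * g.1 (e i)) l := by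
  rw [← hj, g.map_mul, h]

/-- The complex structure of the orthogonal complement of `e 1`. -/
def complexEquiv : Fin 3 ⊕ Fin 3 ≃ Fin 6 :=
  -- The index `i` stands for `e (i + 2)`. The pairs are `(e 2, e 3)`, `(e 4, e 5)`, `(e 7, e 6)`,
  -- the second vector being `e 1` times the first.
  Equiv.ofBijective (Sum.elim ![0, 2, 5] ![1, 3, 4]) (by decide)

/-- The block is the real form of a complex `3 × 3` matrix, so its determinant is nonnegative;
orthogonality leaves only the value `1`. -/
theorem det_block6_of_fix (g : G2) (h : g.1 (e 1) = e 1) : (block6 g).det = 1 := by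
  have horth := block6_mem_orthogonalGroup g (Or.inl rfl) (h.trans (one_smul ℝ _).symm)
  have hnn : 0 ≤ (block6 g).det := by
    rw [← Matrix.det_submatrix_equiv_self complexEquiv]
    have : (block6 g).submatrix complexEquiv complexEquiv = Matrix.fromBlocks
        (Matrix.of fun i j => block6 g (complexEquiv (Sum.inl i)) (complexEquiv (Sum.inl j)))
        (Matrix.of fun i j => block6 g (complexEquiv (Sum.inl i)) (complexEquiv (Sum.inr j)))
        (-(Matrix.of fun i j => block6 g (complexEquiv (Sum.inl i)) (complexEquiv (Sum.inr j))))
        (Matrix.of fun i j => block6 g (complexEquiv (Sum.inl i)) (complexEquiv (Sum.inl j))) := by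
      have h23 := g.map_e_one_mul h 2 3 (by apply ext8 <;> simp [mul_def, mul, e])
      have h45 := g.map_e_one_mul h 4 5 (by apply ext8 <;> simp [mul_def, mul, e])
      have h76 := g.map_e_one_mul h 7 6 (by apply ext8 <;> simp [mul_def, mul, e])
      ext (i | i) (j | j)
      · rfl
      · rfl
      · fin_cases i <;> fin_cases j
        · exact (h23 2).trans (by simp [mul_def, mul, e]; rfl)
        · exact (h23 4).trans (by simp [mul_def, mul, e]; rfl)
        · exact (h23 7).trans (by simp [mul_def, mul, e]; rfl)
        · exact (h45 2).trans (by simp [mul_def, mul, e]; rfl)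
        · exact (h45 4).trans (by simp [mul_def, mul, e]; rfl)
        · exact (h45 7).trans (by simp [mul_def, mul, e]; rfl)
        · exact (h76 2).trans (by simp [mul_def, mul, e]; rfl)
        · exact (h76 4).trans (by simp [mul_def, mul, e]; rfl)
        · exact (h76 7).trans (by simp [mul_def, mul, e]; rfl)
      · fin_cases i <;> fin_cases j
        · exact (h23 3).trans (by simp [mul_def, mul, e]; rfl)
        · exact (h23 5).trans (by simp [mul_def, mul, e]; rfl)
        · exact (h23 6).trans (by simp [mul_def, mul, e]; rfl)
        · exact (h45 3).trans (by simp [mul_def, mul, e]; rfl)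
        · exact (h45 5).trans (by simp [mul_def, mul, e]; rfl)
        · exact (h45 6).trans (by simp [mul_def, mul, e]; rfl)
        · exact (h76 3).trans (by simp [mul_def, mul, e]; rfl)
        · exact (h76 5).trans (by simp [mul_def, mul, e]; rfl)
        · exact (h76 6).trans (by simp [mul_def, mul, e]; rfl)
    rw [this]
    exact det_fromBlocks_neg_nonneg _ _
  have h1 := Matrix.det_of_mem_unitary horth
  rw [Unitary.mem_iff] at h1
  have h2 : (block6 g).det * (block6 g).det = 1 := h1.2
  nlinarith

theorem det_block6 (g : G2) {ε : ℝ} (hε : ε = 1 ∨ ε = -1) (h : g.1 (e 1) = ε • e 1) :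
    (block6 g).det = ε := by
  rcases hε with rfl | rfl
  · exact det_block6_of_fix g (by rw [h, one_smul])
  -- The automorphism `τ` changes the signs of `e 1`, `e 2`, `e 5`, `e 6`. Composition with it
  -- restores `e 1` and multiplies the determinant of the block by `(-1)³`.
  · set τ := G2.rotA (-1) 0 (by norm_num) with hτ
    have h1 : (τ * g).1 (e 1) = e 1 := by
      change τ.1 (g.1 (e 1)) = e 1
      rw [h]
      apply ext8 <;> simp [hτ, G2.rotA, e]
    have h2 : block6 (τ * g) = block6 g * Matrix.diagonal ![-1, 1, 1, -1, -1, 1] := by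
      ext i j
      rw [Matrix.mul_diagonal]
      change (τ.1 (g.1 (e i.succ.succ))) j.succ.succ = (g.1 (e i.succ.succ)) j.succ.succ * _
      generalize g.1 (e i.succ.succ) = x
      fin_cases j <;> simp [hτ, G2.rotA]
    have h3 := det_block6_of_fix _ h1
    rw [h2, Matrix.det_mul, Matrix.det_diagonal] at h3
    simp [Fin.prod_univ_six] at h3
    linarith

theorem diag16_succ_succ (c : ℝ) (B : Matrix (Fin 6) (Fin 6) ℝ) (i j : Fin 6) :
    diag16 c B i.succ j.succ = B i j := by
  fin_cases i <;> fin_cases j <;> rfl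

theorem diag16_zero_succ (c : ℝ) (B : Matrix (Fin 6) (Fin 6) ℝ) (j : Fin 6) :
    diag16 c B 0 j.succ = 0 := by
  fin_cases j <;> rfl

theorem diag16_succ_zero (c : ℝ) (B : Matrix (Fin 6) (Fin 6) ℝ) (i : Fin 6) :
    diag16 c B i.succ 0 = 0 := by
  fin_cases i <;> rfl

theorem mat7_eq_diag16_block6 (g : G2) {ε : ℝ} (hε : ε = 1 ∨ ε = -1) (h : g.1 (e 1) = ε • e 1) :
    mat7 g = diag16 ε (block6 g) := by
  have h0 : ∀ j : Fin 7, mat7 g 0 j = (ε • e 1) j.succ := fun j => by rw [← h]; rfl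
  ext i j
  cases i using Fin.cases with
  | zero =>
    rw [h0]
    cases j using Fin.cases with
    | zero => simp [e]; rfl
    | succ j => rw [diag16_zero_succ]; fin_cases j <;> simp [e]
  | succ i =>
    cases j using Fin.cases with
    | zero => rw [diag16_succ_zero]; exact g.block_column hε h i
    | succ j => rw [diag16_succ_succ]; rfl

theorem map_e_one_of_mat7_eq {g : G2} {c : ℝ} {B : Matrix (Fin 6) (Fin 6) ℝ}
    (h : mat7 g = diag16 c B) : g.1 (e 1) = c • e 1 := by
  have h0 : ∀ j : Fin 7, (g.1 (e 1)) j.succ = diag16 c B 0 j := fun j => congrFun (congrFun h 0) j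
  have h1 : ∀ j : Fin 6, (g.1 (e 1)) j.succ.succ = 0 := fun j =>
    (h0 j.succ).trans (diag16_zero_succ c B j)
  have z0 : (g.1 (e 1)) 0 = 0 := g.map_e_apply_zero 0
  refine ext8 (z0.trans ?_) ((h0 0).trans ?_) ((h1 0).trans ?_) ((h1 1).trans ?_)
    ((h1 2).trans ?_) ((h1 3).trans ?_) ((h1 4).trans ?_) ((h1 5).trans ?_) <;> simp [e]
  rfl

theorem det_eq_or_of_mem_orthogonalGroup {B : Matrix (Fin 6) (Fin 6) ℝ}
    (hB : B ∈ Matrix.orthogonalGroup (Fin 6) ℝ) : B.det = 1 ∨ B.det = -1 := by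
  have h1 := Matrix.det_of_mem_unitary hB
  rw [Unitary.mem_iff] at h1
  exact mul_self_eq_one_iff.1 h1.2

/-! ### `SO(2)` as the unit circle, and membership in the groups -/

/-- The complex number `a + b i` of the element of `SO(2)` with first row `(a, b)`. -/
def SO2.toComplex (γ : SO2) : ℂ := ⟨γ.1 0 0, γ.1 0 1⟩

theorem SO2.norm_toComplex (γ : SO2) : ‖γ.toComplex‖ = 1 := by
  have h : ‖γ.toComplex‖ ^ 2 = 1 := by
    rw [← Complex.normSq_eq_norm_sq, Complex.normSq_apply, ← (SO2.entries γ).2.2]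
    simp only [SO2.toComplex]; ring
  exact (pow_eq_one_iff_of_nonneg (norm_nonneg _) two_ne_zero).1 h

theorem SO2.toComplex_ne_zero (γ : SO2) : γ.toComplex ≠ 0 := by
  rw [← norm_ne_zero_iff, γ.norm_toComplex]; exact one_ne_zero

theorem SO2.toComplex_one : SO2.toComplex 1 = 1 := by
  apply Complex.ext <;> simp [SO2.toComplex]

theorem SO2.toComplex_mul (γ δ : SO2) : (γ * δ).toComplex = γ.toComplex * δ.toComplex := by
  obtain ⟨h1, h2, -⟩ := SO2.entries δ
  apply Complex.ext
  · simp [SO2.toComplex, Matrix.mul_apply, Fin.sum_univ_two, h1]; ring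
  · simp [SO2.toComplex, Matrix.mul_apply, Fin.sum_univ_two, h2]

theorem SO2.continuous_toComplex : Continuous SO2.toComplex := by
  have h : SO2.toComplex = fun γ : SO2 => (γ.1 0 0 : ℂ) + γ.1 0 1 * Complex.I := by
    funext γ
    apply Complex.ext <;> simp [SO2.toComplex]
  rw [h]
  exact (Complex.continuous_ofReal.comp (SO2.continuous_entry 0 0)).add
    ((Complex.continuous_ofReal.comp (SO2.continuous_entry 0 1)).mul continuous_const)

theorem SO2.ext_entries {γ : SO2} {M : Matrix (Fin 2) (Fin 2) ℝ} (h0 : γ.1 0 0 = M 0 0)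
    (h1 : γ.1 0 1 = M 0 1) (h2 : M 1 0 = -M 0 1) (h3 : M 1 1 = M 0 0) : γ.1 = M := by
  obtain ⟨e1, e2, -⟩ := SO2.entries γ
  ext i j
  fin_cases i <;> fin_cases j
  · exact h0
  · exact h1
  · exact e1.trans ((congrArg Neg.neg h1).trans h2.symm)
  · exact e2.trans (h0.trans h3.symm)

theorem SO2.eq_smul_one_iff (γ : SO2) (ε : ℝ) :
    γ.1 = ε • (1 : Matrix (Fin 2) (Fin 2) ℝ) ↔ γ.1 0 0 = ε ∧ γ.1 0 1 = 0 := by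
  constructor
  · intro h
    rw [h]; simp
  · rintro ⟨h0, h1⟩
    exact SO2.ext_entries (by simpa using h0) (by simpa using h1) (by simp) (by simp)

theorem SO2.coe_eq_rot_iff (γ : SO2) (θ : ℝ) :
    γ.1 = rot θ ↔ γ.toComplex = Complex.exp (θ * Complex.I) := by
  constructor
  · intro h
    apply Complex.ext
    · rw [Complex.exp_ofReal_mul_I_re]; simp [SO2.toComplex, h, rot]
    · rw [Complex.exp_ofReal_mul_I_im]; simp [SO2.toComplex, h, rot]
  · intro h
    have h0 := congrArg Complex.re h
    have h1 := congrArg Complex.im h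
    rw [Complex.exp_ofReal_mul_I_re] at h0
    rw [Complex.exp_ofReal_mul_I_im] at h1
    exact SO2.ext_entries h0 h1 (by simp [rot]) (by simp [rot])

theorem SO2.exists_eq_rot (γ : SO2) : ∃ θ : ℝ, γ.1 = rot θ := by
  refine ⟨γ.toComplex.arg, (γ.coe_eq_rot_iff _).2 ?_⟩
  have h := Complex.norm_mul_exp_arg_mul_I γ.toComplex
  rw [γ.norm_toComplex, Complex.ofReal_one, one_mul] at h
  exact h.symm

theorem rot_entries_of_eq_exp {z : ℂ} {θ : ℝ} (h : z = Complex.exp (θ * Complex.I)) :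
    Real.cos θ = z.re ∧ Real.sin θ = z.im := by
  rw [h, Complex.exp_ofReal_mul_I_re, Complex.exp_ofReal_mul_I_im]
  exact ⟨rfl, rfl⟩

/-- This removes the angle: `R(kθ)` depends on `γ` only through `γ ^ k`, whichever `θ` represents
`γ`. -/
theorem SO2.cos_sin_eq {γ : SO2} {θ : ℝ} (h : γ.1 = rot θ) (k : ℤ) :
    Real.cos (k * θ) = (γ.toComplex ^ k).re ∧ Real.sin (k * θ) = (γ.toComplex ^ k).im := by
  apply rot_entries_of_eq_exp
  rw [(γ.coe_eq_rot_iff θ).1 h, ← Complex.exp_int_mul]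
  push_cast
  rw [mul_assoc]

theorem mem_groupKbar_iff_aux (k : ℤ) (g : G) {ε : ℝ} (hε : ε = 1 ∨ ε = -1) {θ : ℝ}
    (h : (g.1 : Matrix (Fin 2) (Fin 2) ℝ) = rot θ) :
    (∃ A, mat7 g.2 = diag214 (ε • rot (k * θ)) A) ↔
      g.2.1 (e 1) = (ε * (g.1.toComplex ^ k).re) • e 1 + (ε * (g.1.toComplex ^ k).im) • e 2 ∧
        g.2.1 (e 3) = e 3 := by
  obtain ⟨hc, hs⟩ := SO2.cos_sin_eq h k
  rw [exists_mat7_eq_diag214_iff]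
  · simp [rot, hc, hs]
  · simp [rot]
  · simp [rot]
  · rcases hε with rfl | rfl <;> simp [rot]

theorem mem_groupKbar_iff (k : ℤ) (g : G) : g ∈ groupKbar k ↔ ∃ ε : ℝ, (ε = 1 ∨ ε = -1) ∧
    g.2.1 (e 1) = (ε * (g.1.toComplex ^ k).re) • e 1 + (ε * (g.1.toComplex ^ k).im) • e 2 ∧
      g.2.1 (e 3) = e 3 := by
  constructor
  · rintro ⟨θ, ε, A, hε, h1, h2⟩
    exact ⟨ε, hε, (mem_groupKbar_iff_aux k g hε h1).1 ⟨A, h2⟩⟩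
  · rintro ⟨ε, hε, h⟩
    obtain ⟨θ, hθ⟩ := g.1.exists_eq_rot
    obtain ⟨A, hA⟩ := (mem_groupKbar_iff_aux k g hε hθ).2 h
    exact ⟨θ, ε, A, hε, hθ, hA⟩

theorem mem_groupK_iff (k : ℤ) (g : G) : g ∈ groupK k ↔
    g.2.1 (e 1) = (g.1.toComplex ^ k).re • e 1 + (g.1.toComplex ^ k).im • e 2 ∧
      g.2.1 (e 3) = e 3 := by
  have key : ∀ {θ : ℝ}, (g.1 : Matrix (Fin 2) (Fin 2) ℝ) = rot θ → _ := fun hθ =>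
    mem_groupKbar_iff_aux k g (Or.inl rfl) hθ
  simp only [one_smul, one_mul] at key
  constructor
  · rintro ⟨θ, A, h1, h2⟩
    exact (key h1).1 ⟨A, h2⟩
  · intro h
    obtain ⟨θ, hθ⟩ := g.1.exists_eq_rot
    obtain ⟨A, hA⟩ := (key hθ).2 h
    exact ⟨θ, A, hθ, hA⟩

theorem mem_groupLbar_iff (g : G) : g ∈ groupLbar ↔ ∃ ε δ : ℝ, (ε = 1 ∨ ε = -1) ∧
    (δ = 1 ∨ δ = -1) ∧ (g.1 : Matrix (Fin 2) (Fin 2) ℝ) = ε • 1 ∧ g.2.1 (e 1) = δ • e 1 := by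
  constructor
  · rintro ⟨ε, hε, B, hB, h1, h2⟩
    exact ⟨ε, B.det, hε, det_eq_or_of_mem_orthogonalGroup hB, h1, map_e_one_of_mat7_eq h2⟩
  · rintro ⟨ε, δ, hε, hδ, h1, h2⟩
    refine ⟨ε, hε, block6 g.2, block6_mem_orthogonalGroup g.2 hδ h2, h1, ?_⟩
    rw [det_block6 g.2 hδ h2]
    exact mat7_eq_diag16_block6 g.2 hδ h2

/-- The matrix `B` can only be the block of `g` on the complement of `e 1`. Its orthogonality and
`det B = ε` follow from `g e₁ = ε e₁`, so this sign is the only condition left. -/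
theorem mem_groupL_iff (g : G) : g ∈ groupL ↔ ∃ ε : ℝ, (ε = 1 ∨ ε = -1) ∧
    (g.1 : Matrix (Fin 2) (Fin 2) ℝ) = ε • 1 ∧ g.2.1 (e 1) = ε • e 1 := by
  constructor
  · rintro ⟨B, hB, h1, h2⟩
    exact ⟨B.det, det_eq_or_of_mem_orthogonalGroup hB, h1, map_e_one_of_mat7_eq h2⟩
  · rintro ⟨ε, hε, h1, h2⟩
    refine ⟨block6 g.2, block6_mem_orthogonalGroup g.2 hε h2, ?_, ?_⟩
    · rw [det_block6 g.2 hε h2, h1]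
    · rw [det_block6 g.2 hε h2]
      exact mat7_eq_diag16_block6 g.2 hε h2

theorem exists_mat7_eq_diag214_smul_one_iff (g : G2) {ε : ℝ} (hε : ε = 1 ∨ ε = -1) :
    (∃ A, mat7 g = diag214 (ε • 1) A) ↔ g.1 (e 1) = ε • e 1 ∧ g.1 (e 3) = e 3 := by
  rw [exists_mat7_eq_diag214_iff]
  · simp
  · simp
  · simp
  · rcases hε with rfl | rfl <;> simp

theorem mem_groupHbar_iff (g : G) : g ∈ groupHbar ↔ ∃ ε δ : ℝ, (ε = 1 ∨ ε = -1) ∧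
    (δ = 1 ∨ δ = -1) ∧ (g.1 : Matrix (Fin 2) (Fin 2) ℝ) = ε • 1 ∧ g.2.1 (e 1) = δ • e 1 ∧
      g.2.1 (e 3) = e 3 := by
  constructor
  · rintro ⟨ε, δ, A, hε, hδ, h1, h2⟩
    exact ⟨ε, δ, hε, hδ, h1, (exists_mat7_eq_diag214_smul_one_iff g.2 hδ).1 ⟨A, h2⟩⟩
  · rintro ⟨ε, δ, hε, hδ, h1, h2⟩
    obtain ⟨A, hA⟩ := (exists_mat7_eq_diag214_smul_one_iff g.2 hδ).2 h2
    exact ⟨ε, δ, A, hε, hδ, h1, hA⟩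

theorem mem_groupH_iff (g : G) : g ∈ groupH ↔ ∃ ε : ℝ, (ε = 1 ∨ ε = -1) ∧
    (g.1 : Matrix (Fin 2) (Fin 2) ℝ) = ε • 1 ∧ g.2.1 (e 1) = ε • e 1 ∧ g.2.1 (e 3) = e 3 := by
  constructor
  · rintro ⟨ε, A, hε, h1, h2⟩
    exact ⟨ε, hε, h1, (exists_mat7_eq_diag214_smul_one_iff g.2 hε).1 ⟨A, h2⟩⟩
  · rintro ⟨ε, hε, h1, h2⟩
    obtain ⟨A, hA⟩ := (exists_mat7_eq_diag214_smul_one_iff g.2 hε).2 h2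
    exact ⟨ε, A, hε, h1, hA⟩

theorem coe_negOne_mul_fst (g : G) :
    ((negOne * g).1 : Matrix (Fin 2) (Fin 2) ℝ) = -(g.1 : Matrix (Fin 2) (Fin 2) ℝ) := by
  change (-1 : Matrix (Fin 2) (Fin 2) ℝ) * _ = _
  rw [neg_one_mul]

theorem negOne_mul_snd (g : G) : (negOne * g).2 = g.2 := one_mul g.2

theorem toComplex_negOne_mul (g : G) : (negOne * g).1.toComplex = -g.1.toComplex := by
  have h := fun i j => congrFun (congrFun (coe_negOne_mul_fst g) i) j
  exact Complex.ext (h 0 0) (h 0 1)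

/-- As `k` is odd, `(-γ) ^ k = -γ ^ k`; the additional sign in `diag{ε R(kθ), 1, A}` can therefore
be moved into `γ`. -/
theorem groupKbar_eq {k : ℤ} (hk : Odd k) :
    groupKbar k = {g | g ∈ groupK k ∨ negOne * g ∈ groupK k} := by
  ext g
  rw [Set.mem_ofPred_eq, mem_groupKbar_iff, mem_groupK_iff, mem_groupK_iff, negOne_mul_snd,
    toComplex_negOne_mul, hk.neg_zpow]
  constructor
  · rintro ⟨ε, rfl | rfl, h⟩
    · left; simpa using h
    · right; simpa using h
  · rintro (h | h)
    · exact ⟨1, Or.inl rfl, by simpa using h⟩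
    · exact ⟨-1, Or.inr rfl, by simpa using h⟩

/-- The sign of the rotation and the sign of `g` on `e 1` are independent here. Equal signs give
elements of `L`, opposite signs elements of `z L`. The same argument applies to `H`. -/
theorem groupLbar_eq : groupLbar = {g | g ∈ groupL ∨ negOne * g ∈ groupL} := by
  ext g
  rw [Set.mem_ofPred_eq, mem_groupLbar_iff, mem_groupL_iff, mem_groupL_iff, negOne_mul_snd,
    coe_negOne_mul_fst]
  constructor
  · rintro ⟨ε, δ, rfl | rfl, rfl | rfl, h1, h2⟩
    · exact Or.inl ⟨1, Or.inl rfl, h1, h2⟩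
    · exact Or.inr ⟨-1, Or.inr rfl, by rw [h1]; simp, h2⟩
    · exact Or.inr ⟨1, Or.inl rfl, by rw [h1]; simp, h2⟩
    · exact Or.inl ⟨-1, Or.inr rfl, h1, h2⟩
  · rintro (⟨ε, hε, h1, h2⟩ | ⟨ε, hε, h1, h2⟩)
    · exact ⟨ε, ε, hε, hε, h1, h2⟩
    · exact ⟨-ε, ε, by rcases hε with rfl | rfl <;> simp, hε,
        by rw [neg_smul, ← h1, neg_neg], h2⟩

theorem groupHbar_eq : groupHbar = {g | g ∈ groupH ∨ negOne * g ∈ groupH} := by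
  ext g
  rw [Set.mem_ofPred_eq, mem_groupHbar_iff, mem_groupH_iff, mem_groupH_iff, negOne_mul_snd,
    coe_negOne_mul_fst]
  constructor
  · rintro ⟨ε, δ, rfl | rfl, rfl | rfl, h1, h2⟩
    · exact Or.inl ⟨1, Or.inl rfl, h1, h2⟩
    · exact Or.inr ⟨-1, Or.inr rfl, by rw [h1]; simp, h2⟩
    · exact Or.inr ⟨1, Or.inl rfl, by rw [h1]; simp, h2⟩
    · exact Or.inl ⟨-1, Or.inr rfl, h1, h2⟩
  · rintro (⟨ε, hε, h1, h2⟩ | ⟨ε, hε, h1, h2⟩)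
    · exact ⟨ε, ε, hε, hε, h1, h2⟩
    · exact ⟨-ε, ε, by rcases hε with rfl | rfl <;> simp, hε,
        by rw [neg_smul, ← h1, neg_neg], h2⟩

/-! ### The isotropy groups on `S¹³_k` -/

theorem hpt_eq_chart_iff {m n : ℤ} {J : Oct} {p q : ℂ} {u : Oct} {v w : S7} :
    hpt m n J p q v = chart m n u w ↔
      q ≠ 0 ∧ cx J (p * q⁻¹) = u ∧ twist m n (cx J q) v = w := by
  by_cases hq : q = 0
  · simp [hpt, hq, chart'_zero_ne_chart]
  · simp [hpt, hq, chart_inj]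

/-- The point has homogeneous coordinates `(z, 1)` with `J = e 3`. Applying `g` and reading the
result in the first chart splits the fixed point equation into a Möbius equation on the base and a
twist equation in the fibre. -/
theorem S13.mem_stabilizer_pt {k : ℤ} (hk : Odd k) (g : G) (u₁ u₂ : ℝ) :
    g ∈ MulAction.stabilizer G (S13.pt hk u₁ u₂) ↔
      (-g.1.1 0 1 * (Complex.mk u₁ u₂) + g.1.1 0 0 : ℂ) ≠ 0 ∧
      cx (g.2.1 (e 3)) ((g.1.1 0 0 * (Complex.mk u₁ u₂) + g.1.1 0 1) *
        (-g.1.1 0 1 * (Complex.mk u₁ u₂) + g.1.1 0 0)⁻¹) = cx (e 3) (Complex.mk u₁ u₂) ∧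
      twist ((k + 1) / 2) ((-k + 1) / 2) (cx (g.2.1 (e 3)) (-g.1.1 0 1 * (Complex.mk u₁ u₂) + g.1.1 0 0))
        (g.2.sph s1) = s1 := by
  rw [MulAction.mem_stabilizer_iff, ← hpt_eq_chart_iff]
  have h : g • (S13.pt hk u₁ u₂ : Sigma15 k) = hpt _ _ (g.2.1 (e 3))
      (g.1.1 0 0 * (Complex.mk u₁ u₂) + g.1.1 0 1) (-g.1.1 0 1 * (Complex.mk u₁ u₂) + g.1.1 0 0) (g.2.sph s1) := by
    rw [S13.coe_pt, smul_hpt _ _ _ isImUnit_e_three (Or.inr one_ne_zero), mul_one, mul_one]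
  rw [← h]
  exact ⟨fun h => congrArg Subtype.val h, fun h => Subtype.ext h⟩

theorem cx_re {J : Oct} (hJ : IsImUnit J) (z : ℂ) : (cx J z) 0 = z.re := by
  simp [cx, hJ.1, one_def]

theorem twist_cx_sign {k : ℤ} (hk : Odd k) {J : Oct} (hJ : IsImUnit J) {ε : ℝ}
    (hε : ε = 1 ∨ ε = -1) (g : G2) :
    twist ((k + 1) / 2) ((-k + 1) / 2) (cx J ε) (g.sph s1) = s1 ↔ g.1 (e 1) = ε • e 1 := by
  have hs : ∀ v w : S7, v = w ↔ (v : Oct) = w := fun v w => Subtype.ext_iff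
  rcases hε with rfl | rfl
  · rw [Complex.ofReal_one, cx_one, twist_one, one_smul, hs]
    rfl
  · rw [Complex.ofReal_neg, Complex.ofReal_one, twist_neg_one (sum_eq_one hk) hJ, neg_smul,
      one_smul, neg_eq_iff_eq_neg, hs]
    rfl

theorem SO2.sign_of_entry_eq_zero {γ : SO2} (h : γ.1 0 1 = 0) :
    γ.1 0 0 = 1 ∨ γ.1 0 0 = -1 := by
  have h1 := (SO2.entries γ).2.2
  rw [h] at h1
  exact mul_self_eq_one_iff.1 (by linarith)

/-- The fixed point equation of the Möbius map is `b (1 + u₁²) = 0`, so `γ = ±1`. A real base point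
lies in every plane, hence the image of `e 3` is unrestricted. -/
theorem S13.stabilizer_pt_real {k : ℤ} (hk : Odd k) (u₁ : ℝ) :
    (MulAction.stabilizer G (S13.pt hk u₁ 0) : Set G) = groupL := by
  ext g
  rw [SetLike.mem_coe, S13.mem_stabilizer_pt, mem_groupL_iff]
  have hJ := g.2.isImUnit isImUnit_e_three
  have hz : Complex.mk u₁ 0 = (u₁ : ℂ) := rfl
  rw [hz]
  set a := g.1.1 0 0 with ha
  set b := g.1.1 0 1 with hb
  have hp : (a * u₁ + b : ℂ) = ((a * u₁ + b : ℝ) : ℂ) := by push_cast; rfl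
  have hq : (-b * u₁ + a : ℂ) = ((-b * u₁ + a : ℝ) : ℂ) := by push_cast; rfl
  constructor
  · rintro ⟨h1, h2, h3⟩
    have h4 := congrArg (fun x : Oct => x 0) h2
    simp only [cx_re hJ, cx_re isImUnit_e_three] at h4
    rw [hq] at h1
    rw [hp, hq, ← Complex.ofReal_inv, ← Complex.ofReal_mul, Complex.ofReal_re,
      Complex.ofReal_re] at h4
    have h5 : -b * u₁ + a ≠ 0 := by exact_mod_cast h1
    have h6 : a * u₁ + b = u₁ * (-b * u₁ + a) := (mul_inv_eq_iff_eq_mul₀ h5).1 h4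
    have h7 : b = 0 := by
      have : b * (1 + u₁ ^ 2) = 0 := by linear_combination h6
      rcases mul_eq_zero.1 this with h | h
      · exact h
      · nlinarith
    have h8 := SO2.sign_of_entry_eq_zero h7
    refine ⟨a, h8, (g.1.eq_smul_one_iff a).2 ⟨rfl, h7⟩, ?_⟩
    rw [← twist_cx_sign hk hJ h8]
    simpa [h7] using h3
  · rintro ⟨ε, hε, h1, h2⟩
    obtain ⟨h3, h4⟩ := (g.1.eq_smul_one_iff ε).1 h1
    have hε0 : ε ≠ 0 := by rcases hε with rfl | rfl <;> simp
    rw [show a = ε from h3, show b = 0 from h4]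
    refine ⟨by simpa using hε0, ?_, ?_⟩
    · have : ((ε : ℂ) * u₁ + (0 : ℝ)) * (-(0 : ℝ) * u₁ + ε : ℂ)⁻¹ = u₁ := by
        have : (ε : ℂ) ≠ 0 := by exact_mod_cast hε0
        simp; field_simp
      rw [this, cx_ofReal, cx_ofReal]
    · rw [← twist_cx_sign hk hJ hε] at h2
      simpa using h2

theorem S13.stabilizer_pt' {k : ℤ} (hk : Odd k) :
    (MulAction.stabilizer G (S13.pt' hk) : Set G) = groupL := by
  ext g
  rw [SetLike.mem_coe, MulAction.mem_stabilizer_iff, mem_groupL_iff]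
  have hJ := g.2.isImUnit isImUnit_e_three
  have hsm : g • (S13.pt' hk : Sigma15 k) = hpt _ _ (g.2.1 (e 3)) (g.1.1 0 0) (-g.1.1 0 1)
      (g.2.sph s1) := by
    rw [S13.coe_pt', smul_hpt _ _ _ isImUnit_e_three (Or.inl one_ne_zero)]
    simp
  have hiff : g • S13.pt' hk = S13.pt' hk ↔ hpt ((k + 1) / 2) ((-k + 1) / 2) (g.2.1 (e 3))
      (g.1.1 0 0) (-g.1.1 0 1) (g.2.sph s1) = chart' _ _ 0 s1 := by
    rw [← hsm]
    exact ⟨fun h => congrArg Subtype.val h, fun h => Subtype.ext h⟩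
  rw [hiff]
  constructor
  · intro h
    have hb : g.1.1 0 1 = 0 := by
      by_contra hne
      have h0 : -(g.1.1 0 1 : ℂ) ≠ 0 := by simpa using hne
      -- For `b ≠ 0` the image leaves the fibre over `u' = 0`: it lies over `u = 0` if `a = 0`, and
      -- over a nonzero `u'` otherwise.
      by_cases ha : g.1.1 0 0 = 0
      · rw [hpt, if_pos h0, ha, Complex.ofReal_zero, zero_mul, cx_zero] at h
        exact chart_zero_ne_chart' h
      · have ha' : (g.1.1 0 0 : ℂ) ≠ 0 := by exact_mod_cast ha
        rw [hpt_eq_chart' _ _ hJ _ ha', chart'_inj] at h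
        have h1 : (-(g.1.1 0 1 : ℂ)) * (g.1.1 0 0 : ℂ)⁻¹ = 0 := by
          by_contra hn
          exact conj_ne_zero (x := cx _ _) (by rwa [Ne, cx_eq_zero hJ]) h.1
        rcases mul_eq_zero.1 h1 with h1 | h1
        · exact h0 h1
        · exact inv_ne_zero ha' h1
    have hs := SO2.sign_of_entry_eq_zero hb
    refine ⟨_, hs, (g.1.eq_smul_one_iff _).2 ⟨rfl, hb⟩, ?_⟩
    rw [← twist_cx_sign hk hJ hs]
    rw [hpt, if_neg (by simp [hb]), chart'_inj] at h
    exact h.2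
  · rintro ⟨ε, hε, h1, h2⟩
    obtain ⟨h3, h4⟩ := (g.1.eq_smul_one_iff ε).1 h1
    rw [hpt, if_neg (by simp [h4]), chart'_inj, h3]
    exact ⟨rfl, (twist_cx_sign hk hJ hε g.2).2 h2⟩

/-- Off the real line a Cayley number determines its plane, and requiring a positive imaginary part
excludes the other choice `(-J, z̄)`. -/
theorem cx_eq_cx_of_im_pos {J J' : Oct} (hJ : IsImUnit J) (hJ' : IsImUnit J') {z w : ℂ}
    (hz : 0 < z.im) (hw : 0 < w.im) : cx J z = cx J' w ↔ z = w ∧ J = J' := by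
  refine ⟨fun h => ?_, fun ⟨h, h'⟩ => by rw [h, h']⟩
  have h1 := congrArg (fun x : Oct => x 0) h
  simp only [cx_re hJ, cx_re hJ'] at h1
  have h2 := congrArg (fun x : Oct => ‖im x‖) h
  simp only [norm_im_cx hJ, norm_im_cx hJ', abs_of_pos hz, abs_of_pos hw] at h2
  have h3 : z = w := Complex.ext h1 h2
  refine ⟨h3, ?_⟩
  have h4 := congrArg im h
  rw [im_cx hJ, im_cx hJ', h2] at h4
  exact smul_right_injective Oct hw.ne' h4

theorem SO2.moebius_ne_zero_and_im_pos (γ : SO2) {z : ℂ} (hz : 0 < z.im) :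
    (-γ.1 0 1 * z + γ.1 0 0 : ℂ) ≠ 0 ∧
      0 < ((γ.1 0 0 * z + γ.1 0 1) * (-γ.1 0 1 * z + γ.1 0 0 : ℂ)⁻¹).im := by
  obtain ⟨-, -, hab⟩ := SO2.entries γ
  have hq : (-γ.1 0 1 * z + γ.1 0 0 : ℂ) ≠ 0 := by
    intro h
    have h1 := congrArg Complex.im h
    have h2 := congrArg Complex.re h
    simp [hz.ne'] at h1 h2
    rw [h1] at h2 hab
    simp at h2
    rw [h2] at hab
    norm_num at hab
  refine ⟨hq, ?_⟩
  have hn := Complex.normSq_pos.2 hq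
  rw [Complex.mul_im, Complex.inv_re, Complex.inv_im]
  have : ((γ.1 0 0 * z + γ.1 0 1 : ℂ).re * (-(-γ.1 0 1 * z + γ.1 0 0 : ℂ).im /
      Complex.normSq (-γ.1 0 1 * z + γ.1 0 0)) + (γ.1 0 0 * z + γ.1 0 1 : ℂ).im *
      ((-γ.1 0 1 * z + γ.1 0 0 : ℂ).re / Complex.normSq (-γ.1 0 1 * z + γ.1 0 0)))
      = z.im / Complex.normSq (-γ.1 0 1 * z + γ.1 0 0) := by
    rw [mul_div_assoc', mul_div_assoc', ← add_div]
    congr 1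
    simp
    linear_combination z.im * hab
  rw [this]
  exact div_pos hz hn

theorem S13.stabilizer_pt_of_pos {k : ℤ} (hk : Odd k) {u₁ u₂ : ℝ} (hu : 0 < u₂)
    (hne : (u₁, u₂) ≠ (0, 1)) :
    (MulAction.stabilizer G (S13.pt hk u₁ u₂) : Set G) = groupH := by
  ext g
  rw [SetLike.mem_coe, S13.mem_stabilizer_pt, mem_groupH_iff]
  have hJ := g.2.isImUnit isImUnit_e_three
  set z := Complex.mk u₁ u₂ with hz
  have hzim : 0 < z.im := hu
  obtain ⟨hq, him⟩ := g.1.moebius_ne_zero_and_im_pos hzim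
  rw [cx_eq_cx_of_im_pos hJ isImUnit_e_three him hzim, mul_inv_eq_iff_eq_mul₀ hq]
  constructor
  · rintro ⟨-, ⟨h2, h3⟩, h4⟩
    have hb : g.1.1 0 1 = 0 := by
      -- The only zero of `1 + z²` in the upper half-plane is `i`, which is the excluded point `(0,
      -- 1)`.
      have h5 : (g.1.1 0 1 : ℂ) * (1 + z * z) = 0 := by linear_combination h2
      rcases mul_eq_zero.1 h5 with h | h
      · exact_mod_cast h
      · exfalso
        have h6 := congrArg Complex.im h
        have h7 := congrArg Complex.re h
        simp [hz] at h6 h7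
        have h8 : u₁ = 0 := by nlinarith
        rw [h8] at h7
        have h9 : u₂ = 1 := by nlinarith
        exact hne (by rw [h8, h9])
    have hs := SO2.sign_of_entry_eq_zero hb
    refine ⟨_, hs, (g.1.eq_smul_one_iff _).2 ⟨rfl, hb⟩, ?_, h3⟩
    rw [← twist_cx_sign hk hJ hs]
    simpa [hb] using h4
  · rintro ⟨ε, hε, h1, h2, h3⟩
    obtain ⟨h4, h5⟩ := (g.1.eq_smul_one_iff ε).1 h1
    rw [← twist_cx_sign hk hJ hε] at h2
    refine ⟨hq, ⟨?_, h3⟩, ?_⟩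
    · rw [h4, h5]; simp [mul_comm]
    · rw [h4, h5]; simpa using h2

theorem cx_e_three_mul_e_one (z : ℂ) : cx (e 3) z * e 1 = z.re • e 1 + z.im • e 2 := by
  rw [cx, add_mul', Oct.smul_mul', Oct.smul_mul', one_mul', e_three_mul_e_one]

theorem e_one_mul_cx_e_three (z : ℂ) : e 1 * cx (e 3) z = cx (e 3) (starRingEnd ℂ z) * e 1 := by
  apply ext8 <;> simp [mul_def, mul, cx, e, one_def]

/-- Since `e 1` anticommutes with `e 3`, moving `w ^ n` across `e 1` conjugates it, that is, inverts
it for `|w| = 1`. So `w ^ m e₁ w ^ n = w ^ (m - n) e₁`, and `m - n = k`. -/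
theorem coe_twist_s1 {k : ℤ} (hk : Odd k) {w : ℂ} (hw : ‖w‖ = 1) :
    (twist ((k + 1) / 2) ((-k + 1) / 2) (cx (e 3) w) s1 : Oct)
      = (w ^ k).re • e 1 + (w ^ k).im • e 2 := by
  have h0 : w ≠ 0 := by rw [← norm_ne_zero_iff, hw]; exact one_ne_zero
  have hconj : starRingEnd ℂ w = w⁻¹ := by
    rw [Complex.inv_def, Complex.normSq_eq_norm_sq, hw]; simp
  rw [coe_twist_cx _ _ isImUnit_e_three h0, hw, one_zpow, inv_one, one_smul]
  change (cx (e 3) _ * e 1) * _ = _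
  rw [cx_mul_mul_cx, e_one_mul_cx_e_three, cx_mul_cx_mul isImUnit_e_three, map_zpow₀, hconj,
    inv_zpow', ← zpow_add₀ h0, cx_e_three_mul_e_one]
  have : (k + 1) / 2 + -((-k + 1) / 2) = k := by
    obtain ⟨j, rfl⟩ := hk
    omega
  rw [this]

theorem S13.stabilizer_pt_one {k : ℤ} (hk : Odd k) :
    (MulAction.stabilizer G (S13.pt hk 0 1) : Set G) = groupK k := by
  ext g
  rw [SetLike.mem_coe, S13.mem_stabilizer_pt, mem_groupK_iff]
  have hJ := g.2.isImUnit isImUnit_e_three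
  obtain ⟨hq, him⟩ := g.1.moebius_ne_zero_and_im_pos (z := Complex.mk 0 1) one_pos
  rw [cx_eq_cx_of_im_pos hJ isImUnit_e_three him one_pos, mul_inv_eq_iff_eq_mul₀ hq]
  have h1 : (g.1.1 0 0 * Complex.mk 0 1 + g.1.1 0 1 : ℂ)
      = Complex.mk 0 1 * (-g.1.1 0 1 * Complex.mk 0 1 + g.1.1 0 0) := by
    apply Complex.ext <;> simp
  have h0 := g.1.toComplex_ne_zero
  -- At `z = i` the Möbius denominator is `a - b i`, the inverse of the unit complex number of `γ`.
  -- The fibre equation is thus a twist by `γ⁻¹`, undone by twisting with `γ`.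
  have hinv : (-g.1.1 0 1 * Complex.mk 0 1 + g.1.1 0 0 : ℂ) = g.1.toComplex⁻¹ := by
    rw [Complex.inv_def, Complex.normSq_eq_norm_sq, g.1.norm_toComplex]
    apply Complex.ext <;> simp [SO2.toComplex]
  have h2 : g.2.1 (e 3) = e 3 → (twist ((k + 1) / 2) ((-k + 1) / 2) (cx (g.2.1 (e 3))
      (-g.1.1 0 1 * Complex.mk 0 1 + g.1.1 0 0)) (g.2.sph s1) = s1 ↔
      g.2.1 (e 1) = (g.1.toComplex ^ k).re • e 1 + (g.1.toComplex ^ k).im • e 2) := by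
    intro h
    rw [h, hinv, ← coe_twist_s1 hk g.1.norm_toComplex]
    have h3 : g.2.1 (e 1) = (g.2.sph s1 : Oct) := rfl
    rw [h3, ← Subtype.ext_iff]
    constructor
    · intro h4
      conv_rhs => rw [← h4, twist_twist _ _ isImUnit_e_three h0 (inv_ne_zero h0),
        mul_inv_cancel₀ h0, cx_one, twist_one]
    · intro h4
      rw [h4, twist_twist _ _ isImUnit_e_three (inv_ne_zero h0) h0, inv_mul_cancel₀ h0, cx_one,
        twist_one]
  constructor
  · rintro ⟨-, ⟨-, h3⟩, h4⟩
    exact ⟨(h2 h3).1 h4, h3⟩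
  · rintro ⟨h4, h3⟩
    exact ⟨hq, ⟨h1, h3⟩, (h2 h3).2 h4⟩

theorem P13.stabilizer_mk {k : ℤ} {hk : Odd k} {x : S13 k hk} {S : Set G}
    (h : (MulAction.stabilizer G x : Set G) = S) :
    (MulAction.stabilizer G (P13.mk x) : Set G) = {g | g ∈ S ∨ negOne * g ∈ S} := by
  ext g
  subst h
  exact P13.mem_stabilizer g x

/-! ### The structure of `K`, `L` and `H` -/

theorem mem_SU2_iff (g : G2) : g ∈ SU2 ↔ g.1 (e 1) = e 1 ∧ g.1 (e 3) = e 3 := Iff.rfl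

theorem G2.rotA_mul (c s c' s' : ℝ) (h : c ^ 2 + s ^ 2 = 1) (h' : c' ^ 2 + s' ^ 2 = 1) (h'') :
    G2.rotA c s h * G2.rotA c' s' h' = G2.rotA (c * c' - s * s') (c * s' + s * c') h'' := by
  apply Subtype.ext
  apply LinearEquiv.ext
  intro x
  change (G2.rotA c s h).1 ((G2.rotA c' s' h').1 x) = _
  apply ext8 <;> simp [G2.rotA] <;> ring

theorem SO2.re_sq_add_im_sq_zpow (γ : SO2) (k : ℤ) :
    (γ.toComplex ^ k).re ^ 2 + (γ.toComplex ^ k).im ^ 2 = 1 := by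
  have h : ‖γ.toComplex ^ k‖ ^ 2 = 1 := by rw [norm_zpow, γ.norm_toComplex, one_zpow, one_pow]
  rw [← Complex.normSq_eq_norm_sq, Complex.normSq_apply] at h
  linarith

/-- The homomorphism from `SO(2)` to `G₂` that rotates the planes of `e 1, e 2` and of `e 5, e 6`
with weight `k`. -/
def rotHom (k : ℤ) : SO2 →* G2 where
  toFun γ := G2.rotA (γ.toComplex ^ k).re (γ.toComplex ^ k).im (γ.re_sq_add_im_sq_zpow k)
  map_one' := by
    apply Subtype.ext
    apply LinearEquiv.ext
    intro x
    apply ext8 <;> simp [G2.rotA, SO2.toComplex_one]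
  map_mul' γ δ := by
    have h := SO2.re_sq_add_im_sq_zpow (γ * δ) k
    simp only [SO2.toComplex_mul, mul_zpow, Complex.mul_re, Complex.mul_im] at h ⊢
    rw [G2.rotA_mul]

theorem continuous_rotHom (k : ℤ) : Continuous (rotHom k) := by
  refine G2.continuous_of_apply fun x => ?_
  have h : Continuous fun γ : SO2 => γ.toComplex ^ k :=
    SO2.continuous_toComplex.zpow₀ k fun γ => Or.inl γ.toComplex_ne_zero
  have hre := Complex.continuous_re.comp h
  have him := Complex.continuous_im.comp h
  refine (PiLp.continuous_toLp 2 _).comp (continuous_pi fun i => ?_)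
  simp only [Function.comp_def] at hre him
  fin_cases i <;> simp <;> fun_prop

theorem rotHom_e_one (k : ℤ) (γ : SO2) : (rotHom k γ).1 (e 1)
    = (γ.toComplex ^ k).re • e 1 + (γ.toComplex ^ k).im • e 2 := by
  apply ext8 <;> simp [rotHom, G2.rotA, e]

theorem rotHom_e_three (k : ℤ) (γ : SO2) : (rotHom k γ).1 (e 3) = e 3 := by
  apply ext8 <;> simp [rotHom, G2.rotA, e]

/-- A left coset of the joint stabilizer of `e 1` and `e 3` is determined by the images of these two
vectors. -/
theorem exists_mul_SU2_iff (t g : G2) : (∃ s ∈ SU2, g = t * s) ↔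
    g.1 (e 1) = t.1 (e 1) ∧ g.1 (e 3) = t.1 (e 3) := by
  constructor
  · rintro ⟨s, hs, rfl⟩
    obtain ⟨h1, h3⟩ := (mem_SU2_iff s).1 hs
    exact ⟨congrArg t.1 h1, congrArg t.1 h3⟩
  · rintro ⟨h1, h3⟩
    refine ⟨t⁻¹ * g, (mem_SU2_iff _).2 ⟨?_, ?_⟩, by group⟩
    · exact (t.1.symm_apply_eq).2 h1
    · exact (t.1.symm_apply_eq).2 h3

theorem groupK_eq_rotHom_mul (k : ℤ) :
    groupK k = {g | ∃ s ∈ SU2, g.2 = rotHom k g.1 * s} := by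
  ext g
  rw [Set.mem_ofPred_eq, exists_mul_SU2_iff, rotHom_e_one, rotHom_e_three, mem_groupK_iff]

/-- The first component is recovered from the second: it is the sign in `g e₁ = ± e₁`. -/
theorem bijOn_snd_groupL : Set.BijOn Prod.snd groupL O6 := by
  refine ⟨?_, ?_, ?_⟩
  · intro g hg
    obtain ⟨ε, hε, -, h⟩ := (mem_groupL_iff g).1 hg
    rcases hε with rfl | rfl
    · left; simpa using h
    · right; simpa using h
  · intro g hg g' hg' h
    obtain ⟨ε, hε, h1, h2⟩ := (mem_groupL_iff g).1 hg
    obtain ⟨ε', hε', h1', h2'⟩ := (mem_groupL_iff g').1 hg'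
    refine Prod.ext (Subtype.ext ?_) h
    change g.2 = g'.2 at h
    rw [h, h2'] at h2
    have h3 := congrArg (fun x : Oct => x 1) h2
    simp [e] at h3
    rw [h1, h1', h3]
  · intro g hg
    rcases hg with h | h
    · refine ⟨(1, g), (mem_groupL_iff _).2 ⟨1, Or.inl rfl, ?_, ?_⟩, rfl⟩
      · simp
      · simpa using h
    · refine ⟨(SO2.negOne, g), (mem_groupL_iff _).2 ⟨-1, Or.inr rfl, ?_, ?_⟩, rfl⟩
      · simp [SO2.negOne]
      · simpa using h

theorem exists_groupH_eq : ∃ τ : G2, τ * τ = 1 ∧ groupH =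
    {g : G | (g.1 = 1 ∧ g.2 ∈ SU2) ∨
      ((g.1 : Matrix (Fin 2) (Fin 2) ℝ) = -1 ∧ ∃ s ∈ SU2, g.2 = τ * s)} := by
  have h0 : (-1 : ℝ) ^ 2 + 0 ^ 2 = 1 := by norm_num
  have hτ1 : (G2.rotA (-1) 0 h0).1 (e 1) = -e 1 := by apply ext8 <;> simp [G2.rotA, e]
  have hτ3 : (G2.rotA (-1) 0 h0).1 (e 3) = e 3 := by apply ext8 <;> simp [G2.rotA, e]
  refine ⟨G2.rotA (-1) 0 h0, ?_, ?_⟩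
  · rw [G2.rotA_mul _ _ _ _ _ _ (by norm_num)]
    apply Subtype.ext
    apply LinearEquiv.ext
    intro x
    apply ext8 <;> simp [G2.rotA]
  · ext g
    rw [Set.mem_ofPred_eq, mem_groupH_iff, exists_mul_SU2_iff, mem_SU2_iff, hτ1, hτ3]
    constructor
    · rintro ⟨ε, rfl | rfl, h1, h2, h3⟩
      · left
        exact ⟨Subtype.ext (by simpa using h1), by simpa using h2, h3⟩
      · right
        exact ⟨by simpa using h1, by simpa using h2, h3⟩
    · rintro (⟨h1, h2, h3⟩ | ⟨h1, h2, h3⟩)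
      · exact ⟨1, Or.inl rfl, by simp [h1], by simpa using h2, h3⟩
      · exact ⟨-1, Or.inr rfl, by simp [h1], by simpa using h2, h3⟩

/-! ### The stabilizer of `e 1` and `e 3` as the group of unit quaternions -/

theorem specialUnitaryGroup_entries (M : Matrix.specialUnitaryGroup (Fin 2) ℂ) :
    M.1 1 0 = -starRingEnd ℂ (M.1 0 1) ∧ M.1 1 1 = starRingEnd ℂ (M.1 0 0) ∧
      (M.1 0 0).re ^ 2 + (M.1 0 0).im ^ 2 + (M.1 0 1).re ^ 2 + (M.1 0 1).im ^ 2 = 1 := by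
  obtain ⟨A, hA⟩ := M
  obtain ⟨h1, h2⟩ := Matrix.mem_specialUnitaryGroup_iff.1 hA
  have h3 := Matrix.mem_unitaryGroup_iff.1 h1
  have h00 := congrFun (congrFun h3 0) 0
  have h10 := congrFun (congrFun h3 1) 0
  simp [Matrix.mul_apply, Fin.sum_univ_two, Matrix.star_apply] at h00 h10
  rw [Matrix.det_fin_two] at h2
  refine ⟨?_, ?_, ?_⟩
  · linear_combination (-A 1 0) * h00 + A 0 0 * h10 - starRingEnd ℂ (A 0 1) * h2
  · linear_combination (-A 1 1) * h00 + A 0 1 * h10 + starRingEnd ℂ (A 0 0) * h2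
  · have h := congrArg Complex.re h00
    simp at h
    linear_combination h

/-- The matrix of the unit quaternion `a + b i + c j + d k`. -/
def quatMatrix (a b c d : ℝ) (h : a ^ 2 + b ^ 2 + c ^ 2 + d ^ 2 = 1) :
    Matrix.specialUnitaryGroup (Fin 2) ℂ :=
  ⟨!![⟨a, b⟩, ⟨c, d⟩; ⟨-c, d⟩, ⟨a, -b⟩], by
    rw [Matrix.mem_specialUnitaryGroup_iff, Matrix.mem_unitaryGroup_iff]
    constructor
    · ext i j
      fin_cases i <;> fin_cases j <;>
        simp [Matrix.mul_apply, Fin.sum_univ_two, Matrix.star_apply] <;>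
        apply Complex.ext <;> simp <;> first | linear_combination h | ring
    · rw [Matrix.det_fin_two]
      apply Complex.ext <;> simp <;> first | linear_combination h | ring⟩

/-- The parameters multiply like quaternions. The product has its own variables, tied by equations,
so that entries of a matrix product can be inserted directly. -/
theorem G2.quat_mul {a b c d a' b' c' d' a'' b'' c'' d'' : ℝ} (h h' h'')
    (ha : a'' = a * a' - b * b' - c * c' - d * d') (hb : b'' = a * b' + b * a' + c * d' - d * c')
    (hc : c'' = a * c' - b * d' + c * a' + d * b')
    (hd : d'' = a * d' + b * c' - c * b' + d * a') :
    G2.quat a b c d h * G2.quat a' b' c' d' h' = G2.quat a'' b'' c'' d'' h'' := by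
  subst ha hb hc hd
  apply Subtype.ext
  apply LinearEquiv.ext
  intro x
  change (G2.quat a b c d h).1 ((G2.quat a' b' c' d' h').1 x) = _
  apply ext8 <;> simp [G2.quat] <;> ring

theorem quat_mem_SU2 (a b c d : ℝ) (h : a ^ 2 + b ^ 2 + c ^ 2 + d ^ 2 = 1) :
    G2.quat a b c d h ∈ SU2 := by
  rw [mem_SU2_iff]
  constructor <;> apply ext8 <;> simp [G2.quat, e]

theorem quat_e_four (a b c d : ℝ) (h : a ^ 2 + b ^ 2 + c ^ 2 + d ^ 2 = 1) :
    (G2.quat a b c d h).1 (e 4) = !₂[0, 0, 0, 0, a, b, c, d] := by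
  apply ext8 <;> simp [G2.quat, e]

theorem SU2_map_e_four {g : G2} (hg : g ∈ SU2) :
    (g.1 (e 4)) 0 = 0 ∧ (g.1 (e 4)) 1 = 0 ∧ (g.1 (e 4)) 2 = 0 ∧ (g.1 (e 4)) 3 = 0 ∧
      (g.1 (e 4)) 4 ^ 2 + (g.1 (e 4)) 5 ^ 2 + (g.1 (e 4)) 6 ^ 2 + (g.1 (e 4)) 7 ^ 2 = 1 := by
  obtain ⟨h1, h3⟩ := (mem_SU2_iff g).1 hg
  have h2 : g.1 (e 2) = e 2 := by rw [g.map_e_two, h1, h3, e_three_mul_e_one]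
  have c0 : (g.1 (e 4)) 0 = 0 := g.map_e_apply_zero 3
  have c1 := g.apply_coord_eq_zero (i := 4) h1 (by simp [e])
  have c2 := g.apply_coord_eq_zero (i := 4) h2 (by simp [e])
  have c3 := g.apply_coord_eq_zero (i := 4) h3 (by simp [e])
  refine ⟨c0, c1, c2, c3, ?_⟩
  have hn : ‖g.1 (e 4)‖ ^ 2 = 1 := by rw [g.norm_map]; simp [e]
  rw [norm_sq_eq, c0, c1, c2, c3] at hn
  linarith

/-- An automorphism fixing `e 1` and `e 3` is determined by the image of `e 4`, a unit vector in the
span of `e 4, …, e 7`. Its coordinates are the quaternion parameters. -/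
theorem eq_quat_of_mem_SU2 {g : G2} (hg : g ∈ SU2) :
    g = G2.quat _ _ _ _ (SU2_map_e_four hg).2.2.2.2 := by
  obtain ⟨h1, h3⟩ := (mem_SU2_iff g).1 hg
  obtain ⟨h1', h3'⟩ := (mem_SU2_iff _).1 (quat_mem_SU2 _ _ _ _ (SU2_map_e_four hg).2.2.2.2)
  obtain ⟨c0, c1, c2, c3, -⟩ := SU2_map_e_four hg
  apply G2.ext_e
  · rw [h1, h1']
  · rw [h3, h3']
  · rw [quat_e_four]
    apply ext8 <;> simp [c0, c1, c2, c3]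

/-- The subgroup of `G₂` fixing `e 1` and `e 3` is the special unitary group of degree `2`. -/
def specialUnitaryEquiv : Matrix.specialUnitaryGroup (Fin 2) ℂ ≃ₜ* SU2 where
  toFun M := ⟨G2.quat (M.1 0 0).re (M.1 0 0).im (M.1 0 1).re (M.1 0 1).im
    (specialUnitaryGroup_entries M).2.2, quat_mem_SU2 _ _ _ _ _⟩
  -- The parameters are read off from `g (e 4)`, which also makes the inverse continuous.
  invFun g := quatMatrix _ _ _ _ (SU2_map_e_four g.2).2.2.2.2
  left_inv M := by
    obtain ⟨h1, h2, -⟩ := specialUnitaryGroup_entries M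
    apply Subtype.ext
    ext i j
    fin_cases i <;> fin_cases j
    · simp [quatMatrix, quat_e_four]
    · simp [quatMatrix, quat_e_four]
    · refine Eq.trans ?_ h1.symm
      apply Complex.ext <;> simp [quatMatrix, quat_e_four]
    · refine Eq.trans ?_ h2.symm
      apply Complex.ext <;> simp [quatMatrix, quat_e_four]
  right_inv g := Subtype.ext (eq_quat_of_mem_SU2 g.2).symm
  map_mul' M N := by
    obtain ⟨h1, h2, -⟩ := specialUnitaryGroup_entries N
    have e0 : (M * N).1 0 0 = M.1 0 0 * N.1 0 0 + M.1 0 1 * N.1 1 0 := by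
      simp [Matrix.mul_apply, Fin.sum_univ_two]
    have e1 : (M * N).1 0 1 = M.1 0 0 * N.1 0 1 + M.1 0 1 * N.1 1 1 := by
      simp [Matrix.mul_apply, Fin.sum_univ_two]
    rw [h1] at e0
    rw [h2] at e1
    have f0 := congrArg Complex.re e0
    have f1 := congrArg Complex.im e0
    have f2 := congrArg Complex.re e1
    have f3 := congrArg Complex.im e1
    simp only [Complex.add_re, Complex.add_im, Complex.mul_re, Complex.mul_im, Complex.neg_re,
      Complex.neg_im, Complex.conj_re, Complex.conj_im] at f0 f1 f2 f3
    refine Subtype.ext (G2.quat_mul (specialUnitaryGroup_entries M).2.2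
      (specialUnitaryGroup_entries N).2.2 (specialUnitaryGroup_entries (M * N)).2.2
      ?_ ?_ ?_ ?_).symm
    · rw [f0]; ring
    · rw [f1]; ring
    · rw [f2]; ring
    · rw [f3]; ring
  continuous_toFun := by
    refine Continuous.subtype_mk (G2.continuous_of_apply fun x => ?_) _
    have h : ∀ i j, Continuous fun M : Matrix.specialUnitaryGroup (Fin 2) ℂ => M.1 i j :=
      fun i j => (continuous_apply_apply i j).comp continuous_subtype_val
    have h00r := Complex.continuous_re.comp (h 0 0)
    have h00i := Complex.continuous_im.comp (h 0 0)
    have h01r := Complex.continuous_re.comp (h 0 1)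
    have h01i := Complex.continuous_im.comp (h 0 1)
    simp only [Function.comp_def] at h00r h00i h01r h01i
    refine (PiLp.continuous_toLp 2 _).comp (continuous_pi fun i => ?_)
    fin_cases i <;> simp <;> fun_prop
  continuous_invFun := by
    refine Continuous.subtype_mk ?_ _
    have h : ∀ i : Fin 8, Continuous fun g : SU2 => (g.1.1 (e 4)) i := fun i =>
      (EuclideanSpace.proj (𝕜 := ℝ) i).continuous.comp
        ((G2.continuous_apply (e 4)).comp continuous_subtype_val)
    have hc : ∀ {f₁ f₂ : SU2 → ℝ}, Continuous f₁ → Continuous f₂ →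
        Continuous fun g => Complex.mk (f₁ g) (f₂ g) := fun h₁ h₂ =>
      Complex.equivRealProdCLM.symm.continuous.comp (h₁.prodMk h₂)
    refine continuous_matrix fun i j => ?_
    fin_cases i <;> fin_cases j
    · exact hc (h 4) (h 5)
    · exact hc (h 6) (h 7)
    · exact hc (h 6).neg (h 7)
    · exact hc (h 4) (h 5).neg

end Shimada

end

theorem theorem3p3 (k : ℤ) (hk : Odd k) :
    -- the action on `S¹³_k` has cohomogeneity one
    Shimada.IsCohomogeneityOne (Shimada.S13 k hk) (fun t => Shimada.S13.pt hk 0 t) ∧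
    -- the isotropy groups on `S¹³_k`
    (MulAction.stabilizer Shimada.G (Shimada.S13.pt hk 0 1) : Set Shimada.G)
      = Shimada.groupK k ∧
    (∀ u₁ : ℝ, (MulAction.stabilizer Shimada.G (Shimada.S13.pt hk u₁ 0) : Set Shimada.G)
      = Shimada.groupL) ∧
    (MulAction.stabilizer Shimada.G (Shimada.S13.pt' hk) : Set Shimada.G) = Shimada.groupL ∧
    (∀ u₁ u₂ : ℝ, 0 < u₂ → (u₁, u₂) ≠ (0, 1) →
      (MulAction.stabilizer Shimada.G (Shimada.S13.pt hk u₁ u₂) : Set Shimada.G)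
        = Shimada.groupH) ∧
    -- `K = SO(2) SU(2)`, `L = O(6) ∩ G₂` and `H = ℤ₂ · SU(2)`
    Nonempty (Shimada.SU2 ≃ₜ* Matrix.specialUnitaryGroup (Fin 2) ℂ) ∧
    (∃ σ : Shimada.SO2 →* Shimada.G2, Continuous σ ∧
      Shimada.groupK k = {g | ∃ s ∈ Shimada.SU2, g.2 = σ g.1 * s}) ∧
    Set.BijOn Prod.snd Shimada.groupL Shimada.O6 ∧
    (∃ τ : Shimada.G2, τ * τ = 1 ∧ Shimada.groupH =
      {g | (g.1 = 1 ∧ g.2 ∈ Shimada.SU2) ∨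
        ((g.1 : Matrix (Fin 2) (Fin 2) ℝ) = -1 ∧ ∃ s ∈ Shimada.SU2, g.2 = τ * s)}) ∧
    -- the induced action on `P¹³_k`
    Shimada.IsCohomogeneityOne (Shimada.P13 k hk)
      (fun t => Shimada.P13.mk (Shimada.S13.pt hk 0 t)) ∧
    (MulAction.stabilizer Shimada.G (Shimada.P13.mk (Shimada.S13.pt hk 0 1)) : Set Shimada.G)
      = Shimada.groupKbar k ∧
    (∀ u₁ : ℝ,
      (MulAction.stabilizer Shimada.G (Shimada.P13.mk (Shimada.S13.pt hk u₁ 0)) : Set Shimada.G)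
        = Shimada.groupLbar) ∧
    (MulAction.stabilizer Shimada.G (Shimada.P13.mk (Shimada.S13.pt' hk)) : Set Shimada.G)
      = Shimada.groupLbar ∧
    (∀ u₁ u₂ : ℝ, 0 < u₂ → (u₁, u₂) ≠ (0, 1) →
      (MulAction.stabilizer Shimada.G (Shimada.P13.mk (Shimada.S13.pt hk u₁ u₂)) : Set Shimada.G)
        = Shimada.groupHbar) ∧
    -- these groups are the extensions of `K`, `L`, `H` by `ℤ₂ = {(±1, 1)}`
    (∃ z : Shimada.G, (z.1 : Matrix (Fin 2) (Fin 2) ℝ) = -1 ∧ z.2 = 1 ∧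
      Shimada.groupKbar k = {g | g ∈ Shimada.groupK k ∨ z * g ∈ Shimada.groupK k} ∧
      Shimada.groupLbar = {g | g ∈ Shimada.groupL ∨ z * g ∈ Shimada.groupL} ∧
      Shimada.groupHbar = {g | g ∈ Shimada.groupH ∨ z * g ∈ Shimada.groupH}) := by
  refine ⟨Shimada.S13.isCohomogeneityOne hk, Shimada.S13.stabilizer_pt_one hk,
    Shimada.S13.stabilizer_pt_real hk, Shimada.S13.stabilizer_pt' hk,
    fun u₁ u₂ hu hne => Shimada.S13.stabilizer_pt_of_pos hk hu hne,
    ⟨Shimada.specialUnitaryEquiv.symm⟩,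
    ⟨Shimada.rotHom k, Shimada.continuous_rotHom k, Shimada.groupK_eq_rotHom_mul k⟩,
    Shimada.bijOn_snd_groupL, Shimada.exists_groupH_eq, Shimada.P13.isCohomogeneityOne hk,
    ?_, ?_, ?_, ?_, Shimada.negOne, rfl, rfl, Shimada.groupKbar_eq hk, Shimada.groupLbar_eq,
    Shimada.groupHbar_eq⟩
  · rw [Shimada.groupKbar_eq hk]
    exact Shimada.P13.stabilizer_mk (Shimada.S13.stabilizer_pt_one hk)
  · intro u₁
    rw [Shimada.groupLbar_eq]
    exact Shimada.P13.stabilizer_mk (Shimada.S13.stabilizer_pt_real hk u₁)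
  · rw [Shimada.groupLbar_eq]
    exact Shimada.P13.stabilizer_mk (Shimada.S13.stabilizer_pt' hk)
  · intro u₁ u₂ hu hne
    rw [Shimada.groupHbar_eq]
    exact Shimada.P13.stabilizer_mk (Shimada.S13.stabilizer_pt_of_pos hk hu hne)
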